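/- **Setting.** Identify $\mathbf R^2$ with $\mathbf C$. For masses $m_1,\dots,m_n>0$ with $\sum_i m_i=1$, consider the planar $n$-body problem with Hamiltonian $H(p,q)=\sum_i\frac{|p_i|^2}{2m_i}-U(q)$, $U(q)=\sum_{i<j}\frac{m_im_j}{|q_i-q_j|}$. A central configuration is a collision-free $q\in\mathbf C^n$ such that, for some $\lambda\in\mathbf R$, $\frac{\partial U}{\partial q_i}(q)=-\lambda m_i(q_i-q_c)$ for all $i$, where $q_c=\sum_i m_iq_i$; its normalization $a=(a_1,\dots,a_n)$ is the translate and positive multiple of $q$ with $\sum_i m_ia_i=0$, $\sum_i m_i|a_i|^2=1$. Put $\mu=U(a)$. For $e\in[0,1)$ and $p>0$ the elliptic relative equilibrium (ERE) with eccentricity $e$ is $q_i(t)=r(t)e^{\sqrt{-1}\,\theta(t)}a_i$, $p_i=m_i\dot q_i$, where $r=\frac{p}{1+e\cos\theta}$ and $r^2\dot\theta=\sqrt{\mu p}$. The linearized Hamiltonian system at the ERE is $\dot\zeta=JH''(p(t),q(t))\zeta$, $J=\begin{pmatrix}0&-I\\ I&0\end{pmatrix}$. Let $V\in\mathbf C^{n\times(n-1)}$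 have first column $a$ and columns that are orthogonal to $(1,\dots,1)^T$ and orthonormal for $\sum_i m_i\overline{u_i}v_i$, and let $\sigma=(\mu p)^{1/4}$. Such a $V$ gives the linear change of coordinates $(Z,z)\mapsto(p,q)$ on $\mathbf C^{n-1}\times\mathbf C^{n-1}=\mathbf R^{4(n-1)}$, $$q=\tfrac{r}{\sigma}\,e^{\sqrt{-1}\,\theta}\,Vz,\qquad p=\mathrm{diag}(m_1,\dots,m_n)\,e^{\sqrt{-1}\,\theta}\,V\left(\tfrac{\sigma}{r}Z+\tfrac{\dot r}{\sigma}z\right).$$ We say that, by $V$, the linearized system reduces to $\xi'=JB(\theta)\xi$ ($B$ symmetric) if, for every ERE of eccentricity $e$ over $a$, the ERE solves the $n$-body problem, this change of coordinates is symplectic with image $\{\sum_i p_i=0,\ \sum_i m_iq_i=0\}$, and in the coordinates $\xi=(Z,z)$, with the true anomaly $\theta$ as independent variable, the linearized system is exactly $\xi'=JB(\theta)\xi$. **Theorem.** Let $e\in[0,1)$. Consider the planar $4$-body problem with masses $m=(m_1,m_2,m_3,m_4)\in(\mathbf R^+)^4$, $\sum_{i=1}^4 m_i=1$, and central configurations $(q_1,q_2,q_3,q_4)$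 of these masses, in a limit in which $m_4\to0$, $m_i\to m_{i,0}>0$ and $q_i\to q_{i,0}$ for $i=1,2,3$, and $q_4\to z^*$, where $q_{1,0},q_{2,0},q_{3,0}$ form an equilateral triangle of side $1$. Then $z^*\ne q_{i,0}$ for $i=1,2,3$, and for suitable choices of $V$ (depending on $m$ and $q$) the linearized Hamiltonian system at the ERE with eccentricity $e$ reduces to systems $\xi'=JB(\theta)\xi$ on $\mathbf R^{12}$ whose coefficient matrices $B(\theta)$ converge, uniformly in $\theta$, to that of the direct sum of three independent Hamiltonian systems on $\mathbf R^4$, $\xi'=JB_k(\theta)\xi$, $k=0,1,2$, with $$B_k(\theta)=\begin{pmatrix}1&0&0&1\\0&1&-1&0\\0&-1&1-\frac{\kappa_k}{1+e\cos\theta}&0\\1&0&0&1-\frac{\kappa_k'}{1+e\cos\theta}\end{pmatrix},$$ as follows. 1. $\kappa_0=3$, $\kappa_0'=0$: for all positive masses of total mass $1$, this is the system to which the linearized system of the $2$-body problem at a Kepler orbit of eccentricity $e$ reduces. 2. $\kappa_1=\frac{3+\sqrt{9-\beta_L}}2$, $\kappa_1'=\frac{3-\sqrt{9-\beta_L}}2$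 with $\beta_L=\frac{27(m_{1,0}m_{2,0}+m_{2,0}m_{3,0}+m_{3,0}m_{1,0})}{(m_{1,0}+m_{2,0}+m_{3,0})^2}$: for a suitable $V$, the linearized system of the $3$-body problem with masses $m_{1,0},m_{2,0},m_{3,0}$ at the Lagrangian ERE with eccentricity $e$ over the triangle $q_{1,0},q_{2,0},q_{3,0}$ reduces to the direct sum of the systems $k=0$ and $k=1$. 3. (Essential part) $\kappa_2=\lambda_3=1+\alpha+3\beta$, $\kappa_2'=\lambda_4=1+\alpha-3\beta$, where $$\alpha=\frac12\sum_{i=1}^3\frac{m_{i,0}}{|q_{i,0}-z^*|^3},\qquad \beta=\frac12\left|\sum_{i=1}^3\frac{m_{i,0}(q_{i,0}-z^*)^2}{|q_{i,0}-z^*|^5}\right|.$$ -/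

import Mathlib

open Filter Topology
open scoped ComplexConjugate

noncomputable section

namespace FourBody

/-! ### Phase space, Hamiltonian systems and their linearization -/

/-- Coordinates of `n` points in the plane: `(c, i)` is the `c`-th coordinate of the `i`-th point. -/
abbrev Coord (n : ℕ) : Type := Fin 2 × Fin n

/-- The phase space `ℝ^{4n}` with coordinates `(p, q)`: `Sum.inl` is momentum, `Sum.inr` position. -/
abbrev Phase (n : ℕ) : Type := Coord n ⊕ Coord n → ℝ

/-- The momenta, the plane being identified with `ℂ`. -/
def mom {n : ℕ} (x : Phase n) (i : Fin n) : ℂ := ⟨x (Sum.inl (0, i)), x (Sum.inl (1, i))⟩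

/-- The positions, the plane being identified with `ℂ`. -/
def pos {n : ℕ} (x : Phase n) (i : Fin n) : ℂ := ⟨x (Sum.inr (0, i)), x (Sum.inr (1, i))⟩

/-- The phase point with momenta `P` and positions `Q`. -/
def phasePoint {n : ℕ} (P Q : Fin n → ℂ) : Phase n :=
  Sum.elim (fun k => if k.1 = 0 then (P k.2).re else (P k.2).im)
    (fun k => if k.1 = 0 then (Q k.2).re else (Q k.2).im)

/-- The vector of partial derivatives. -/
def grad {κ : Type*} [Fintype κ] [DecidableEq κ] (f : (κ → ℝ) → ℝ) (x : κ → ℝ) : κ → ℝ :=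
  fun k => fderiv ℝ f x (Pi.single k 1)

/-- The matrix of second partial derivatives. -/
def hessian {κ : Type*} [Fintype κ] [DecidableEq κ] (f : (κ → ℝ) → ℝ) (x : κ → ℝ) :
    Matrix κ κ ℝ :=
  Matrix.of fun k k' => fderiv ℝ (fun y => grad f y k) x (Pi.single k' 1)

/-- `x' = J ∇H(x)`, that is `p' = -∂H/∂q`, `q' = ∂H/∂p`; here `J = (0, -1; 1, 0)`. -/
def SolvesHamilton {n : ℕ} (H : Phase n → ℝ) (x : ℝ → Phase n) : Prop :=
  ∀ t, HasDerivAt x ((Matrix.J (Coord n) ℝ).mulVec (grad H (x t))) t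

/-- `ξ'(t) = J B(t) ξ(t)`. -/
def SolvesLinear {n : ℕ} (B : ℝ → Matrix (Coord n ⊕ Coord n) (Coord n ⊕ Coord n) ℝ)
    (ξ : ℝ → Phase n) : Prop :=
  ∀ t, HasDerivAt ξ ((Matrix.J (Coord n) ℝ * B t).mulVec (ξ t)) t

/-- The standard symplectic form. -/
def symplecticForm {n : ℕ} (x y : Phase n) : ℝ := x ⬝ᵥ (Matrix.J (Coord n) ℝ).mulVec y

/-! ### The planar `n`-body problem -/

/-- The force function `U`. -/
def potential {n : ℕ} (m : Fin n → ℝ) (q : Fin n → ℂ) : ℝ :=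
  ∑ i, ∑ j ∈ Finset.Ioi i, m i * m j / ‖q i - q j‖

def hamiltonian {n : ℕ} (m : Fin n → ℝ) (x : Phase n) : ℝ :=
  ∑ i, ‖mom x i‖ ^ 2 / (2 * m i) - potential m (pos x)

/-- The centre of mass. -/
def centre {n : ℕ} (m : Fin n → ℝ) (q : Fin n → ℂ) : ℂ := (∑ i, m i * q i) / ((∑ i, m i : ℝ) : ℂ)

/-- Central configuration: a collision-free configuration with
`∂U/∂q_i = -lam m_i (q_i - centre)` for all `i`, for some real `lam`. -/
def IsCentralConfiguration {n : ℕ} (m : Fin n → ℝ) (q : Fin n → ℂ) : Prop :=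
  Function.Injective q ∧ ∃ lam : ℝ, ∀ i,
    ∑ j ∈ Finset.univ.erase i, (m i * m j : ℂ) * (q j - q i) / ((‖q i - q j‖ ^ 3 : ℝ) : ℂ)
      = -lam * m i * (q i - centre m q)

/-- The configuration moved to centre of mass `0` and scaled so that `∑ m_i |a_i|² = 1`. -/
def normalized {n : ℕ} (m : Fin n → ℝ) (q : Fin n → ℂ) : Fin n → ℂ := fun i =>
  (q i - centre m q) / ((Real.sqrt (∑ j, m j * ‖q j - centre m q‖ ^ 2) : ℝ) : ℂ)

/-! ### Elliptic relative equilibria -/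

/-- The Kepler ellipse `r = p / (1 + e cos θ)`. -/
def radius (p e s : ℝ) : ℝ := p / (1 + e * Real.cos s)

/-- `θ` is the true anomaly, as a function of time, of a Kepler motion with force constant `μ`
along the ellipse with parameter `p` and eccentricity `e`:  `r² θ' = (μ p)^{1/2}`. -/
def IsTrueAnomaly (μ p e : ℝ) (θ : ℝ → ℝ) : Prop :=
  ∀ t, HasDerivAt θ (Real.sqrt (μ * p) / radius p e (θ t) ^ 2) t

/-- The homographic motion `q_i(t) = r(t) R(θ(t)) a_i`. -/
def erePos {n : ℕ} (a : Fin n → ℂ) (p e : ℝ) (θ : ℝ → ℝ) (t : ℝ) (i : Fin n) : ℂ :=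
  (radius p e (θ t) : ℂ) * Complex.exp (θ t * Complex.I) * a i

/-- The elliptic relative equilibrium in phase space: `p_i = m_i q_i'`. -/
def ere {n : ℕ} (m : Fin n → ℝ) (a : Fin n → ℂ) (p e : ℝ) (θ : ℝ → ℝ) (t : ℝ) : Phase n :=
  phasePoint (fun i => m i * deriv (fun s => erePos a p e θ s i) t) (erePos a p e θ t)

/-! ### Symplectic reduction -/

/-- The columns of `V` are orthonormal for `∑ m_i conj(u_i) v_i`, orthogonal to `(1, …, 1)`, and the
first one is the configuration `a`. Together with `(1, …, 1)` they form a unitary basis. -/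
structure IsFrame {k : ℕ} (m : Fin (k + 2) → ℝ) (a : Fin (k + 2) → ℂ)
    (V : Matrix (Fin (k + 2)) (Fin (k + 1)) ℂ) : Prop where
  first : ∀ i, V i 0 = a i
  centred : ∀ j, ∑ i, m i * V i j = 0
  orthonormal : ∀ j j', ∑ i, m i * conj (V i j) * V i j' = if j = j' then 1 else 0

/-- The linear change of coordinates at time `t`: for `(Z, z)` in the reduced phase space,
`q = V X`, `p = M V Y` (the inverse transpose of `X ↦ V X`, as `V` is orthonormal), where
`X = (r/σ) R(θ) z` and `Y = R(θ) ((σ/r) Z + (r'/σ) z)`, with `σ = (μ p)^{1/4}`, `μ = U(a)`. -/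
def changeOfCoords {k : ℕ} (m : Fin (k + 2) → ℝ) (a : Fin (k + 2) → ℂ)
    (V : Matrix (Fin (k + 2)) (Fin (k + 1)) ℂ) (p e : ℝ) (θ : ℝ → ℝ) (t : ℝ)
    (x : Phase (k + 1)) : Phase (k + 2) :=
  let σ : ℝ := (potential m a * p) ^ (1 / 4 : ℝ)
  let r : ℝ → ℝ := fun s => radius p e (θ s)
  let rot : ℂ := Complex.exp (θ t * Complex.I)
  phasePoint
    (fun i => m i * ∑ j, V i j *
      (rot * (((σ / r t : ℝ) : ℂ) * mom x j + ((deriv r t / σ : ℝ) : ℂ) * pos x j)))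
    (fun i => ∑ j, V i j * (rot * (((r t / σ : ℝ) : ℂ) * pos x j)))

/-- Total linear momentum and centre of mass are zero. -/
def centredPhase {n : ℕ} (m : Fin n → ℝ) : Set (Phase n) :=
  {x | ∑ i, mom x i = 0 ∧ ∑ i, m i * pos x i = 0}

/-- For every elliptic relative equilibrium of eccentricity `e` over the normalized configuration
`a` (any size `p`, any parametrization `θ` by time): it is a solution of the `n`-body problem; the
change of coordinates given by `V` is a symplectic map of the reduced phase space onto the phase
space with fixed centre of mass; and in the new coordinates, with the true anomaly as time, the
linearized Hamiltonian system is `ξ' = J B ξ`, with `B` symmetric. -/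
def LinearizationReducesTo {k : ℕ} (m : Fin (k + 2) → ℝ) (a : Fin (k + 2) → ℂ) (e : ℝ)
    (V : Matrix (Fin (k + 2)) (Fin (k + 1)) ℂ)
    (B : ℝ → Matrix (Coord (k + 1) ⊕ Coord (k + 1)) (Coord (k + 1) ⊕ Coord (k + 1)) ℝ) : Prop :=
  (∀ s, (B s).IsSymm) ∧
  ∀ (p : ℝ) (θ : ℝ → ℝ), 0 < p → IsTrueAnomaly (potential m a) p e θ →
    SolvesHamilton (hamiltonian m) (ere m a p e θ) ∧
    (∀ t x y, symplecticForm (changeOfCoords m a V p e θ t x) (changeOfCoords m a V p e θ t y)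
      = symplecticForm x y) ∧
    (∀ t, Set.range (changeOfCoords m a V p e θ t) = centredPhase m) ∧
    ∀ ξ : ℝ → Phase (k + 1),
      SolvesLinear (fun t => hessian (hamiltonian m) (ere m a p e θ t))
          (fun t => changeOfCoords m a V p e θ t (ξ (θ t)))
        ↔ SolvesLinear B ξ

/-! ### The independent parts -/

/-- The coefficient matrix of the sum of independent Hamiltonian systems on `ℝ^4`. -/
def directSum {n : ℕ} (C : Fin n → Matrix (Fin 2 ⊕ Fin 2) (Fin 2 ⊕ Fin 2) ℝ) :
    Matrix (Coord n ⊕ Coord n) (Coord n ⊕ Coord n) ℝ :=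
  Matrix.fromBlocks
    (Matrix.blockDiagonal fun j => (C j).toBlocks₁₁) (Matrix.blockDiagonal fun j => (C j).toBlocks₁₂)
    (Matrix.blockDiagonal fun j => (C j).toBlocks₂₁) (Matrix.blockDiagonal fun j => (C j).toBlocks₂₂)

/-- The matrix
`(1, 0, 0, 1; 0, 1, -1, 0; 0, -1, 1 - l/(1 + e cos s), 0; 1, 0, 0, 1 - l'/(1 + e cos s))`. -/
def part (l l' e s : ℝ) : Matrix (Fin 2 ⊕ Fin 2) (Fin 2 ⊕ Fin 2) ℝ :=
  Matrix.fromBlocks !![1, 0; 0, 1] !![0, 1; -1, 0] !![0, -1; 1, 0]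
    !![1 - l / (1 + e * Real.cos s), 0; 0, 1 - l' / (1 + e * Real.cos s)]

/-- The Kepler part. -/
def keplerPart (e s : ℝ) : Matrix (Fin 2 ⊕ Fin 2) (Fin 2 ⊕ Fin 2) ℝ :=
  Matrix.fromBlocks !![1, 0; 0, 1] !![0, 1; -1, 0] !![0, -1; 1, 0]
    !![-((2 - e * Real.cos s) / (1 + e * Real.cos s)), 0; 0, 1]

/-- The mass parameter of the elliptic Lagrangian solution. -/
def betaL (m : Fin 3 → ℝ) : ℝ :=
  27 * (m 0 * m 1 + m 1 * m 2 + m 2 * m 0) / (m 0 + m 1 + m 2) ^ 2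

/-- The essential part of the elliptic Lagrangian solution with mass parameter `b`. -/
def lagrangePart (b e s : ℝ) : Matrix (Fin 2 ⊕ Fin 2) (Fin 2 ⊕ Fin 2) ℝ :=
  part ((3 + Real.sqrt (9 - b)) / 2) ((3 - Real.sqrt (9 - b)) / 2) e s

def alpha (m : Fin 3 → ℝ) (q : Fin 3 → ℂ) (z : ℂ) : ℝ :=
  1 / 2 * ∑ i, m i / ‖q i - z‖ ^ 3

def beta (m : Fin 3 → ℝ) (q : Fin 3 → ℂ) (z : ℂ) : ℝ :=
  1 / 2 * ‖∑ i, (m i : ℂ) * (q i - z) ^ 2 / ((‖q i - z‖ ^ 5 : ℝ) : ℂ)‖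

end FourBody

end

noncomputable section

namespace FourBody

/-! ### Phase points as pairs of complex vectors -/

@[simp] lemma mom_phasePoint {n : ℕ} (P Q : Fin n → ℂ) : mom (phasePoint P Q) = P := by
  funext i; apply Complex.ext <;> simp [mom, phasePoint]

@[simp] lemma pos_phasePoint {n : ℕ} (P Q : Fin n → ℂ) : pos (phasePoint P Q) = Q := by
  funext i; apply Complex.ext <;> simp [pos, phasePoint]

lemma phasePoint_mom_pos {n : ℕ} (x : Phase n) : phasePoint (mom x) (pos x) = x := by
  funext k
  rcases k with ⟨c, i⟩ | ⟨c, i⟩ <;> fin_cases c <;> simp [mom, pos, phasePoint]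

lemma phase_ext {n : ℕ} {x y : Phase n} (h₁ : ∀ i, mom x i = mom y i)
    (h₂ : ∀ i, pos x i = pos y i) : x = y := by
  rw [← phasePoint_mom_pos x, ← phasePoint_mom_pos y, funext h₁, funext h₂]

/-- The phase space as pairs (momenta, positions) of complex vectors. -/
def phaseEquiv (n : ℕ) : Phase n ≃L[ℝ] (Fin n → ℂ) × (Fin n → ℂ) :=
  LinearEquiv.toContinuousLinearEquiv
    { toFun := fun x => (mom x, pos x)
      invFun := fun y => phasePoint y.1 y.2
      map_add' := fun x y => by
        ext i <;> simp [mom, pos, Complex.ext_iff]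
      map_smul' := fun c x => by
        ext i <;> simp [mom, pos, Complex.ext_iff]
      left_inv := fun x => phasePoint_mom_pos x
      right_inv := fun y => by simp }

/-- The `i`-th momentum as a continuous linear map. -/
def momL {n : ℕ} (i : Fin n) : Phase n →L[ℝ] ℂ :=
  (ContinuousLinearMap.proj i).comp
    ((ContinuousLinearMap.fst ℝ (Fin n → ℂ) (Fin n → ℂ)).comp (phaseEquiv n).toContinuousLinearMap)

/-- The `i`-th position as a continuous linear map. -/
def posL {n : ℕ} (i : Fin n) : Phase n →L[ℝ] ℂ :=
  (ContinuousLinearMap.proj i).comp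
    ((ContinuousLinearMap.snd ℝ (Fin n → ℂ) (Fin n → ℂ)).comp (phaseEquiv n).toContinuousLinearMap)

@[simp] lemma momL_apply {n : ℕ} (i : Fin n) (x : Phase n) : momL i x = mom x i := rfl

@[simp] lemma posL_apply {n : ℕ} (i : Fin n) (x : Phase n) : posL i x = pos x i := rfl

lemma hasFDerivAt_phase_iff {E : Type*} [NormedAddCommGroup E] [NormedSpace ℝ E] {n : ℕ}
    {f : E → Phase n} {L : E →L[ℝ] Phase n} {x : E} :
    HasFDerivAt f L x ↔ (∀ i, HasFDerivAt (fun y => mom (f y) i) ((momL i).comp L) x) ∧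
      ∀ i, HasFDerivAt (fun y => pos (f y) i) ((posL i).comp L) x := by
  constructor
  · intro h
    exact ⟨fun i => (momL i).hasFDerivAt.comp x h, fun i => (posL i).hasFDerivAt.comp x h⟩
  · rintro ⟨h₁, h₂⟩
    rw [← (phaseEquiv n).comp_hasFDerivAt_iff]
    have := (hasFDerivAt_pi.2 h₁).prodMk (hasFDerivAt_pi.2 h₂)
    exact this

lemma hasDerivAt_phase_iff {n : ℕ} {f : ℝ → Phase n} {f' : Phase n} {t : ℝ} :
    HasDerivAt f f' t ↔ (∀ i, HasDerivAt (fun s => mom (f s) i) (mom f' i) t) ∧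
      ∀ i, HasDerivAt (fun s => pos (f s) i) (pos f' i) t := by
  have := hasFDerivAt_phase_iff (f := f) (L := ContinuousLinearMap.toSpanSingleton ℝ f') (x := t)
  simp only [hasDerivAt_iff_hasFDerivAt, this]
  have e₁ : ∀ i, (momL i).comp (ContinuousLinearMap.toSpanSingleton ℝ f')
      = ContinuousLinearMap.toSpanSingleton ℝ (mom f' i) := fun i => by ext; simp
  have e₂ : ∀ i, (posL i).comp (ContinuousLinearMap.toSpanSingleton ℝ f')
      = ContinuousLinearMap.toSpanSingleton ℝ (pos f' i) := fun i => by ext; simp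
  simp only [e₁, e₂]

lemma dotProduct_phase {n : ℕ} (x y : Phase n) :
    x ⬝ᵥ y = ∑ i, (conj (mom x i) * mom y i).re + ∑ i, (conj (pos x i) * pos y i).re := by
  simp only [dotProduct, Fintype.sum_sum_type, Fintype.sum_prod_type, Fin.sum_univ_two,
    ← Finset.sum_add_distrib]
  simp [mom, pos]

lemma J_mulVec {n : ℕ} (x : Phase n) :
    (Matrix.J (Coord n) ℝ).mulVec x = phasePoint (fun i => -pos x i) (mom x) := by
  have hx : x = Sum.elim (fun k => x (Sum.inl k)) (fun k => x (Sum.inr k)) := by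
    funext k; rcases k with k | k <;> rfl
  conv_lhs => rw [hx]
  rw [Matrix.J, Matrix.fromBlocks_mulVec]
  funext k
  rcases k with ⟨c, i⟩ | ⟨c, i⟩ <;> fin_cases c <;>
    simp [mom, pos, phasePoint, Matrix.neg_mulVec]

lemma symplecticForm_eq {n : ℕ} (x y : Phase n) :
    symplecticForm x y
      = ∑ i, (conj (pos x i) * mom y i).re - ∑ i, (conj (mom x i) * pos y i).re := by
  simp only [symplecticForm, J_mulVec, dotProduct_phase, mom_phasePoint, pos_phasePoint, mul_neg,
    Complex.neg_re, Finset.sum_neg_distrib]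
  ring

/-! ### Gradients and Hessian matrices -/

lemma grad_eq_of_hasFDerivAt {κ : Type*} [Fintype κ] [DecidableEq κ] {f : (κ → ℝ) → ℝ}
    {x g : κ → ℝ} {L : (κ → ℝ) →L[ℝ] ℝ} (h : HasFDerivAt f L x) (hL : ∀ v, L v = g ⬝ᵥ v) :
    grad f x = g := by
  funext k
  rw [grad, h.fderiv, hL, dotProduct_single, mul_one]

lemma hessian_mulVec {κ : Type*} [Fintype κ] [DecidableEq κ] {f : (κ → ℝ) → ℝ}
    {g : (κ → ℝ) → κ → ℝ} {x : κ → ℝ} {L : (κ → ℝ) →L[ℝ] κ → ℝ} (h : grad f =ᶠ[𝓝 x] g)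
    (hg : HasFDerivAt g L x) (v : κ → ℝ) : (hessian f x).mulVec v = L v := by
  funext k
  have h₁ : HasFDerivAt (fun y => grad f y k) ((ContinuousLinearMap.proj k).comp L) x :=
    (hasFDerivAt_pi'.1 (hg.congr_of_eventuallyEq h)) k
  conv_rhs => rw [pi_eq_sum_univ' v, map_sum, Finset.sum_apply]
  simp only [Matrix.mulVec, dotProduct, hessian, Matrix.of_apply, h₁.fderiv, map_smul,
    ContinuousLinearMap.comp_apply, ContinuousLinearMap.proj_apply, Pi.smul_apply, smul_eq_mul]
  refine Finset.sum_congr rfl fun k' _ => ?_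
  rw [mul_comm]

/-! ### The Newtonian kernel -/

lemma hasFDerivAt_norm_complex {w : ℂ} (hw : w ≠ 0) :
    HasFDerivAt (fun w : ℂ => ‖w‖) ((‖w‖⁻¹ : ℝ) • innerSL ℝ w) w := by
  have h := (hasStrictFDerivAt_norm_sq w).hasFDerivAt.sqrt (by simpa using hw)
  simp only [Real.sqrt_sq (norm_nonneg _)] at h
  refine h.congr_fderiv (ContinuousLinearMap.ext fun v => ?_)
  simp only [smul_apply, smul_eq_mul, nsmul_eq_mul]
  field_simp
  norm_num

/-- The derivative of `w ↦ w / |w|³`. -/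
def kernelDeriv (w : ℂ) : ℂ →L[ℝ] ℂ :=
  (-(1 / 2) / ‖w‖ ^ 3 : ℝ) • ContinuousLinearMap.id ℝ ℂ
    - (3 / 2 * w ^ 2 / ((‖w‖ ^ 5 : ℝ) : ℂ)) • (Complex.conjCLE : ℂ →L[ℝ] ℂ)

lemma kernelDeriv_apply (w h : ℂ) :
    kernelDeriv w h = -(1 / 2) / ((‖w‖ ^ 3 : ℝ) : ℂ) * h
      - 3 / 2 * w ^ 2 / ((‖w‖ ^ 5 : ℝ) : ℂ) * conj h := by
  simp [kernelDeriv]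

lemma hasFDerivAt_kernel {w : ℂ} (hw : w ≠ 0) :
    HasFDerivAt (fun w : ℂ => w / ((‖w‖ ^ 3 : ℝ) : ℂ)) (kernelDeriv w) w := by
  have hn : ‖w‖ ≠ 0 := norm_ne_zero_iff.2 hw
  have h₁ : HasFDerivAt (fun w : ℂ => (‖w‖ ^ 3)⁻¹)
      ((-(3 * ‖w‖ ^ 2) / (‖w‖ ^ 3) ^ 2) • ((‖w‖⁻¹ : ℝ) • innerSL ℝ w)) w := by
    have := ((hasDerivAt_pow 3 ‖w‖).fun_inv (pow_ne_zero 3 hn)).comp_hasFDerivAt w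
      (hasFDerivAt_norm_complex hw)
    exact this
  have h₂ := h₁.smul (hasFDerivAt_id w)
  have e : (fun w : ℂ => w / ((‖w‖ ^ 3 : ℝ) : ℂ)) = fun w : ℂ => (‖w‖ ^ 3)⁻¹ • id w := by
    funext w; simp [div_eq_inv_mul]
  rw [e]
  refine h₂.congr_fderiv ?_
  apply ContinuousLinearMap.ext
  intro h
  have hc : (‖w‖ : ℂ) ≠ 0 := by exact_mod_cast hn
  have hi : (((h * conj w).re : ℝ) : ℂ) = (h * conj w + conj h * w) / 2 := by
    rw [Complex.re_eq_add_conj]; simp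
  have hw2 : (‖w‖ : ℂ) ^ 2 = w * conj w := by
    rw [Complex.mul_conj, Complex.normSq_eq_norm_sq]; push_cast; rfl
  rw [kernelDeriv_apply]
  simp only [add_apply, smul_apply,
    ContinuousLinearMap.smulRight_apply, ContinuousLinearMap.id_apply, innerSL_apply_apply,
    Complex.inner, id, smul_eq_mul, Complex.real_smul]
  push_cast
  rw [hi]
  field_simp
  ring_nf
  simp only [hw2]
  ring

/-! ### Gradient and Hessian matrix of the Hamiltonian -/

lemma sum_Ioi_add_swap {n : ℕ} {M : Type*} [AddCommMonoid M] (f : Fin n → Fin n → M)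
    (hf : ∀ i, f i i = 0) :
    ∑ i, ∑ j ∈ Finset.Ioi i, (f i j + f j i) = ∑ i, ∑ j, f i j := by
  have h := Finset.sum_sum_Ioi_add_eq_sum_sum_off_diag (fun i j => f j i)
  rw [h]
  refine Finset.sum_congr rfl fun i _ => ?_
  rw [← Finset.sum_compl_add_sum {i} (f i)]
  simp [hf]

/-- The force `∂U/∂q_i`. -/
def force {n : ℕ} (m : Fin n → ℝ) (q : Fin n → ℂ) (i : Fin n) : ℂ :=
  ∑ j, (m i * m j : ℂ) * ((q j - q i) / ((‖q j - q i‖ ^ 3 : ℝ) : ℂ))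

/-- The derivative of the force `∂U/∂q_i` in the direction `h`. -/
def forceDeriv {n : ℕ} (m : Fin n → ℝ) (q h : Fin n → ℂ) (i : Fin n) : ℂ :=
  ∑ j, (m i * m j : ℂ) * kernelDeriv (q j - q i) (h j - h i)

lemma hasFDerivAt_norm_inv {w : ℂ} (hw : w ≠ 0) :
    HasFDerivAt (fun w : ℂ => ‖w‖⁻¹) ((-(‖w‖ ^ 3)⁻¹ : ℝ) • innerSL ℝ w) w := by
  have hn : ‖w‖ ≠ 0 := norm_ne_zero_iff.2 hw
  have h := (hasDerivAt_inv hn).comp_hasFDerivAt w (hasFDerivAt_norm_complex hw)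
  refine HasFDerivAt.congr_fderiv (f := fun w : ℂ => ‖w‖⁻¹) h
    (ContinuousLinearMap.ext fun v => ?_)
  simp only [smul_apply, smul_eq_mul]
  field_simp

lemma hasFDerivAt_potential {n : ℕ} (m : Fin n → ℝ) {x : Phase n}
    (hx : Function.Injective (pos x)) :
    ∃ L : Phase n →L[ℝ] ℝ, HasFDerivAt (fun y => potential m (pos y)) L x ∧
      ∀ v, L v = ∑ i, (conj (force m (pos x) i) * pos v i).re := by
  have hterm : ∀ i, ∀ j ∈ Finset.Ioi i,
      HasFDerivAt (fun y : Phase n => m i * m j / ‖pos y i - pos y j‖)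
        ((m i * m j) • ((-(‖pos x i - pos x j‖ ^ 3)⁻¹ : ℝ) •
          (innerSL ℝ (pos x i - pos x j))).comp (posL i - posL j)) x := by
    intro i j hj
    have hne : pos x i - pos x j ≠ 0 :=
      sub_ne_zero.2 fun h => (Finset.mem_Ioi.1 hj).ne (hx h)
    have h₁ : HasFDerivAt (fun y : Phase n => pos y i - pos y j) (posL i - posL j) x :=
      (posL i - posL j : Phase n →L[ℝ] ℂ).hasFDerivAt
    have h₂ := (HasFDerivAt.comp x (hasFDerivAt_norm_inv hne) h₁).const_mul (m i * m j)
    simpa [div_eq_mul_inv, Function.comp_def] using h₂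
  refine ⟨_, HasFDerivAt.fun_sum fun i _ => HasFDerivAt.fun_sum fun j hj => hterm i j hj, ?_⟩
  intro v
  set f : Fin n → Fin n → ℝ := fun i j =>
    m i * m j * ((conj (pos x j - pos x i) * pos v i).re / ‖pos x j - pos x i‖ ^ 3) with hf
  have e₁ : ∑ i, (conj (force m (pos x) i) * pos v i).re = ∑ i, ∑ j, f i j := by
    refine Finset.sum_congr rfl fun i _ => ?_
    rw [force, map_sum, Finset.sum_mul, Complex.re_sum]
    refine Finset.sum_congr rfl fun j _ => ?_
    rw [hf]
    simp only [map_mul, map_div₀, Complex.conj_ofReal]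
    rw [show (m i * m j : ℂ) * (conj (pos x j - pos x i) / ((‖pos x j - pos x i‖ ^ 3 : ℝ) : ℂ))
      * pos v i = ((m i * m j / ‖pos x j - pos x i‖ ^ 3 : ℝ) : ℂ) *
        (conj (pos x j - pos x i) * pos v i) by push_cast; ring, Complex.re_ofReal_mul]
    ring
  rw [e₁, ← sum_Ioi_add_swap f (fun i => by simp [hf])]
  simp only [sum_apply]
  refine Finset.sum_congr rfl fun i _ => Finset.sum_congr rfl fun j _ => ?_
  simp only [hf, smul_apply, ContinuousLinearMap.comp_apply, innerSL_apply_apply, Complex.inner,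
    sub_apply, posL_apply, smul_eq_mul]
  rw [norm_sub_rev (pos x j) (pos x i)]
  simp only [Complex.mul_re, Complex.sub_re, Complex.sub_im, Complex.conj_re, Complex.conj_im]
  ring

lemma hasFDerivAt_kinetic {n : ℕ} (m : Fin n → ℝ) (x : Phase n) :
    ∃ L : Phase n →L[ℝ] ℝ, HasFDerivAt (fun y => ∑ i, ‖mom y i‖ ^ 2 / (2 * m i)) L x ∧
      ∀ v, L v = ∑ i, (conj (mom x i / m i) * mom v i).re := by
  have hterm : ∀ i, HasFDerivAt (fun y : Phase n => ‖mom y i‖ ^ 2 / (2 * m i))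
      ((2 * m i)⁻¹ • (2 • innerSL ℝ (mom x i)).comp (momL i)) x := by
    intro i
    have h₁ := (HasFDerivAt.comp x (hasStrictFDerivAt_norm_sq (momL i x)).hasFDerivAt
      (momL i).hasFDerivAt).const_mul (2 * m i)⁻¹
    simpa [div_eq_inv_mul, Function.comp_def] using h₁
  refine ⟨_, HasFDerivAt.fun_sum fun i _ => hterm i, fun v => ?_⟩
  simp only [sum_apply]
  refine Finset.sum_congr rfl fun i _ => ?_
  simp only [smul_apply, ContinuousLinearMap.comp_apply, innerSL_apply_apply, Complex.inner,
    momL_apply, smul_eq_mul, map_div₀, Complex.conj_ofReal, nsmul_eq_mul]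
  rw [div_mul_eq_mul_div, Complex.div_ofReal_re, mul_comm (conj _)]
  by_cases hm : m i = 0
  · simp [hm]
  · field_simp
    norm_num

lemma grad_hamiltonian {n : ℕ} (m : Fin n → ℝ) {x : Phase n} (hx : Function.Injective (pos x)) :
    grad (hamiltonian m) x
      = phasePoint (fun i => mom x i / m i) (fun i => -force m (pos x) i) := by
  obtain ⟨L₁, h₁, e₁⟩ := hasFDerivAt_kinetic m x
  obtain ⟨L₂, h₂, e₂⟩ := hasFDerivAt_potential m hx
  refine grad_eq_of_hasFDerivAt (L := L₁ - L₂) (h₁.sub h₂) fun v => ?_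
  rw [sub_apply, e₁, e₂, dotProduct_phase]
  simp only [mom_phasePoint, pos_phasePoint, map_neg, neg_mul, Complex.neg_re,
    Finset.sum_neg_distrib]
  ring

lemma hasFDerivAt_force {n : ℕ} (m : Fin n → ℝ) {x : Phase n} (hx : Function.Injective (pos x))
    (i : Fin n) : HasFDerivAt (fun y : Phase n => force m (pos y) i)
      (∑ j, (m i * m j : ℂ) • (kernelDeriv (pos x j - pos x i)).comp (posL j - posL i)) x := by
  refine HasFDerivAt.fun_sum fun j _ => ?_
  by_cases hij : j = i
  · subst hij
    have e : ((m j * m j : ℂ) • (kernelDeriv (pos x j - pos x j)).comp (posL j - posL j) :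
        Phase n →L[ℝ] ℂ) = 0 := ContinuousLinearMap.ext fun v => by simp
    rw [e]
    simpa using hasFDerivAt_const (0 : ℂ) x
  · have hne : pos x j - pos x i ≠ 0 := sub_ne_zero.2 fun h => hij (hx h)
    have h₁ : HasFDerivAt (fun y : Phase n => pos y j - pos y i) (posL j - posL i) x :=
      (posL j - posL i : Phase n →L[ℝ] ℂ).hasFDerivAt
    exact (HasFDerivAt.comp x (hasFDerivAt_kernel hne) h₁).const_mul _

lemma eventually_injective_pos {n : ℕ} {x : Phase n} (hx : Function.Injective (pos x)) :
    ∀ᶠ y in 𝓝 x, Function.Injective (pos y) := by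
  have h : ∀ i j : Fin n, i ≠ j → ∀ᶠ y in 𝓝 x, pos y i ≠ pos y j := fun i j hij =>
    (isOpen_ne_fun (posL i).continuous (posL j).continuous).mem_nhds fun h => hij (hx h)
  have h' : ∀ᶠ y in 𝓝 x, ∀ i j : Fin n, i ≠ j → pos y i ≠ pos y j := by
    simp only [eventually_all]
    exact h
  filter_upwards [h'] with y hy i j hij
  by_contra hne
  exact hy i j hne hij

lemma hessian_hamiltonian_mulVec {n : ℕ} (m : Fin n → ℝ) {x : Phase n}
    (hx : Function.Injective (pos x)) (v : Phase n) :
    (hessian (hamiltonian m) x).mulVec v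
      = phasePoint (fun i => mom v i / m i) (fun i => -forceDeriv m (pos x) (pos v) i) := by
  let D : Phase n →L[ℝ] (Fin n → ℂ) × (Fin n → ℂ) :=
    (ContinuousLinearMap.pi fun i => (m i : ℂ)⁻¹ • momL i).prod
    (ContinuousLinearMap.pi fun i =>
      -(∑ j, (m i * m j : ℂ) • (kernelDeriv (pos x j - pos x i)).comp (posL j - posL i)))
  have hD : ∀ v, (phaseEquiv n).symm (D v)
      = phasePoint (fun i => mom v i / m i) (fun i => -forceDeriv m (pos x) (pos v) i) := by
    intro v
    change phasePoint _ _ = _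
    congr 1
    · funext i; simp [D, div_eq_inv_mul]
    · funext i; simp [D, forceDeriv]
  rw [hessian_mulVec (L := (phaseEquiv n).symm.toContinuousLinearMap.comp D)
    ((eventually_injective_pos hx).mono fun y hy => grad_hamiltonian m hy) ?_ v]
  · exact hD v
  · have hpair : HasFDerivAt
        (fun y : Phase n => ((fun i => mom y i / m i : Fin n → ℂ), fun i => -force m (pos y) i))
        D x := by
      refine HasFDerivAt.prodMk (hasFDerivAt_pi.2 fun i => ?_) (hasFDerivAt_pi.2 fun i => ?_)
      · have := ((momL i).hasFDerivAt (x := x)).const_mul (m i : ℂ)⁻¹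
        simpa [div_eq_inv_mul] using this
      · exact (hasFDerivAt_force m hx i).neg
    exact (phaseEquiv n).symm.hasFDerivAt.comp x hpair

/-! ### Real matrices of real-linear maps of complex vectors -/

/-- The real coordinates of a complex vector. -/
def coordVec {n : ℕ} (w : Fin n → ℂ) : Coord n → ℝ :=
  fun k => if k.1 = 0 then (w k.2).re else (w k.2).im

lemma phasePoint_eq {n : ℕ} (P Q : Fin n → ℂ) :
    phasePoint P Q = Sum.elim (coordVec P) (coordVec Q) := rfl

/-- The real matrix of `w ↦ P w + Q conj(w)`. -/
def realMatrix {n : ℕ} (P Q : Matrix (Fin n) (Fin n) ℂ) : Matrix (Coord n) (Coord n) ℝ :=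
  Matrix.of fun k l =>
    if k.1 = 0 then
      if l.1 = 0 then (P k.2 l.2 + Q k.2 l.2).re else (Q k.2 l.2 - P k.2 l.2).im
    else
      if l.1 = 0 then (P k.2 l.2 + Q k.2 l.2).im else (P k.2 l.2 - Q k.2 l.2).re

lemma realMatrix_mulVec {n : ℕ} (P Q : Matrix (Fin n) (Fin n) ℂ) (w : Fin n → ℂ) :
    (realMatrix P Q).mulVec (coordVec w)
      = coordVec fun j => ∑ k, (P j k * w k + Q j k * conj (w k)) := by
  funext ⟨c, j⟩
  simp only [Matrix.mulVec, dotProduct, Fintype.sum_prod_type, Fin.sum_univ_two,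
    ← Finset.sum_add_distrib, realMatrix, coordVec, Matrix.of_apply]
  fin_cases c
  · simp only [Fin.zero_eta, ↓reduceIte, Fin.isValue, one_ne_zero, Complex.re_sum]
    refine Finset.sum_congr rfl fun k _ => ?_
    simp
    ring
  · simp only [Fin.mk_one, ↓reduceIte, Fin.isValue, one_ne_zero, Complex.im_sum]
    refine Finset.sum_congr rfl fun k _ => ?_
    simp
    ring

lemma realMatrix_isSymm {n : ℕ} {P Q : Matrix (Fin n) (Fin n) ℂ}
    (hP : ∀ j k, P k j = conj (P j k)) (hQ : ∀ j k, Q k j = Q j k) :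
    (realMatrix P Q).IsSymm := by
  ext ⟨c, j⟩ ⟨d, k⟩
  fin_cases c <;> fin_cases d <;> simp [realMatrix, hP j k, hQ j k] <;> ring

/-- The coefficient matrix of the reduced linearized system, where `z ↦ P z + Q conj(z)` is the
second derivative of the force function divided by its value. -/
def reducedMatrix {n : ℕ} (P Q : Matrix (Fin n) (Fin n) ℂ) (e s : ℝ) :
    Matrix (Coord n ⊕ Coord n) (Coord n ⊕ Coord n) ℝ :=
  Matrix.fromBlocks 1 (realMatrix (Matrix.diagonal fun _ => -Complex.I) 0)
    (realMatrix (Matrix.diagonal fun _ => Complex.I) 0)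
    (1 - (1 + e * Real.cos s)⁻¹ • (1 + realMatrix P Q))

lemma reducedMatrix_isSymm {n : ℕ} {P Q : Matrix (Fin n) (Fin n) ℂ} (e s : ℝ)
    (hP : ∀ j k, P k j = conj (P j k)) (hQ : ∀ j k, Q k j = Q j k) :
    (reducedMatrix P Q e s).IsSymm := by
  refine Matrix.IsSymm.fromBlocks Matrix.isSymm_one ?_ ?_
  · ext ⟨c, j⟩ ⟨d, k⟩
    by_cases h : j = k
    · subst h
      fin_cases c <;> fin_cases d <;> simp [realMatrix]
    · fin_cases c <;> fin_cases d <;> simp [realMatrix, h, Ne.symm h]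
  · exact Matrix.isSymm_one.sub ((Matrix.isSymm_one.add (realMatrix_isSymm hP hQ)).smul _)

lemma reducedMatrix_mulVec {n : ℕ} (P Q : Matrix (Fin n) (Fin n) ℂ) (e s : ℝ) (x : Phase n) :
    (reducedMatrix P Q e s).mulVec x
      = phasePoint (fun j => mom x j - Complex.I * pos x j)
        (fun j => Complex.I * mom x j + (pos x j - ((1 + e * Real.cos s)⁻¹ : ℝ) *
          (pos x j + ∑ k, (P j k * pos x k + Q j k * conj (pos x k))))) := by
  conv_lhs => rw [← phasePoint_mom_pos x, phasePoint_eq]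
  have hd : ∀ (c : ℂ) (w : Fin n → ℂ),
      (realMatrix (Matrix.diagonal fun _ => c) 0).mulVec (coordVec w)
        = coordVec fun j => c * w j := by
    intro c w
    rw [realMatrix_mulVec]
    congr 1
    funext j
    simp [Matrix.diagonal_apply]
  rw [reducedMatrix, Matrix.fromBlocks_mulVec]
  simp only [Sum.elim_comp_inl, Sum.elim_comp_inr, hd, Matrix.one_mulVec, Matrix.sub_mulVec,
    Matrix.smul_mulVec, Matrix.add_mulVec, realMatrix_mulVec]
  rw [phasePoint_eq]
  generalize (1 + e * Real.cos s)⁻¹ = b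
  congr 1 <;> funext ⟨c, j⟩ <;> fin_cases c <;> simp [coordVec] <;> ring

lemma reducedMatrix_diagonal {n : ℕ} (f g : Fin n → ℝ) {e s : ℝ} :
    reducedMatrix (Matrix.diagonal fun j => (f j : ℂ)) (Matrix.diagonal fun j => (g j : ℂ)) e s
      = directSum fun j => part (1 + f j + g j) (1 + f j - g j) e s := by
  ext x y
  rcases x with ⟨c, j⟩ | ⟨c, j⟩ <;> rcases y with ⟨d, k⟩ | ⟨d, k⟩ <;> by_cases h : j = k
  all_goals
    first | subst h | skip
    fin_cases c <;> fin_cases d <;>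
      simp [reducedMatrix, directSum, realMatrix, part, Matrix.blockDiagonal_apply, *] <;> ring

lemma part_three_zero {e s : ℝ} (h : 1 + e * Real.cos s ≠ 0) : part 3 0 e s = keplerPart e s := by
  have hk : 1 - 3 / (1 + e * Real.cos s) = -((2 - e * Real.cos s) / (1 + e * Real.cos s)) := by
    field_simp; ring
  simp [part, keplerPart, hk]

/-! ### Frames -/

section Frame

variable {k : ℕ} {m : Fin (k + 2) → ℝ} {a : Fin (k + 2) → ℂ}
  {V : Matrix (Fin (k + 2)) (Fin (k + 1)) ℂ}

lemma IsFrame.sum_conj_mul (hV : IsFrame m a V) (y : Fin (k + 1) → ℂ) (j : Fin (k + 1)) :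
    ∑ i, m i * conj (V i j) * ∑ l, V i l * y l = y j := by
  simp only [Finset.mul_sum]
  rw [Finset.sum_comm]
  have : ∀ l, ∑ i, (m i : ℂ) * conj (V i j) * (V i l * y l) = (if j = l then 1 else 0) * y l := by
    intro l
    rw [← hV.orthonormal j l, Finset.sum_mul]
    exact Finset.sum_congr rfl fun i _ => by ring
  simp [this]

lemma IsFrame.sum_mul (hV : IsFrame m a V) (y : Fin (k + 1) → ℂ) :
    ∑ i, (m i : ℂ) * ∑ l, V i l * y l = 0 := by
  simp only [Finset.mul_sum]
  rw [Finset.sum_comm]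
  refine Finset.sum_eq_zero fun l _ => ?_
  rw [← zero_mul (y l), ← hV.centred l, Finset.sum_mul]
  exact Finset.sum_congr rfl fun i _ => by ring

lemma IsFrame.exists_eq (hV : IsFrame m a V) (hm : ∀ i, 0 < m i) {w : Fin (k + 2) → ℂ}
    (hw : ∑ i, m i * w i = 0) : ∃ y : Fin (k + 1) → ℂ, ∀ i, w i = ∑ l, V i l * y l := by
  let φ : (Fin (k + 2) → ℂ) →ₗ[ℂ] ℂ := ∑ i, (m i : ℂ) • LinearMap.proj i
  have hφ : ∀ w, φ w = ∑ i, (m i : ℂ) * w i := fun w => by simp [φ]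
  have hle : LinearMap.range V.mulVecLin ≤ LinearMap.ker φ := by
    rintro _ ⟨y, rfl⟩
    rw [LinearMap.mem_ker, hφ]
    exact hV.sum_mul y
  have hinj : Function.Injective V.mulVecLin := by
    rw [← LinearMap.ker_eq_bot, LinearMap.ker_eq_bot']
    intro y hy
    funext j
    have h := hV.sum_conj_mul y j
    have h0 : ∀ i, ∑ l, V i l * y l = 0 := fun i => congrFun hy i
    simpa [h0] using h.symm
  have hsurj : LinearMap.range φ = ⊤ := by
    rw [LinearMap.range_eq_top]
    refine LinearMap.surjective ?_
    intro h
    have h1 := congrArg (fun f => f (Pi.single 0 1)) h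
    simp only [hφ, LinearMap.zero_apply] at h1
    simp [Pi.single_apply] at h1
    exact (hm 0).ne' h1
  have h1 := LinearMap.finrank_range_of_inj hinj
  have h2 := LinearMap.finrank_range_add_finrank_ker φ
  rw [hsurj, finrank_top] at h2
  simp only [Module.finrank_fin_fun, Module.finrank_self] at h1 h2
  have heq := Submodule.eq_of_le_of_finrank_le hle (by omega)
  have hmem : w ∈ LinearMap.range V.mulVecLin := by
    rw [heq, LinearMap.mem_ker, hφ, hw]
  obtain ⟨y, rfl⟩ := hmem
  exact ⟨y, fun i => rfl⟩

lemma IsFrame.eq_sum (hV : IsFrame m a V) (hm : ∀ i, 0 < m i) {w : Fin (k + 2) → ℂ}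
    (hw : ∑ i, m i * w i = 0) (i : Fin (k + 2)) :
    w i = ∑ l, V i l * ∑ i', m i' * conj (V i' l) * w i' := by
  obtain ⟨y, hy⟩ := hV.exists_eq hm hw
  simp only [hy, hV.sum_conj_mul]

end Frame

/-! ### The second derivative of the force function in a frame -/

/-- The complex linear part of the second derivative of `U` at `a` in the basis `V`. -/
def hessLin {n l : ℕ} (m : Fin n → ℝ) (a : Fin n → ℂ) (V : Matrix (Fin n) (Fin l) ℂ) :
    Matrix (Fin l) (Fin l) ℂ :=
  Matrix.of fun j k => 1 / 4 * ∑ i, ∑ i', (m i * m i' : ℂ) / ((‖a i' - a i‖ ^ 3 : ℝ) : ℂ) *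
    (conj (V i' j - V i j) * (V i' k - V i k))

/-- The conjugate linear part of the second derivative of `U` at `a` in the basis `V`. -/
def hessConj {n l : ℕ} (m : Fin n → ℝ) (a : Fin n → ℂ) (V : Matrix (Fin n) (Fin l) ℂ) :
    Matrix (Fin l) (Fin l) ℂ :=
  Matrix.of fun j k => 3 / 4 * ∑ i, ∑ i',
    (m i * m i' : ℂ) * (a i' - a i) ^ 2 / ((‖a i' - a i‖ ^ 5 : ℝ) : ℂ) *
      (conj (V i' j - V i j) * conj (V i' k - V i k))

lemma hessLin_conj {n l : ℕ} (m : Fin n → ℝ) (a : Fin n → ℂ) (V : Matrix (Fin n) (Fin l) ℂ)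
    (j k : Fin l) : hessLin m a V k j = conj (hessLin m a V j k) := by
  simp only [hessLin, Matrix.of_apply, map_mul, map_sum, map_div₀, map_sub, Complex.conj_conj,
    Complex.conj_ofReal, map_one, map_ofNat]
  congr 1
  refine Finset.sum_congr rfl fun i _ => Finset.sum_congr rfl fun i' _ => ?_
  ring

lemma hessConj_symm {n l : ℕ} (m : Fin n → ℝ) (a : Fin n → ℂ) (V : Matrix (Fin n) (Fin l) ℂ)
    (j k : Fin l) : hessConj m a V k j = hessConj m a V j k := by
  simp only [hessConj, Matrix.of_apply]
  congr 1
  refine Finset.sum_congr rfl fun i _ => Finset.sum_congr rfl fun i' _ => ?_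
  ring

lemma sum_mul_sum_of_antisymm {n : ℕ} (u : Fin n → ℂ) {G : Fin n → Fin n → ℂ}
    (hG : ∀ i j, G j i = -G i j) :
    ∑ i, u i * ∑ j, G i j = -(1 / 2) * ∑ i, ∑ j, (u j - u i) * G i j := by
  have h : ∑ i, ∑ j, u j * G i j = -∑ i, ∑ j, u i * G i j := by
    rw [Finset.sum_comm, ← Finset.sum_neg_distrib]
    refine Finset.sum_congr rfl fun i _ => ?_
    rw [← Finset.sum_neg_distrib]
    refine Finset.sum_congr rfl fun j _ => ?_
    rw [hG i j]; ring
  simp only [sub_mul, Finset.sum_sub_distrib, h, Finset.mul_sum]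
  ring

lemma kernelDeriv_neg_neg (w h : ℂ) : kernelDeriv (-w) (-h) = -kernelDeriv w h := by
  simp only [kernelDeriv_apply, norm_neg, map_neg]
  ring

lemma kernelDeriv_mul (c w h : ℂ) :
    kernelDeriv (c * w) (c * h) = c / ((‖c‖ ^ 3 : ℝ) : ℂ) * kernelDeriv w h := by
  by_cases hc : c = 0
  · simp [hc]
  have hn : (‖c‖ : ℂ) ≠ 0 := by simpa using hc
  have h2 : (‖c‖ : ℂ) ^ 2 = c * conj c := by
    rw [Complex.mul_conj, Complex.normSq_eq_norm_sq]; push_cast; rfl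
  simp only [kernelDeriv_apply, norm_mul, mul_pow, map_mul]
  push_cast
  by_cases hw : w = 0
  · simp [hw]
  have hnw : (‖w‖ : ℂ) ≠ 0 := by simpa using hw
  field_simp
  rw [mul_sub, h2]
  ring

lemma forceDeriv_antisymm {n : ℕ} (m : Fin n → ℝ) (a h : Fin n → ℂ) (i j : Fin n) :
    (m j * m i : ℂ) * kernelDeriv (a i - a j) (h i - h j)
      = -((m i * m j : ℂ) * kernelDeriv (a j - a i) (h j - h i)) := by
  rw [← neg_sub (a j), ← neg_sub (h j), kernelDeriv_neg_neg]
  ring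

lemma sum_forceDeriv {n : ℕ} (m : Fin n → ℝ) (a h : Fin n → ℂ) :
    ∑ i, forceDeriv m a h i = 0 := by
  have := sum_mul_sum_of_antisymm (fun _ => 1) (forceDeriv_antisymm m a h)
  simpa [forceDeriv] using this

lemma sum_conj_mul_forceDeriv {n l : ℕ} (m : Fin n → ℝ) (a : Fin n → ℂ)
    (V : Matrix (Fin n) (Fin l) ℂ) (z : Fin l → ℂ) (j : Fin l) :
    ∑ i, conj (V i j) * forceDeriv m a (fun i => ∑ k, V i k * z k) i
      = ∑ k, (hessLin m a V j k * z k + hessConj m a V j k * conj (z k)) := by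
  simp only [forceDeriv]
  rw [sum_mul_sum_of_antisymm (fun i => conj (V i j)) (forceDeriv_antisymm m a _)]
  simp only [hessLin, hessConj, Matrix.of_apply, Finset.mul_sum, Finset.sum_mul,
    ← Finset.sum_add_distrib]
  conv_rhs => rw [Finset.sum_comm]
  refine Finset.sum_congr rfl fun i _ => ?_
  conv_rhs => rw [Finset.sum_comm]
  refine Finset.sum_congr rfl fun i' _ => ?_
  rw [← Finset.sum_sub_distrib]
  simp only [kernelDeriv_apply, ← sub_mul, map_sum, map_sub, map_mul, Finset.mul_sum]
  refine Finset.sum_congr rfl fun k _ => ?_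
  ring

lemma IsFrame.forceDeriv_eq {k : ℕ} {m : Fin (k + 2) → ℝ} {a : Fin (k + 2) → ℂ}
    {V : Matrix (Fin (k + 2)) (Fin (k + 1)) ℂ} (hV : IsFrame m a V) (hm : ∀ i, 0 < m i)
    (z : Fin (k + 1) → ℂ) (i : Fin (k + 2)) :
    forceDeriv m a (fun i => ∑ k, V i k * z k) i = m i * ∑ j, V i j *
      ∑ k, (hessLin m a V j k * z k + hessConj m a V j k * conj (z k)) := by
  have hm' : ∀ i, (m i : ℂ) ≠ 0 := fun i => by exact_mod_cast (hm i).ne'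
  have hsum : ∑ i, (m i : ℂ) * (forceDeriv m a (fun i => ∑ k, V i k * z k) i / m i) = 0 := by
    rw [← sum_forceDeriv m a fun i => ∑ k, V i k * z k]
    exact Finset.sum_congr rfl fun i _ => mul_div_cancel₀ _ (hm' i)
  have h := hV.eq_sum hm hsum i
  have e : ∀ l, ∑ i', (m i' : ℂ) * conj (V i' l) *
      (forceDeriv m a (fun i => ∑ k, V i k * z k) i' / m i')
      = ∑ k, (hessLin m a V l k * z k + hessConj m a V l k * conj (z k)) := by
    intro l
    rw [← sum_conj_mul_forceDeriv]
    refine Finset.sum_congr rfl fun i' _ => ?_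
    have := hm' i'
    field_simp
  simp only [e] at h
  rw [← h, mul_div_cancel₀ _ (hm' i)]

lemma force_mul {n : ℕ} (m : Fin n → ℝ) (a : Fin n → ℂ) (c : ℂ) (i : Fin n) :
    force m (fun i => c * a i) i = c / ((‖c‖ ^ 3 : ℝ) : ℂ) * force m a i := by
  simp only [force, Finset.mul_sum, ← mul_sub, norm_mul, mul_pow]
  refine Finset.sum_congr rfl fun j _ => ?_
  push_cast
  rw [mul_div_mul_comm]
  ring

lemma forceDeriv_mul {n : ℕ} (m : Fin n → ℝ) (a h : Fin n → ℂ) (c : ℂ) (i : Fin n) :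
    forceDeriv m (fun i => c * a i) (fun i => c * h i) i
      = c / ((‖c‖ ^ 3 : ℝ) : ℂ) * forceDeriv m a h i := by
  simp only [forceDeriv, Finset.mul_sum, ← mul_sub, kernelDeriv_mul]
  exact Finset.sum_congr rfl fun j _ => by ring

/-! ### Normalized central configurations -/

/-- A collision-free configuration with centre of mass `0` and moment of inertia `1` on which the
force is `-U(a)` times the mass times the position. -/
structure IsNormalizedCentral {n : ℕ} (m : Fin n → ℝ) (a : Fin n → ℂ) : Prop where
  injective : Function.Injective a
  centred : ∑ i, (m i : ℂ) * a i = 0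
  inertia : ∑ i, m i * ‖a i‖ ^ 2 = 1
  force_eq : ∀ i, force m a i = -potential m a * m i * a i

lemma potential_pos {k : ℕ} {m : Fin (k + 2) → ℝ} {a : Fin (k + 2) → ℂ} (hm : ∀ i, 0 < m i)
    (ha : Function.Injective a) : 0 < potential m a := by
  have hterm : ∀ i, ∀ j ∈ Finset.Ioi i, 0 < m i * m j / ‖a i - a j‖ := fun i j hj =>
    div_pos (mul_pos (hm i) (hm j)) (norm_pos_iff.2 (sub_ne_zero.2 fun h =>
      (Finset.mem_Ioi.1 hj).ne (ha h)))
  refine Finset.sum_pos' (fun i _ => Finset.sum_nonneg fun j hj => (hterm i j hj).le)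
    ⟨0, Finset.mem_univ _, Finset.sum_pos (hterm 0) ⟨1, by simp⟩⟩

lemma two_mul_potential {n : ℕ} (m : Fin n → ℝ) (a : Fin n → ℂ) :
    2 * potential m a = ∑ i, ∑ j, m i * m j / ‖a j - a i‖ := by
  rw [← sum_Ioi_add_swap (fun i j => m i * m j / ‖a j - a i‖) (by simp), potential, Finset.mul_sum]
  refine Finset.sum_congr rfl fun i _ => ?_
  rw [Finset.mul_sum]
  refine Finset.sum_congr rfl fun j _ => ?_
  rw [norm_sub_rev (a j)]
  ring

/-! ### Kepler motion -/

lemma surjective_of_le_deriv {θ θ' : ℝ → ℝ} (hθ : ∀ t, HasDerivAt θ (θ' t) t) {c : ℝ} (hc : 0 < c)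
    (hc' : ∀ t, c ≤ θ' t) : Function.Surjective θ := by
  have hmono : Monotone fun t => θ t - c * t := by
    have hd : ∀ t, HasDerivAt (fun t => θ t - c * t) (θ' t - c) t := fun t => by
      simpa using (hθ t).fun_sub ((hasDerivAt_id t).const_mul c)
    refine monotone_of_deriv_nonneg (fun t => (hd t).differentiableAt) fun t => ?_
    rw [(hd t).deriv]
    linarith [hc' t]
  have hcont : Continuous θ := continuous_iff_continuousAt.2 fun t => (hθ t).continuousAt
  refine hcont.surjective ?_ ?_
  · refine tendsto_atTop_mono' atTop ?_
      (tendsto_atTop_add_const_left atTop (θ 0) (tendsto_id.const_mul_atTop hc))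
    filter_upwards [eventually_ge_atTop 0] with t ht
    have := hmono ht
    simp at this ⊢
    linarith
  · refine tendsto_atBot_mono' atBot ?_
      (tendsto_atBot_add_const_left atBot (θ 0) (tendsto_id.const_mul_atBot hc))
    filter_upwards [eventually_le_atBot 0] with t ht
    have := hmono ht
    simp at this ⊢
    linarith

/-- Change of the independent variable. -/
lemma hasDerivAt_comp_iff {E : Type*} [NormedAddCommGroup E] [NormedSpace ℝ E] {θ θ' : ℝ → ℝ}
    (hθ : ∀ t, HasDerivAt θ (θ' t) t) {c : ℝ} (hc : 0 < c) (hc' : ∀ t, c ≤ θ' t) (ξ G : ℝ → E) :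
    (∀ t, HasDerivAt (fun t => ξ (θ t)) (θ' t • G (θ t)) t) ↔ ∀ s, HasDerivAt ξ (G s) s := by
  have hpos : ∀ t, 0 < θ' t := fun t => hc.trans_le (hc' t)
  constructor
  · intro h s
    have hmono : StrictMono θ := strictMono_of_deriv_pos fun t => by
      rw [(hθ t).deriv]; exact hpos t
    let g := hmono.orderIsoOfSurjective θ (surjective_of_le_deriv hθ hc hc')
    have hg : ∀ s, θ (g.symm s) = s := fun s => g.apply_symm_apply s
    have hd : HasDerivAt g.symm (θ' (g.symm s))⁻¹ s :=
      HasDerivAt.of_local_left_inverse g.symm.continuous.continuousAt (hθ _) (hpos _).ne'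
        (Eventually.of_forall hg)
    have := (h (g.symm s)).scomp s hd
    simpa [Function.comp_def, hg, smul_smul, inv_mul_cancel₀ (hpos (g.symm s)).ne'] using this
  · intro h t
    exact (h (θ t)).scomp t (hθ t)

lemma one_add_mul_cos_pos {e : ℝ} (he₀ : 0 ≤ e) (he₁ : e < 1) (s : ℝ) :
    1 - e ≤ 1 + e * Real.cos s ∧ 0 < 1 + e * Real.cos s := by
  have := mul_le_mul_of_nonneg_left (Real.neg_one_le_cos s) he₀
  constructor <;> linarith

section Kepler

variable {e μ p : ℝ} {θ : ℝ → ℝ}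

lemma radius_pos (he₀ : 0 ≤ e) (he₁ : e < 1) (hp : 0 < p) (s : ℝ) : 0 < radius p e s :=
  div_pos hp (one_add_mul_cos_pos he₀ he₁ s).2

lemma IsTrueAnomaly.hasDerivAt_radius (he₀ : 0 ≤ e) (he₁ : e < 1) (hp : 0 < p)
    (hθ : IsTrueAnomaly μ p e θ) (t : ℝ) :
    HasDerivAt (fun s => radius p e (θ s)) (Real.sqrt (μ * p) / p * (e * Real.sin (θ t))) t := by
  have hD := (one_add_mul_cos_pos he₀ he₁ (θ t)).2
  have h := (((hθ t).cos.const_mul e).const_add 1).fun_inv hD.ne' |>.const_mul p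
  simp only [radius, div_eq_mul_inv p]
  refine h.congr_deriv ?_
  simp only [radius]
  field_simp

lemma IsTrueAnomaly.hasDerivAt_radius_deriv (hμ : 0 ≤ μ) (hp : 0 < p)
    (hθ : IsTrueAnomaly μ p e θ) (t : ℝ) :
    HasDerivAt (fun s => Real.sqrt (μ * p) / p * (e * Real.sin (θ s)))
      (μ * (e * Real.cos (θ t)) / radius p e (θ t) ^ 2) t := by
  refine (((hθ t).sin.const_mul e).const_mul (Real.sqrt (μ * p) / p)).congr_deriv ?_
  have h := Real.mul_self_sqrt (mul_nonneg hμ hp.le)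
  calc _ = (Real.sqrt (μ * p) * Real.sqrt (μ * p)) / p * (e * Real.cos (θ t))
      / radius p e (θ t) ^ 2 := by ring
    _ = _ := by rw [h]; field_simp

lemma IsTrueAnomaly.exists_le (he₀ : 0 ≤ e) (he₁ : e < 1) (hμ : 0 < μ) (hp : 0 < p) :
    ∃ c > 0, ∀ s, c ≤ Real.sqrt (μ * p) / radius p e s ^ 2 := by
  have h1 : 0 < 1 - e := by linarith
  refine ⟨Real.sqrt (μ * p) / (p / (1 - e)) ^ 2, by positivity, fun s => ?_⟩
  have h := one_add_mul_cos_pos he₀ he₁ s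
  have := radius_pos he₀ he₁ hp s
  refine div_le_div_of_nonneg_left (Real.sqrt_nonneg _) (by positivity) ?_
  refine pow_le_pow_left₀ this.le ?_ 2
  exact div_le_div_of_nonneg_left hp.le h1 h.1

end Kepler

lemma hasDerivAt_rot {θ : ℝ → ℝ} {θ' t : ℝ} (hθ : HasDerivAt θ θ' t) :
    HasDerivAt (fun s => Complex.exp (θ s * Complex.I))
      (Complex.exp (θ t * Complex.I) * (θ' * Complex.I)) t :=
  (hθ.ofReal_comp.mul_const Complex.I).cexp

/-- The linear equations of motion in rotating and pulsating coordinates. -/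
lemma hasDerivAt_rotating_iff {r ρ θ : ℝ → ℝ} {σ ρ' t : ℝ} (hr : HasDerivAt r (ρ t) t)
    (hρ : HasDerivAt ρ ρ' t) (hθ : HasDerivAt θ (σ ^ 2 / r t ^ 2) t) (hr0 : ∀ s, r s ≠ 0)
    (hσ : σ ≠ 0) (z Z : ℝ → ℂ) (A : ℂ) :
    (HasDerivAt (fun s => Complex.exp (θ s * Complex.I) * (((r s / σ : ℝ) : ℂ) * z s))
        (Complex.exp (θ t * Complex.I) *
          (((σ / r t : ℝ) : ℂ) * Z t + ((ρ t / σ : ℝ) : ℂ) * z t)) t ∧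
      HasDerivAt (fun s => Complex.exp (θ s * Complex.I) *
          (((σ / r s : ℝ) : ℂ) * Z s + ((ρ s / σ : ℝ) : ℂ) * z s))
        (Complex.exp (θ t * Complex.I) * A) t) ↔
    (HasDerivAt z (((σ ^ 2 / r t ^ 2 : ℝ) : ℂ) * (Z t - Complex.I * z t)) t ∧
      HasDerivAt Z (((σ ^ 2 / r t ^ 2 : ℝ) : ℂ) * (-Complex.I * Z t)
        + ((r t / σ : ℝ) : ℂ) * (A - ((ρ' / σ : ℝ) : ℂ) * z t)) t) := by
  have hrc : ∀ s, (r s : ℂ) ≠ 0 := fun s => by exact_mod_cast hr0 s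
  have hσc : (σ : ℂ) ≠ 0 := by exact_mod_cast hσ
  have hE := hasDerivAt_rot hθ
  have hE' : HasDerivAt (fun s => Complex.exp (-(θ s * Complex.I)))
      (Complex.exp (-(θ t * Complex.I)) * -((σ ^ 2 / r t ^ 2 : ℝ) * Complex.I)) t :=
    (hθ.ofReal_comp.mul_const Complex.I).neg.cexp
  have hR := (hr.div_const σ).ofReal_comp
  have hS := ((hr.fun_inv (hr0 t)).const_mul σ).ofReal_comp
  simp only [← div_eq_mul_inv] at hS
  have hT := (hρ.div_const σ).ofReal_comp
  have hcancel : ∀ s, Complex.exp (-(θ s * Complex.I)) * Complex.exp (θ s * Complex.I) = 1 :=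
    fun s => by rw [← Complex.exp_add]; simp
  have hI := Complex.I_sq
  constructor
  · rintro ⟨h₁, h₂⟩
    have hzd : DifferentiableAt ℝ z t := by
      have h := (hE'.mul (((hr.fun_inv (hr0 t)).const_mul σ).ofReal_comp)).mul h₁
      refine (h.congr_of_eventuallyEq (Eventually.of_forall fun s => ?_)).differentiableAt
      have := hrc s
      simp only [Pi.mul_apply]
      push_cast
      calc z s = 1 * z s := (one_mul _).symm
        _ = _ := by rw [← hcancel s]; field_simp
    have hZd : DifferentiableAt ℝ Z t := by
      have h := hR.mul ((hE'.mul h₂).sub (hT.mul hzd.hasDerivAt))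
      refine (h.congr_of_eventuallyEq (Eventually.of_forall fun s => ?_)).differentiableAt
      have := hrc s
      simp only [Pi.mul_apply, Pi.sub_apply, ← mul_assoc, hcancel, one_mul]
      push_cast
      field_simp
      ring
    have hE0 := Complex.exp_ne_zero (θ t * Complex.I)
    have hrt := hrc t
    have u₁ := h₁.unique (hE.mul (hR.mul hzd.hasDerivAt))
    have u₂ := h₂.unique (hE.mul ((hS.mul hZd.hasDerivAt).add (hT.mul hzd.hasDerivAt)))
    simp only [mul_assoc, ← mul_add] at u₁ u₂
    replace u₁ := mul_left_cancel₀ hE0 u₁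
    replace u₂ := mul_left_cancel₀ hE0 u₂
    have ez : deriv z t = ((σ ^ 2 / r t ^ 2 : ℝ) : ℂ) * (Z t - Complex.I * z t) := by
      push_cast at u₁ ⊢
      field_simp at u₁ ⊢
      linear_combination -u₁
    refine ⟨hzd.hasDerivAt.congr_deriv ez, hZd.hasDerivAt.congr_deriv ?_⟩
    rw [u₂, ez]
    push_cast
    field_simp
    ring
  · rintro ⟨h₁, h₂⟩
    constructor
    · refine (hE.mul (hR.mul h₁)).congr_deriv ?_
      have := hrc t
      simp only [Pi.mul_apply]
      push_cast
      field_simp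
      ring
    · refine (hE.mul ((hS.mul h₂).add (hT.mul h₁))).congr_deriv ?_
      have := hrc t
      simp only [Pi.mul_apply, Pi.add_apply]
      push_cast
      field_simp
      ring

/-! ### Reduction of the linearized system -/

/-- The positions in the rotating and pulsating frame. -/
def rotPos {n : ℕ} (σ r θ : ℝ) (x : Phase n) (j : Fin n) : ℂ :=
  Complex.exp (θ * Complex.I) * (((r / σ : ℝ) : ℂ) * pos x j)

/-- The momenta in the rotating and pulsating frame. -/
def rotMom {n : ℕ} (σ r ρ θ : ℝ) (x : Phase n) (j : Fin n) : ℂ :=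
  Complex.exp (θ * Complex.I) * (((σ / r : ℝ) : ℂ) * mom x j + ((ρ / σ : ℝ) : ℂ) * pos x j)

lemma mom_smul {n : ℕ} (c : ℝ) (x : Phase n) (i : Fin n) : mom (c • x) i = c * mom x i :=
  ((momL i).map_smul c x).trans (Complex.real_smul)

lemma pos_smul {n : ℕ} (c : ℝ) (x : Phase n) (i : Fin n) : pos (c • x) i = c * pos x i :=
  ((posL i).map_smul c x).trans (Complex.real_smul)

section Reduction

variable {k : ℕ} {m : Fin (k + 2) → ℝ} {a : Fin (k + 2) → ℂ}
  {V : Matrix (Fin (k + 2)) (Fin (k + 1)) ℂ}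

lemma changeOfCoords_eq {p e ρ t : ℝ} {θ : ℝ → ℝ}
    (h : HasDerivAt (fun s => radius p e (θ s)) ρ t) (x : Phase (k + 1)) :
    changeOfCoords m a V p e θ t x = phasePoint
      (fun i => m i * ∑ j, V i j *
        rotMom ((potential m a * p) ^ (1 / 4 : ℝ)) (radius p e (θ t)) ρ (θ t) x j)
      (fun i => ∑ j, V i j *
        rotPos ((potential m a * p) ^ (1 / 4 : ℝ)) (radius p e (θ t)) (θ t) x j) := by
  simp only [changeOfCoords, h.deriv, rotMom, rotPos]

lemma conj_exp_mul_exp (s : ℝ) :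
    conj (Complex.exp (s * Complex.I)) * Complex.exp (s * Complex.I) = 1 := by
  rw [Complex.conj_mul', Complex.norm_exp_ofReal_mul_I]; simp

lemma IsFrame.sum_conj_sum_mul (hV : IsFrame m a V) (X Y : Fin (k + 1) → ℂ) :
    ∑ i, conj (∑ j, V i j * X j) * (m i * ∑ j, V i j * Y j) = ∑ j, conj (X j) * Y j := by
  have h : ∀ j, conj (X j) * Y j = ∑ i, conj (X j) * (m i * conj (V i j) * ∑ l, V i l * Y l) := by
    intro j
    rw [← Finset.mul_sum, hV.sum_conj_mul]
  simp only [h]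
  rw [Finset.sum_comm]
  refine Finset.sum_congr rfl fun i _ => ?_
  rw [map_sum, Finset.sum_mul]
  refine Finset.sum_congr rfl fun j _ => ?_
  rw [map_mul]
  ring

lemma IsFrame.symplecticForm_frame (hV : IsFrame m a V) (X Y X' Y' : Fin (k + 1) → ℂ) :
    symplecticForm
        (phasePoint (fun i => m i * ∑ j, V i j * Y j) (fun i => ∑ j, V i j * X j))
        (phasePoint (fun i => m i * ∑ j, V i j * Y' j) (fun i => ∑ j, V i j * X' j))
      = ∑ j, (conj (X j) * Y' j).re - ∑ j, (conj (Y j) * X' j).re := by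
  have h₁ := congrArg Complex.re (hV.sum_conj_sum_mul X Y')
  have h₂ := congrArg Complex.re (hV.sum_conj_sum_mul Y X')
  rw [Complex.re_sum, Complex.re_sum] at h₁ h₂
  simp only [symplecticForm_eq, mom_phasePoint, pos_phasePoint]
  rw [h₁, ← h₂]
  congr 1
  refine Finset.sum_congr rfl fun i _ => ?_
  rw [map_mul, Complex.conj_ofReal]
  ring_nf

lemma IsFrame.symplecticForm_rot (hV : IsFrame m a V) {σ r : ℝ} (ρ θ : ℝ) (hσ : σ ≠ 0)
    (hr : r ≠ 0) (x y : Phase (k + 1)) :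
    symplecticForm
        (phasePoint (fun i => m i * ∑ j, V i j * rotMom σ r ρ θ x j)
          (fun i => ∑ j, V i j * rotPos σ r θ x j))
        (phasePoint (fun i => m i * ∑ j, V i j * rotMom σ r ρ θ y j)
          (fun i => ∑ j, V i j * rotPos σ r θ y j))
      = symplecticForm x y := by
  rw [hV.symplecticForm_frame, symplecticForm_eq, ← Finset.sum_sub_distrib,
    ← Finset.sum_sub_distrib]
  refine Finset.sum_congr rfl fun j _ => ?_
  have hE := conj_exp_mul_exp θ
  have e₁ : conj (rotPos σ r θ x j) * rotMom σ r ρ θ y j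
      = conj (pos x j) * mom y j + ((r * ρ / σ ^ 2 : ℝ) : ℂ) * (conj (pos x j) * pos y j) := by
    have hr' : (r : ℂ) ≠ 0 := by exact_mod_cast hr
    have hσ' : (σ : ℂ) ≠ 0 := by exact_mod_cast hσ
    simp only [rotPos, rotMom, map_mul, Complex.conj_ofReal]
    rw [mul_mul_mul_comm, hE]
    push_cast
    field_simp
  have e₂ : conj (rotMom σ r ρ θ x j) * rotPos σ r θ y j
      = conj (mom x j) * pos y j + ((r * ρ / σ ^ 2 : ℝ) : ℂ) * (conj (pos x j) * pos y j) := by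
    have hr' : (r : ℂ) ≠ 0 := by exact_mod_cast hr
    have hσ' : (σ : ℂ) ≠ 0 := by exact_mod_cast hσ
    simp only [rotPos, rotMom, map_mul, map_add, Complex.conj_ofReal]
    rw [mul_mul_mul_comm, hE]
    push_cast
    field_simp
  rw [e₁, e₂, Complex.add_re, Complex.add_re]
  ring

lemma IsFrame.range_rot (hV : IsFrame m a V) (hm : ∀ i, 0 < m i) {σ r : ℝ} (ρ θ : ℝ) (hσ : σ ≠ 0)
    (hr : r ≠ 0) :
    Set.range (fun x : Phase (k + 1) =>
      phasePoint (fun i => m i * ∑ j, V i j * rotMom σ r ρ θ x j)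
          (fun i => ∑ j, V i j * rotPos σ r θ x j)) = centredPhase m := by
  have hr' : (r : ℂ) ≠ 0 := by exact_mod_cast hr
  have hσ' : (σ : ℂ) ≠ 0 := by exact_mod_cast hσ
  ext x
  constructor
  · rintro ⟨x, rfl⟩
    simp only [centredPhase, Set.mem_ofPred_eq, mom_phasePoint, pos_phasePoint]
    exact ⟨hV.sum_mul _, hV.sum_mul _⟩
  · rintro ⟨h₁, h₂⟩
    have hm' : ∀ i, (m i : ℂ) ≠ 0 := fun i => by exact_mod_cast (hm i).ne'
    obtain ⟨X, hX⟩ := hV.exists_eq hm h₂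
    obtain ⟨Y, hY⟩ := hV.exists_eq hm (w := fun i => mom x i / m i) (by
      rw [← h₁]
      exact Finset.sum_congr rfl fun i _ => mul_div_cancel₀ _ (hm' i))
    have hE := Complex.exp_ne_zero (θ * Complex.I)
    refine ⟨phasePoint
      (fun j => ((r / σ : ℝ) : ℂ) * ((Complex.exp (θ * Complex.I))⁻¹ * Y j
        - ((ρ / σ : ℝ) : ℂ) * (((σ / r : ℝ) : ℂ) * ((Complex.exp (θ * Complex.I))⁻¹ * X j))))
      (fun j => ((σ / r : ℝ) : ℂ) * ((Complex.exp (θ * Complex.I))⁻¹ * X j)), ?_⟩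
    refine phase_ext (fun i => ?_) fun i => ?_
    · simp only [mom_phasePoint, pos_phasePoint, rotMom]
      rw [(div_eq_iff (hm' i)).1 (hY i), mul_comm]
      congr 1
      refine Finset.sum_congr rfl fun j _ => ?_
      congr 1
      push_cast
      field_simp
      ring
    · simp only [pos_phasePoint, rotPos]
      rw [hX i]
      refine Finset.sum_congr rfl fun j _ => ?_
      congr 1
      push_cast
      field_simp

lemma IsFrame.hasDerivAt_iff (hV : IsFrame m a V) {y : ℝ → Fin (k + 1) → ℂ} {y' : Fin (k + 1) → ℂ}
    {t : ℝ} :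
    (∀ i, HasDerivAt (fun s => ∑ j, V i j * y s j) (∑ j, V i j * y' j) t)
      ↔ ∀ j, HasDerivAt (fun s => y s j) (y' j) t := by
  constructor
  · intro h j
    have := HasDerivAt.fun_sum (u := Finset.univ)
      fun i _ => (h i).const_mul ((m i : ℂ) * conj (V i j))
    simpa only [hV.sum_conj_mul] using this
  · intro h i
    exact HasDerivAt.fun_sum fun j _ => (h j).const_mul (V i j)

lemma IsFrame.hasDerivAt_mass_mul_iff (hV : IsFrame m a V) (hm : ∀ i, 0 < m i)
    {y : ℝ → Fin (k + 1) → ℂ} {y' : Fin (k + 1) → ℂ} {t : ℝ} :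
    (∀ i, HasDerivAt (fun s => (m i : ℂ) * ∑ j, V i j * y s j) (m i * ∑ j, V i j * y' j) t)
      ↔ ∀ j, HasDerivAt (fun s => y s j) (y' j) t := by
  rw [← hV.hasDerivAt_iff]
  refine forall_congr' fun i => ⟨fun h => ?_, fun h => h.const_mul _⟩
  have hmi : (m i : ℂ) ≠ 0 := by exact_mod_cast (hm i).ne'
  simpa only [inv_mul_cancel_left₀ hmi] using h.const_mul (m i : ℂ)⁻¹

lemma injective_erePos {n : ℕ} {a : Fin n → ℂ} (ha : Function.Injective a) {p e t : ℝ} {θ : ℝ → ℝ}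
    (hr : radius p e (θ t) ≠ 0) : Function.Injective (erePos a p e θ t) := by
  intro i j h
  refine ha (mul_left_cancel₀ ?_ h)
  exact mul_ne_zero (by exact_mod_cast hr) (Complex.exp_ne_zero _)

lemma norm_ofReal_mul_exp {r : ℝ} (hr : 0 < r) (s : ℝ) :
    ‖(r : ℂ) * Complex.exp (s * Complex.I)‖ = r := by
  rw [norm_mul, Complex.norm_exp_ofReal_mul_I, Complex.norm_of_nonneg hr.le, mul_one]

lemma IsNormalizedCentral.solvesHamilton (ha : IsNormalizedCentral m a) (hm : ∀ i, 0 < m i)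
    {e p : ℝ} {θ : ℝ → ℝ} (he₀ : 0 ≤ e) (he₁ : e < 1) (hp : 0 < p)
    (hθ : IsTrueAnomaly (potential m a) p e θ) :
    SolvesHamilton (hamiltonian m) (ere m a p e θ) := by
  have hμ := potential_pos hm ha.injective
  have hr : ∀ t, 0 < radius p e (θ t) := fun t => radius_pos he₀ he₁ hp _
  set μ := potential m a with hμdef
  set w := Real.sqrt (μ * p) with hw
  have hw2 : (w : ℂ) ^ 2 = μ * p := by
    rw [hw]; norm_cast; exact Real.sq_sqrt (by positivity)
  have hrd := hθ.hasDerivAt_radius he₀ he₁ hp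
  have hrdd := hθ.hasDerivAt_radius_deriv hμ.le hp
  have hpos : ∀ t i, HasDerivAt (fun s => erePos a p e θ s i)
      (((w / p * (e * Real.sin (θ t)) : ℝ) + (w / radius p e (θ t) : ℝ) * Complex.I)
        * Complex.exp (θ t * Complex.I) * a i) t := by
    intro t i
    refine (((hrd t).ofReal_comp.mul (hasDerivAt_rot (hθ t))).mul_const (a i)).congr_deriv ?_
    have : (radius p e (θ t) : ℂ) ≠ 0 := by exact_mod_cast (hr t).ne'
    push_cast
    field_simp
    ring
  intro t
  have hinj : Function.Injective (pos (ere m a p e θ t)) := by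
    rw [ere, pos_phasePoint]; exact injective_erePos ha.injective (hr t).ne'
  have hmi : ∀ i, (m i : ℂ) ≠ 0 := fun i => by exact_mod_cast (hm i).ne'
  rw [grad_hamiltonian m hinj, J_mulVec, hasDerivAt_phase_iff]
  simp only [mom_phasePoint, pos_phasePoint, ere, neg_neg]
  constructor
  · intro i
    have e₁ : (fun s => (m i : ℂ) * deriv (fun s => erePos a p e θ s i) s) = fun s =>
        (m i : ℂ) * (((w / p * (e * Real.sin (θ s)) : ℝ) + (w * (radius p e (θ s))⁻¹ : ℝ) * Complex.I)
        * Complex.exp (θ s * Complex.I) * a i) := by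
      funext s; rw [(hpos s i).deriv, div_eq_mul_inv w (radius _ _ _)]
    rw [e₁]
    refine (((((hrdd t).ofReal_comp.add
      ((((hrd t).fun_inv (hr t).ne').const_mul w).ofReal_comp.mul_const Complex.I)).mul
        (hasDerivAt_rot (hθ t))).mul_const (a i)).const_mul (m i : ℂ)).congr_deriv ?_
    have hF := force_mul m a (radius p e (θ t) * Complex.exp (θ t * Complex.I)) i
    rw [norm_ofReal_mul_exp (hr t), ha.force_eq i] at hF
    rw [show force m (erePos a p e θ t) i = _ from hF]
    have hrc : (radius p e (θ t) : ℂ) ≠ 0 := by exact_mod_cast (hr t).ne'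
    have hpc : (p : ℂ) ≠ 0 := by exact_mod_cast hp.ne'
    have hpr : (p : ℂ) = radius p e (θ t) * (1 + e * Complex.cos (θ t)) := by
      have := (one_add_mul_cos_pos he₀ he₁ (θ t)).2.ne'
      rw [← Complex.ofReal_cos]
      norm_cast
      rw [radius]
      field_simp
    simp only [Pi.add_apply, ← hw]
    push_cast
    generalize (radius p e (θ t) : ℂ) = R at *
    have hI := Complex.I_sq
    field_simp
    rw [← hμdef]
    linear_combination (m i : ℂ) * a i * (w ^ 2 * p * hI - p * hw2 - μ * p * hpr)
  · intro i
    refine (hpos t i).congr_deriv ?_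
    rw [(hpos t i).deriv, mul_div_cancel_left₀ _ (hmi i)]

lemma IsFrame.forceDeriv_rotPos (hV : IsFrame m a V) (hm : ∀ i, 0 < m i) {σ r : ℝ} (θ : ℝ)
    (hr : 0 < r) (x : Phase (k + 1)) (i : Fin (k + 2)) :
    forceDeriv m (fun i => (r : ℂ) * Complex.exp (θ * Complex.I) * a i)
        (fun i => ∑ j, V i j * rotPos σ r θ x j) i
      = m i * ∑ j, V i j * (Complex.exp (θ * Complex.I) * (((r ^ 2 * σ)⁻¹ : ℝ) *
          ∑ l, (hessLin m a V j l * pos x l + hessConj m a V j l * conj (pos x l)))) := by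
  have e₁ : (fun i => ∑ j, V i j * rotPos σ r θ x j) = fun i =>
      (r : ℂ) * Complex.exp (θ * Complex.I) * ∑ j, V i j * (((σ⁻¹ : ℝ) : ℂ) * pos x j) := by
    funext i
    rw [Finset.mul_sum]
    refine Finset.sum_congr rfl fun j _ => ?_
    rw [rotPos]
    push_cast
    ring
  have hrc : (r : ℂ) ≠ 0 := by exact_mod_cast hr.ne'
  rw [e₁, forceDeriv_mul, hV.forceDeriv_eq hm, norm_ofReal_mul_exp hr, Finset.mul_sum,
    Finset.mul_sum, Finset.mul_sum]
  refine Finset.sum_congr rfl fun j _ => ?_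
  have e₂ : ∑ l, (hessLin m a V j l * (((σ⁻¹ : ℝ) : ℂ) * pos x l)
        + hessConj m a V j l * conj (((σ⁻¹ : ℝ) : ℂ) * pos x l))
      = ((σ⁻¹ : ℝ) : ℂ) *
        ∑ l, (hessLin m a V j l * pos x l + hessConj m a V j l * conj (pos x l)) := by
    rw [Finset.mul_sum]
    refine Finset.sum_congr rfl fun l _ => ?_
    rw [map_mul, Complex.conj_ofReal]
    ring
  rw [e₂]
  push_cast
  field_simp

/-- The linearized system at an elliptic relative equilibrium, in the coordinates given by a frame,
is the linear system with matrix `reducedMatrix`. -/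
theorem IsNormalizedCentral.linearizationReducesTo (ha : IsNormalizedCentral m a)
    (hm : ∀ i, 0 < m i) (hV : IsFrame m a V) {e : ℝ} (he₀ : 0 ≤ e) (he₁ : e < 1) :
    LinearizationReducesTo m a e V
      (reducedMatrix (((potential m a : ℝ) : ℂ)⁻¹ • hessLin m a V)
        (((potential m a : ℝ) : ℂ)⁻¹ • hessConj m a V) e) := by
  refine ⟨fun s => reducedMatrix_isSymm e s (fun j l => ?_) (fun j l => ?_), ?_⟩
  · simp only [Matrix.smul_apply, smul_eq_mul, hessLin_conj m a V j l, map_mul, map_inv₀,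
      Complex.conj_ofReal]
  · simp only [Matrix.smul_apply, hessConj_symm m a V j l]
  intro p θ hp hθ
  have hμ := potential_pos hm ha.injective
  have hr : ∀ t, 0 < radius p e (θ t) := fun t => radius_pos he₀ he₁ hp _
  have hrd := hθ.hasDerivAt_radius he₀ he₁ hp
  have hrdd := hθ.hasDerivAt_radius_deriv hμ.le hp
  have hσ : 0 < (potential m a * p) ^ (1 / 4 : ℝ) := Real.rpow_pos_of_pos (mul_pos hμ hp) _
  have hσ2 : ((potential m a * p) ^ (1 / 4 : ℝ)) ^ 2 = Real.sqrt (potential m a * p) := by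
    rw [← Real.rpow_natCast, ← Real.rpow_mul (mul_pos hμ hp).le, Real.sqrt_eq_rpow]
    norm_num
  refine ⟨ha.solvesHamilton hm he₀ he₁ hp hθ, fun t x y => ?_, fun t => ?_, fun ξ => ?_⟩
  · rw [changeOfCoords_eq (hrd t), changeOfCoords_eq (hrd t)]
    exact hV.symplecticForm_rot _ _ hσ.ne' (hr t).ne' x y
  · rw [← hV.range_rot hm (Real.sqrt (potential m a * p) / p * (e * Real.sin (θ t))) (θ t) hσ.ne'
      (hr t).ne']
    exact congrArg Set.range (funext fun x => changeOfCoords_eq (hrd t) x)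
  obtain ⟨c, hc, hc'⟩ := IsTrueAnomaly.exists_le he₀ he₁ hμ hp
  refine Iff.trans ?_ (hasDerivAt_comp_iff hθ hc (fun t => hc' (θ t)) ξ _)
  refine forall_congr' fun t => ?_
  have hinj : Function.Injective (pos (ere m a p e θ t)) := by
    rw [ere, pos_phasePoint]; exact injective_erePos ha.injective (hr t).ne'
  have hmi : ∀ i, (m i : ℂ) ≠ 0 := fun i => by exact_mod_cast (hm i).ne'
  have hcc : (fun t => changeOfCoords m a V p e θ t (ξ (θ t))) = fun t => _ :=
    funext fun t => changeOfCoords_eq (hrd t) (ξ (θ t))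
  rw [← Matrix.mulVec_mulVec, hessian_hamiltonian_mulVec m hinj, J_mulVec, hcc,
    hasDerivAt_phase_iff, ← Matrix.mulVec_mulVec, reducedMatrix_mulVec, J_mulVec,
    hasDerivAt_phase_iff]
  generalize (potential m a * p) ^ (1 / 4 : ℝ) = σ at *
  have hpos : pos (ere m a p e θ t)
      = fun i => (radius p e (θ t) : ℂ) * Complex.exp (θ t * Complex.I) * a i := by
    rw [ere, pos_phasePoint]; rfl
  simp only [mom_phasePoint, pos_phasePoint, neg_neg, hpos, hV.forceDeriv_rotPos hm (θ t) (hr t),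
    mul_div_cancel_left₀ _ (hmi _), mom_smul, pos_smul]
  rw [hV.hasDerivAt_mass_mul_iff hm, hV.hasDerivAt_iff, and_comm, ← forall_and,
    and_comm (b := ∀ i, HasDerivAt (fun s => pos (ξ (θ s)) i) _ t), ← forall_and]
  refine forall_congr' fun j => ?_
  refine (hasDerivAt_rotating_iff (hrd t) (hrdd t) (by rw [hσ2]; exact hθ t) (fun s => (hr s).ne')
    hσ.ne' (fun s => pos (ξ (θ s)) j) (fun s => mom (ξ (θ s)) j) _).trans ?_
  have hS : ∑ l, ((((potential m a : ℝ) : ℂ)⁻¹ • hessLin m a V) j l * pos (ξ (θ t)) l +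
        (((potential m a : ℝ) : ℂ)⁻¹ • hessConj m a V) j l * conj (pos (ξ (θ t)) l))
      = ((potential m a : ℝ) : ℂ)⁻¹ * ∑ l, (hessLin m a V j l * pos (ξ (θ t)) l +
        hessConj m a V j l * conj (pos (ξ (θ t)) l)) := by
    rw [Finset.mul_sum]
    refine Finset.sum_congr rfl fun l _ => ?_
    simp only [Matrix.smul_apply, smul_eq_mul]
    ring
  have hD := (one_add_mul_cos_pos he₀ he₁ (θ t)).2
  have hpr : p = radius p e (θ t) * (1 + e * Real.cos (θ t)) := by
    rw [radius]; field_simp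
  have h4 : (σ : ℂ) ^ 4 = potential m a * (radius p e (θ t) * (1 + e * Real.cos (θ t))) := by
    have : σ ^ 4 = potential m a * p := by
      rw [show σ ^ 4 = (σ ^ 2) ^ 2 by ring, hσ2, Real.sq_sqrt (mul_pos hμ hp).le]
    rw [hpr] at this
    exact_mod_cast this
  rw [hS, ← hσ2]
  refine and_congr_right fun _ => ?_
  refine iff_of_eq (congrArg (fun d => HasDerivAt _ d t) ?_)
  have hR := hr t
  generalize ∑ l, (hessLin m a V j l * pos (ξ (θ t)) l +
        hessConj m a V j l * conj (pos (ξ (θ t)) l)) = S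
  generalize radius p e (θ t) = R at *
  generalize Real.cos (θ t) = C at *
  generalize potential m a = μ at *
  have hRc : (R : ℂ) ≠ 0 := by exact_mod_cast hR.ne'
  have hμc : (μ : ℂ) ≠ 0 := by exact_mod_cast hμ.ne'
  have hσc : (σ : ℂ) ≠ 0 := by exact_mod_cast hσ.ne'
  have hDc : (1 + e * C : ℂ) ≠ 0 := by exact_mod_cast hD.ne'
  push_cast
  field_simp
  rw [h4]
  ring

end Reduction

/-! ### Normalization of central configurations -/

lemma force_antisymm {n : ℕ} (m : Fin n → ℝ) (a : Fin n → ℂ) (i j : Fin n) :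
    (m j * m i : ℂ) * ((a i - a j) / ((‖a i - a j‖ ^ 3 : ℝ) : ℂ))
      = -((m i * m j : ℂ) * ((a j - a i) / ((‖a j - a i‖ ^ 3 : ℝ) : ℂ))) := by
  rw [norm_sub_rev (a j)]
  ring

lemma sum_mul_force {n : ℕ} (m : Fin n → ℝ) (a u : Fin n → ℂ) :
    ∑ i, u i * force m a i = -(1 / 2) * ∑ i, ∑ j,
      (u j - u i) * ((m i * m j : ℂ) * ((a j - a i) / ((‖a j - a i‖ ^ 3 : ℝ) : ℂ))) :=
  sum_mul_sum_of_antisymm u (force_antisymm m a)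

lemma conj_mul_div_norm_pow_three (w : ℂ) :
    conj w * (w / ((‖w‖ ^ 3 : ℝ) : ℂ)) = ((‖w‖⁻¹ : ℝ) : ℂ) := by
  by_cases hw : w = 0
  · simp [hw]
  have hn : (‖w‖ : ℂ) ≠ 0 := by simpa using hw
  rw [mul_div_assoc', Complex.conj_mul']
  push_cast
  field_simp

lemma sum_conj_mul_force {n : ℕ} (m : Fin n → ℝ) (a : Fin n → ℂ) :
    ∑ i, conj (a i) * force m a i = -((potential m a : ℝ) : ℂ) := by
  have h : ((2 * potential m a : ℝ) : ℂ) = ∑ i, ∑ j, conj (a j - a i) *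
      ((m i * m j : ℂ) * ((a j - a i) / ((‖a j - a i‖ ^ 3 : ℝ) : ℂ))) := by
    rw [two_mul_potential]
    push_cast
    refine Finset.sum_congr rfl fun i _ => Finset.sum_congr rfl fun j _ => ?_
    rw [mul_left_comm, ← Complex.ofReal_pow, conj_mul_div_norm_pow_three]
    push_cast
    ring
  rw [sum_mul_force]
  simp only [map_sub] at h
  rw [← h]
  push_cast
  ring

lemma force_sub_const {n : ℕ} (m : Fin n → ℝ) (q : Fin n → ℂ) (c : ℂ) (i : Fin n) :
    force m (fun i => q i - c) i = force m q i := by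
  simp only [force, sub_sub_sub_cancel_right]

lemma sum_erase_eq_force {n : ℕ} (m : Fin n → ℝ) (q : Fin n → ℂ) (i : Fin n) :
    ∑ j ∈ Finset.univ.erase i, (m i * m j : ℂ) * (q j - q i) / ((‖q i - q j‖ ^ 3 : ℝ) : ℂ)
      = force m q i := by
  rw [force, ← Finset.add_sum_erase _ _ (Finset.mem_univ i)]
  simp only [sub_self, zero_div, mul_zero, zero_add]
  refine Finset.sum_congr rfl fun j _ => ?_
  rw [norm_sub_rev, mul_div_assoc]

lemma sum_mul_sub_centre {n : ℕ} (m : Fin n → ℝ) (q : Fin n → ℂ) (hM : ∑ i, m i ≠ 0) :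
    ∑ i, (m i : ℂ) * (q i - centre m q) = 0 := by
  have hM' : ((∑ i, m i : ℝ) : ℂ) ≠ 0 := by exact_mod_cast hM
  simp only [mul_sub, Finset.sum_sub_distrib, ← Finset.sum_mul]
  rw [centre, ← Complex.ofReal_sum, mul_div_cancel₀ _ hM', sub_self]

lemma inertia_pos {k : ℕ} {m : Fin (k + 2) → ℝ} {q : Fin (k + 2) → ℂ} (hm : ∀ i, 0 < m i)
    (hq : Function.Injective q) (c : ℂ) : 0 < ∑ j, m j * ‖q j - c‖ ^ 2 := by
  have hnn : ∀ j ∈ Finset.univ, 0 ≤ m j * ‖q j - c‖ ^ 2 := fun j _ =>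
    mul_nonneg (hm j).le (sq_nonneg _)
  refine lt_of_le_of_ne (Finset.sum_nonneg hnn) fun h => ?_
  have h0 := (Finset.sum_eq_zero_iff_of_nonneg hnn).1 h.symm
  have hc : ∀ j, q j = c := fun j => by
    have := h0 j (Finset.mem_univ j)
    simpa [(hm j).ne', sub_eq_zero] using this
  exact absurd (hq ((hc 0).trans (hc 1).symm)) (by simp)

theorem IsCentralConfiguration.isNormalizedCentral {k : ℕ} {m : Fin (k + 2) → ℝ}
    {q : Fin (k + 2) → ℂ} (hm : ∀ i, 0 < m i) (hq : IsCentralConfiguration m q) :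
    IsNormalizedCentral m (normalized m q) := by
  obtain ⟨hinj, lam, hlam⟩ := hq
  have hI := inertia_pos hm hinj (centre m q)
  have hM : ∑ i, m i ≠ 0 := (Finset.sum_pos (fun i _ => hm i) ⟨0, Finset.mem_univ _⟩).ne'
  set s := Real.sqrt (∑ j, m j * ‖q j - centre m q‖ ^ 2) with hs
  have hs0 : 0 < s := Real.sqrt_pos.2 hI
  have hsc : (s : ℂ) ≠ 0 := by exact_mod_cast hs0.ne'
  have ha : ∀ i, normalized m q i = (s : ℂ)⁻¹ * (q i - centre m q) := fun i => by
    rw [normalized, div_eq_inv_mul]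
  have hinertia : ∑ i, m i * ‖normalized m q i‖ ^ 2 = 1 := by
    have h2 : s ^ 2 = ∑ j, m j * ‖q j - centre m q‖ ^ 2 := Real.sq_sqrt hI.le
    have : ∀ i, m i * ‖normalized m q i‖ ^ 2 = (s ^ 2)⁻¹ * (m i * ‖q i - centre m q‖ ^ 2) := by
      intro i
      rw [ha, norm_mul, norm_inv, Complex.norm_of_nonneg hs0.le]
      ring
    simp only [this, ← Finset.mul_sum]
    rw [← h2]
    field_simp
  have hforce : ∀ i, force m (normalized m q) i = -(lam * s ^ 3) * m i * normalized m q i := by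
    intro i
    rw [show normalized m q = fun i => (s : ℂ)⁻¹ * (q i - centre m q) from funext ha, force_mul,
      force_sub_const, ← sum_erase_eq_force, hlam i, norm_inv, Complex.norm_of_nonneg hs0.le]
    push_cast
    field_simp
  refine ⟨fun i j h => ?_, ?_, hinertia, fun i => ?_⟩
  · rw [ha, ha] at h
    exact hinj (sub_left_injective (mul_left_cancel₀ (inv_ne_zero hsc) h))
  · simp only [ha, mul_left_comm _ (s : ℂ)⁻¹, ← Finset.mul_sum, sum_mul_sub_centre m q hM,
      mul_zero]
  · have h := sum_conj_mul_force m (normalized m q)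
    have e : ∀ i, conj (normalized m q i) * force m (normalized m q) i
        = -(lam * s ^ 3) * ((m i * ‖normalized m q i‖ ^ 2 : ℝ) : ℂ) := by
      intro i
      rw [hforce i]
      push_cast
      rw [← Complex.conj_mul']
      ring
    simp only [e, ← Finset.mul_sum] at h
    rw [← Complex.ofReal_sum, hinertia] at h
    rw [hforce i, ← h]
    simp

/-! ### The first column of a frame -/

section FirstColumn

variable {k : ℕ} {m : Fin (k + 2) → ℝ} {a : Fin (k + 2) → ℂ}
  {V : Matrix (Fin (k + 2)) (Fin (k + 1)) ℂ}

lemma IsFrame.hessLin_zero (hV : IsFrame m a V) (ha : IsNormalizedCentral m a) (j : Fin (k + 1)) :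
    hessLin m a V j 0 = if j = 0 then (potential m a : ℂ) / 2 else 0 := by
  have h := sum_mul_force m a fun i => conj (V i j)
  have h₁ : ∑ i, conj (V i j) * force m a i
      = -(potential m a : ℂ) * (if j = 0 then 1 else 0) := by
    rw [← hV.orthonormal j 0, Finset.mul_sum]
    refine Finset.sum_congr rfl fun i _ => ?_
    rw [ha.force_eq, hV.first]
    ring
  have h₂ : ∑ i, ∑ i', (conj (V i' j) - conj (V i j)) *
        ((m i * m i' : ℂ) * ((a i' - a i) / ((‖a i' - a i‖ ^ 3 : ℝ) : ℂ)))
      = 4 * hessLin m a V j 0 := by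
    rw [hessLin, Matrix.of_apply, ← mul_assoc, show (4 * (1 / 4) : ℂ) = 1 by norm_num, one_mul]
    refine Finset.sum_congr rfl fun i _ => Finset.sum_congr rfl fun i' _ => ?_
    rw [hV.first, hV.first, map_sub]
    ring
  rw [h₁, h₂] at h
  split_ifs at h ⊢ <;> linear_combination (1 / 2) * h

lemma IsFrame.hessConj_zero (hV : IsFrame m a V) (j : Fin (k + 1)) :
    hessConj m a V j 0 = 3 * hessLin m a V j 0 := by
  simp only [hessConj, hessLin, Matrix.of_apply]
  rw [← mul_assoc]
  norm_num
  refine Finset.sum_congr rfl fun i _ => Finset.sum_congr rfl fun i' _ => ?_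
  rw [hV.first, hV.first]
  by_cases hw : a i' - a i = 0
  · simp [hw]
  have hn : (‖a i' - a i‖ : ℂ) ≠ 0 := by simpa using hw
  have h2 : (‖a i' - a i‖ : ℂ) ^ 2 = (a i' - a i) * conj (a i' - a i) := by
    rw [Complex.mul_conj, Complex.normSq_eq_norm_sq]; push_cast; rfl
  rw [← map_sub conj (a i') (a i)]
  generalize a i' - a i = w at *
  field_simp
  rw [h2]
  ring

end FirstColumn

/-! ### The two-body problem -/

lemma isCentralConfiguration_two {m : Fin 2 → ℝ} {q : Fin 2 → ℂ} (hm : ∑ i, m i = 1)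
    (hq : q 0 ≠ q 1) : IsCentralConfiguration m q := by
  have hm' : (m 0 : ℂ) + m 1 = 1 := by
    rw [Fin.sum_univ_two] at hm; exact_mod_cast hm
  have hn : (‖q 0 - q 1‖ : ℂ) ≠ 0 := by simpa [sub_eq_zero] using hq
  refine ⟨fun i j h => ?_, (‖q 0 - q 1‖ ^ 3)⁻¹, fun i => ?_⟩
  · fin_cases i <;> fin_cases j <;> simp_all [eq_comm]
  · rw [sum_erase_eq_force, force, Fin.sum_univ_two, centre, Fin.sum_univ_two, hm]
    have hr := norm_sub_rev (q 1) (q 0)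
    fin_cases i
    · simp only [Fin.zero_eta, hr]
      push_cast
      field_simp
      linear_combination -(m 0 : ℂ) * q 0 * hm'
    · simp only [Fin.mk_one]
      push_cast
      field_simp
      linear_combination -(m 1 : ℂ) * q 1 * hm'

theorem exists_reduction_two {e : ℝ} (he₀ : 0 ≤ e) (he₁ : e < 1) (m : Fin 2 → ℝ) (q : Fin 2 → ℂ)
    (hm : ∀ i, 0 < m i) (hm1 : ∑ i, m i = 1) (hq : q 0 ≠ q 1) :
    ∃ V : Matrix (Fin 2) (Fin 1) ℂ, IsFrame m (normalized m q) V ∧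
      LinearizationReducesTo m (normalized m q) e V (fun s => directSum ![keplerPart e s]) := by
  have ha := (isCentralConfiguration_two hm1 hq).isNormalizedCentral hm
  set a := normalized m q
  have hV : IsFrame m a (Matrix.of fun i (_ : Fin 1) => a i) := by
    refine ⟨fun i => rfl, fun j => ha.centred, fun j j' => ?_⟩
    rw [if_pos (Subsingleton.elim (α := Fin 1) j j')]
    have h := ha.inertia
    apply_fun ((↑) : ℝ → ℂ) at h
    push_cast at h
    rw [← h]
    refine Finset.sum_congr rfl fun i _ => ?_
    rw [← Complex.conj_mul', Matrix.of_apply, mul_assoc]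
    rfl
  refine ⟨_, hV, ?_⟩
  have hμ : ((potential m a : ℝ) : ℂ) ≠ 0 := by
    exact_mod_cast (potential_pos hm ha.injective).ne'
  convert ha.linearizationReducesTo hm hV he₀ he₁ using 1
  funext s
  have e₁ : ((potential m a : ℝ) : ℂ)⁻¹ • hessLin m a (Matrix.of fun i (_ : Fin 1) => a i)
      = Matrix.diagonal fun _ => ((1 / 2 : ℝ) : ℂ) := by
    ext i j
    rw [Subsingleton.elim i 0, Subsingleton.elim j 0, Matrix.smul_apply, hV.hessLin_zero ha]
    simp
    field_simp
  have e₂ : ((potential m a : ℝ) : ℂ)⁻¹ • hessConj m a (Matrix.of fun i (_ : Fin 1) => a i)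
      = Matrix.diagonal fun _ => ((3 / 2 : ℝ) : ℂ) := by
    ext i j
    rw [Subsingleton.elim i 0, Subsingleton.elim j 0, Matrix.smul_apply, hV.hessConj_zero,
      hV.hessLin_zero ha]
    simp
    field_simp
  rw [e₁, e₂, reducedMatrix_diagonal (fun _ => 1 / 2) (fun _ => 3 / 2)]
  congr 1
  funext j
  rw [Subsingleton.elim j 0, ← part_three_zero (one_add_mul_cos_pos he₀ he₁ s).2.ne']
  norm_num

/-! ### The mass inner product -/

/-- The Hermitian form `∑ m_i conj(u_i) v_i`. -/
def massInner {n : ℕ} (m : Fin n → ℝ) (u v : Fin n → ℂ) : ℂ := ∑ i, m i * conj (u i) * v i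

lemma conj_massInner {n : ℕ} (m : Fin n → ℝ) (u v : Fin n → ℂ) :
    conj (massInner m u v) = massInner m v u := by
  simp only [massInner, map_sum, map_mul, Complex.conj_ofReal, Complex.conj_conj]
  exact Finset.sum_congr rfl fun i _ => by ring

lemma massInner_self {n : ℕ} (m : Fin n → ℝ) (u : Fin n → ℂ) :
    massInner m u u = ((∑ i, m i * ‖u i‖ ^ 2 : ℝ) : ℂ) := by
  push_cast
  refine Finset.sum_congr rfl fun i _ => ?_
  rw [← Complex.conj_mul', mul_assoc]

lemma IsNormalizedCentral.massInner_self {n : ℕ} {m : Fin n → ℝ} {a : Fin n → ℂ}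
    (ha : IsNormalizedCentral m a) : massInner m a a = 1 := by
  rw [FourBody.massInner_self, ha.inertia, Complex.ofReal_one]

lemma sum_sum_mul_sub_mul_sub {n : ℕ} (m : Fin n → ℝ) (u v : Fin n → ℂ) :
    ∑ i, ∑ j, (m i * m j : ℂ) * (conj (u j - u i) * (v j - v i))
      = 2 * ((∑ i, (m i : ℂ)) * massInner m u v
        - conj (∑ i, (m i : ℂ) * u i) * ∑ i, (m i : ℂ) * v i) := by
  have e : ∀ i j, (m i * m j : ℂ) * (conj (u j - u i) * (v j - v i))
      = (m i : ℂ) * (m j * conj (u j) * v j) + (m i * conj (u i) * v i) * m j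
        - (m i * conj (u i)) * (m j * v j) - (m i * v i) * (m j * conj (u j)) := by
    intro i j
    rw [map_sub]
    ring
  simp only [e, Finset.sum_sub_distrib, Finset.sum_add_distrib, ← Finset.sum_mul,
    ← Finset.mul_sum, massInner, map_sum, map_mul, Complex.conj_ofReal]
  ring

lemma exists_unit_conj_sq_mul (X : ℂ) : ∃ u : ℂ, ‖u‖ = 1 ∧ conj u ^ 2 * X = ‖X‖ := by
  refine ⟨Complex.exp ((Complex.arg X / 2 : ℝ) * Complex.I),
    Complex.norm_exp_ofReal_mul_I _, ?_⟩
  have h : conj (Complex.exp ((Complex.arg X / 2 : ℝ) * Complex.I)) ^ 2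
      = Complex.exp (-(Complex.arg X * Complex.I)) := by
    rw [← Complex.exp_conj, ← Complex.exp_nat_mul]
    congr 1
    simp [map_ofNat]
    ring
  rw [h]
  conv_lhs => rw [← Complex.norm_mul_exp_arg_mul_I X]
  rw [mul_left_comm, ← Complex.exp_add]
  simp

/-! ### The second column of the frame -/

/-- `∑ |a_{i+1} - a_{i+2}|² / m_i`, the squared length of the vector
`conj(a_{i+1} - a_{i+2}) / m_i`. -/
def sideNormSq (m : Fin 3 → ℝ) (a : Fin 3 → ℂ) : ℝ := ∑ i, ‖a (i + 1) - a (i + 2)‖ ^ 2 / m i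

/-- The unit vector, of phase `u`, orthogonal to `(1, 1, 1)` and `a`. -/
def sideCol (u : ℂ) (m : Fin 3 → ℝ) (a : Fin 3 → ℂ) (i : Fin 3) : ℂ :=
  u / (Real.sqrt (sideNormSq m a) : ℂ) * (conj (a (i + 1) - a (i + 2)) / m i)

section SideCol

variable {m : Fin 3 → ℝ} {a : Fin 3 → ℂ} {u : ℂ}

lemma sideNormSq_pos (hm : ∀ i, 0 < m i) (ha : a 0 ≠ a 1) : 0 < sideNormSq m a := by
  have h01 : 0 < ‖a 0 - a 1‖ := norm_pos_iff.2 (sub_ne_zero.2 ha)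
  refine Finset.sum_pos' (fun i _ => div_nonneg (sq_nonneg _) (hm i).le)
    ⟨2, Finset.mem_univ _, div_pos (pow_pos ?_ 2) (hm 2)⟩
  exact h01

lemma mass_mul_sideCol (hm : ∀ i, 0 < m i) (i : Fin 3) :
    (m i : ℂ) * sideCol u m a i
      = u / (Real.sqrt (sideNormSq m a) : ℂ) * conj (a (i + 1) - a (i + 2)) := by
  have : (m i : ℂ) ≠ 0 := by exact_mod_cast (hm i).ne'
  rw [sideCol]
  field_simp

lemma sum_mass_mul_sideCol (hm : ∀ i, 0 < m i) : ∑ i, (m i : ℂ) * sideCol u m a i = 0 := by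
  simp only [mass_mul_sideCol hm, ← Finset.mul_sum, Fin.sum_univ_three, ← map_add]
  have : a (0 + 1) - a (0 + 2) + (a (1 + 1) - a (1 + 2)) + (a (2 + 1) - a (2 + 2)) = 0 := by
    change a 1 - a 2 + (a 2 - a 0) + (a 0 - a 1) = 0
    ring
  rw [this, map_zero, mul_zero]

lemma massInner_sideCol (hm : ∀ i, 0 < m i) : massInner m a (sideCol u m a) = 0 := by
  have e : ∀ i, (m i : ℂ) * conj (a i) * sideCol u m a i
      = u / (Real.sqrt (sideNormSq m a) : ℂ) * conj (a i * (a (i + 1) - a (i + 2))) := by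
    intro i
    rw [mul_right_comm, mass_mul_sideCol hm, map_mul]
    ring
  simp only [massInner, e, ← Finset.mul_sum, Fin.sum_univ_three, ← map_add]
  have : a 0 * (a (0 + 1) - a (0 + 2)) + a 1 * (a (1 + 1) - a (1 + 2))
      + a 2 * (a (2 + 1) - a (2 + 2)) = 0 := by
    change a 0 * (a 1 - a 2) + a 1 * (a 2 - a 0) + a 2 * (a 0 - a 1) = 0
    ring
  rw [this, map_zero, mul_zero]

lemma massInner_sideCol_self (hm : ∀ i, 0 < m i) (ha : a 0 ≠ a 1) (hu : ‖u‖ = 1) :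
    massInner m (sideCol u m a) (sideCol u m a) = 1 := by
  have hN := sideNormSq_pos hm ha
  rw [massInner_self]
  have e : ∀ i, m i * ‖sideCol u m a i‖ ^ 2
      = (sideNormSq m a)⁻¹ * (‖a (i + 1) - a (i + 2)‖ ^ 2 / m i) := by
    intro i
    have := hm i
    rw [sideCol, norm_mul, norm_div, norm_div, hu, RCLike.norm_conj,
      Complex.norm_of_nonneg (Real.sqrt_nonneg _), Complex.norm_of_nonneg this.le, mul_pow, div_pow,
      Real.sq_sqrt hN.le]
    field_simp
  simp only [e, ← Finset.mul_sum]
  rw [← sideNormSq, inv_mul_cancel₀ hN.ne', Complex.ofReal_one]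

end SideCol

/-! ### The Lagrangian triangle -/

lemma exists_cube_root {a : Fin 3 → ℂ} {s : ℝ} (hs : 0 < s)
    (ha : ∀ i j, i ≠ j → ‖a i - a j‖ = s) :
    ∃ w d : ℂ, ‖d‖ = s ∧ w ^ 2 = -1 - w ∧ conj w = -1 - w ∧ a 1 = a 0 + d ∧
      a 2 = a 0 + d + w * d := by
  have hd : ‖a 1 - a 0‖ = s := ha 1 0 (by decide)
  have hf : ‖a 2 - a 1‖ = s := ha 2 1 (by decide)
  have hg : ‖a 2 - a 0‖ = s := ha 2 0 (by decide)
  have hd0 : a 1 - a 0 ≠ 0 := norm_pos_iff.1 (hd ▸ hs)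
  have hw : (a 2 - a 1) / (a 1 - a 0) * (a 1 - a 0) = a 2 - a 1 := div_mul_cancel₀ _ hd0
  have n₁ : ‖(a 2 - a 1) / (a 1 - a 0)‖ = 1 := by
    rw [norm_div, hd, hf, div_self hs.ne']
  have n₂ : ‖1 + (a 2 - a 1) / (a 1 - a 0)‖ = 1 := by
    rw [show 1 + (a 2 - a 1) / (a 1 - a 0) = (a 2 - a 0) / (a 1 - a 0) by field_simp; ring,
      norm_div, hd, hg, div_self hs.ne']
  refine ⟨(a 2 - a 1) / (a 1 - a 0), a 1 - a 0, hd, ?_, ?_, by ring, by rw [hw]; ring⟩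
  all_goals
    generalize (a 2 - a 1) / (a 1 - a 0) = w at n₁ n₂
    have h₁ : conj w * w = 1 := by rw [Complex.conj_mul', n₁]; simp
    have h₂ : conj (1 + w) * (1 + w) = 1 := by rw [Complex.conj_mul', n₂]; simp
    rw [map_add, map_one] at h₂
  · linear_combination w * h₂ - (1 + w) * h₁
  · linear_combination h₂ - h₁

section Triangle

variable {m : Fin 3 → ℝ} {a : Fin 3 → ℂ} {s : ℝ}

lemma isCentralConfiguration_triangle (hm : ∑ i, m i = 1)
    (ha : ∀ i j, i ≠ j → ‖a i - a j‖ = 1) : IsCentralConfiguration m a := by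
  refine ⟨fun i j h => ?_, 1, fun i => ?_⟩
  · by_contra hne
    simpa [h] using ha i j hne
  · have hm' : ∑ i, (m i : ℂ) = 1 := by exact_mod_cast hm
    have e : ∀ j ∈ Finset.univ.erase i, (m i * m j : ℂ) * (a j - a i) /
        ((‖a i - a j‖ ^ 3 : ℝ) : ℂ) = m i * (m j * a j) - m i * a i * m j := by
      intro j hj
      rw [ha i j (Finset.ne_of_mem_erase hj).symm]
      simp
      ring
    rw [Finset.sum_congr rfl e, Finset.sum_erase _ (by ring), Finset.sum_sub_distrib,
      ← Finset.mul_sum, ← Finset.mul_sum, hm', centre, hm]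
    simp
    ring

lemma potential_triangle (hm : ∑ i, m i = 1) (hs : 0 < s)
    (ha : ∀ i j, i ≠ j → ‖a i - a j‖ = s) (hc : IsNormalizedCentral m a) :
    potential m a = (s ^ 3)⁻¹ := by
  have h := two_mul_potential m a
  have h₁ := sum_sum_mul_sub_mul_sub m a a
  rw [hc.centred, hc.massInner_self, map_zero, zero_mul, sub_zero, mul_one] at h₁
  have hm' : ∑ i, (m i : ℂ) = 1 := by exact_mod_cast hm
  rw [hm'] at h₁
  have h₂ : ((2 * potential m a : ℝ) : ℂ) = ((s ^ 3 : ℝ) : ℂ)⁻¹ * (2 * 1) := by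
    rw [h, ← h₁, Finset.mul_sum]
    push_cast
    refine Finset.sum_congr rfl fun i _ => ?_
    rw [Finset.mul_sum]
    refine Finset.sum_congr rfl fun j _ => ?_
    by_cases hij : j = i
    · simp [hij]
    · rw [Complex.conj_mul', ha j i hij]
      have : (s : ℂ) ≠ 0 := by exact_mod_cast hs.ne'
      field_simp
  have h₃ : 2 * potential m a = (s ^ 3)⁻¹ * (2 * 1) := by exact_mod_cast h₂
  linarith

lemma hessLin_triangle {l : ℕ} {V : Matrix (Fin 3) (Fin l) ℂ} (hm : ∑ i, m i = 1)
    (ha : ∀ i j, i ≠ j → ‖a i - a j‖ = s) {j k : Fin l} (hj : ∑ i, (m i : ℂ) * V i j = 0) :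
    hessLin m a V j k
      = ((s ^ 3)⁻¹ : ℝ) / 2 * massInner m (fun i => V i j) (fun i => V i k) := by
  have h₁ := sum_sum_mul_sub_mul_sub m (fun i => V i j) (fun i => V i k)
  have hm' : ∑ i, (m i : ℂ) = 1 := by exact_mod_cast hm
  rw [hj, map_zero, zero_mul, sub_zero, hm', one_mul] at h₁
  have h₂ : hessLin m a V j k = ((s ^ 3)⁻¹ : ℝ) / 4 *
      (2 * massInner m (fun i => V i j) (fun i => V i k)) := by
    rw [← h₁, hessLin, Matrix.of_apply, Finset.mul_sum, Finset.mul_sum]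
    refine Finset.sum_congr rfl fun i _ => ?_
    rw [Finset.mul_sum, Finset.mul_sum]
    refine Finset.sum_congr rfl fun i' _ => ?_
    by_cases hij : i' = i
    · simp [hij]
    · rw [ha i' i hij]
      push_cast
      ring
  rw [h₂]
  ring

lemma sideNormSq_triangle (hm : ∀ i, 0 < m i) (ha : ∀ i j, i ≠ j → ‖a i - a j‖ = s) :
    sideNormSq m a = s ^ 2 * (m 0 * m 1 + m 1 * m 2 + m 2 * m 0) / (m 0 * m 1 * m 2) := by
  have h0 := hm 0
  have h1 := hm 1
  have h2 := hm 2
  have e : ∀ i : Fin 3, ‖a (i + 1) - a (i + 2)‖ = s := fun i => ha _ _ (by simp)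
  simp only [sideNormSq, e, Fin.sum_univ_three]
  field_simp
  ring

lemma norm_cube_root_sum {w : ℂ} (hw : w ^ 2 = -1 - w) (hw' : conj w = -1 - w)
    (hm1 : ∑ i, m i = 1) :
    ‖(m 2 + w * m 0 + w ^ 2 * m 1 : ℂ)‖ = 1 / 3 * Real.sqrt (9 - betaL m) := by
  rw [Fin.sum_univ_three] at hm1
  have h : ‖(m 2 + w * m 0 + w ^ 2 * m 1 : ℂ)‖ ^ 2 = 1 / 9 * (9 - betaL m) := by
    have hc : ((‖(m 2 + w * m 0 + w ^ 2 * m 1 : ℂ)‖ ^ 2 : ℝ) : ℂ)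
        = ((1 / 9 * (9 - betaL m) : ℝ) : ℂ) := by
      have hm' : (m 0 + m 1 + m 2 : ℂ) = 1 := by exact_mod_cast hm1
      rw [betaL, hm1]
      push_cast
      rw [← Complex.conj_mul']
      simp only [map_add, map_mul, map_pow, Complex.conj_ofReal, hw']
      have w3 : w ^ 3 = 1 := by linear_combination (w - 1) * hw
      have w4 : w ^ 4 = w := by linear_combination w * w3
      have hsq : (m 0 : ℂ) = 1 - m 1 - m 2 := by linear_combination hm'
      rw [hsq]
      ring_nf
      simp only [w4, w3, hw]
      ring
    exact_mod_cast hc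
  rw [← Real.sqrt_sq (norm_nonneg _), h, Real.sqrt_mul (by norm_num),
    show (1 / 9 : ℝ) = (1 / 3) ^ 2 by norm_num, Real.sqrt_sq (by norm_num)]

lemma sum_triangle_eq (hm : ∀ i, 0 < m i) {w d : ℂ} (hw : w ^ 2 = -1 - w) (h1 : a 1 = a 0 + d)
    (h2 : a 2 = a 0 + d + w * d) :
    ∑ i, ∑ i', (m i * m i' : ℂ) * (a i' - a i) ^ 2 * ((a (i' + 1) - a (i' + 2)) / m i'
      - (a (i + 1) - a (i + 2)) / m i) ^ 2
    = 2 * d ^ 4 * (((m 0 * m 1 + m 1 * m 2 + m 2 * m 0) / (m 0 * m 1 * m 2) : ℝ) : ℂ)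
      * (m 2 + w * m 0 + w ^ 2 * m 1) := by
  have m0 : (m 0 : ℂ) ≠ 0 := by exact_mod_cast (hm 0).ne'
  have m1 : (m 1 : ℂ) ≠ 0 := by exact_mod_cast (hm 1).ne'
  have m2 : (m 2 : ℂ) ≠ 0 := by exact_mod_cast (hm 2).ne'
  have w3 : w ^ 3 = 1 := by linear_combination (w - 1) * hw
  have w4 : w ^ 4 = w := by linear_combination w * w3
  have e₀ : a (0 + 1) - a (0 + 2) = -(w * d) := by
    change a 1 - a 2 = _; rw [h1, h2]; ring
  have e₁ : a (1 + 1) - a (1 + 2) = (1 + w) * d := by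
    change a 2 - a 0 = _; rw [h2]; ring
  have e₂ : a (2 + 1) - a (2 + 2) = -d := by
    change a 0 - a 1 = _; rw [h1]; ring
  simp only [Fin.sum_univ_three, e₀, e₁, e₂]
  rw [h1, h2]
  push_cast
  field_simp
  ring_nf
  simp only [w4, w3, hw]
  ring

/-- The conjugate linear coefficient for the side vector of an equilateral triangle. -/
lemma norm_sum_triangle (hm : ∀ i, 0 < m i) (hm1 : ∑ i, m i = 1) (hs : 0 < s)
    (ha : ∀ i j, i ≠ j → ‖a i - a j‖ = s) {u : ℂ} (hu : ‖u‖ = 1) :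
    ‖∑ i, ∑ i', (m i * m i' : ℂ) * (a i' - a i) ^ 2 / ((‖a i' - a i‖ ^ 5 : ℝ) : ℂ) *
      (conj (sideCol u m a i' - sideCol u m a i) * conj (sideCol u m a i' - sideCol u m a i))‖
      = 2 / 3 * Real.sqrt (9 - betaL m) * (s ^ 3)⁻¹ := by
  obtain ⟨w, d, hd, hw, hw', h1, h2⟩ := exists_cube_root hs ha
  have hN : 0 < sideNormSq m a := sideNormSq_pos hm fun h => by
    have := ha 0 1 (by decide)
    rw [h, sub_self, norm_zero] at this
    exact hs.ne this
  have hcol : ∀ i, conj (sideCol u m a i)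
      = conj u / (Real.sqrt (sideNormSq m a) : ℂ) * ((a (i + 1) - a (i + 2)) / m i) := by
    intro i
    simp only [sideCol, map_mul, map_div₀, Complex.conj_ofReal, Complex.conj_conj]
  have hsq : (Real.sqrt (sideNormSq m a) : ℂ) ^ 2 = (sideNormSq m a : ℂ) := by
    exact_mod_cast Real.sq_sqrt hN.le
  have e : ∑ i, ∑ i', (m i * m i' : ℂ) * (a i' - a i) ^ 2 / ((‖a i' - a i‖ ^ 5 : ℝ) : ℂ) *
      (conj (sideCol u m a i' - sideCol u m a i) * conj (sideCol u m a i' - sideCol u m a i))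
      = conj u ^ 2 / (((sideNormSq m a) * s ^ 5 : ℝ) : ℂ) * ∑ i, ∑ i', (m i * m i' : ℂ) *
        (a i' - a i) ^ 2 * ((a (i' + 1) - a (i' + 2)) / m i' - (a (i + 1) - a (i + 2)) / m i) ^ 2 := by
    rw [Finset.mul_sum]
    refine Finset.sum_congr rfl fun i _ => ?_
    rw [Finset.mul_sum]
    refine Finset.sum_congr rfl fun i' _ => ?_
    by_cases hij : i' = i
    · simp [hij]
    · rw [ha i' i hij, map_sub, hcol, hcol, ← mul_sub, Complex.ofReal_mul, ← hsq]
      ring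
  have h0 := hm 0
  have h1' := hm 1
  have h2' := hm 2
  rw [e, sum_triangle_eq hm hw h1 h2, norm_mul, norm_mul, norm_cube_root_sum hw hw' hm1, norm_div,
    norm_mul, norm_mul, norm_pow, norm_pow, RCLike.norm_conj, hu, hd,
    Complex.norm_of_nonneg (by positivity), Complex.norm_of_nonneg (by positivity),
    sideNormSq_triangle hm ha]
  simp
  field_simp

end Triangle

/-! ### The three-body problem -/

/-- The frame of a configuration of three bodies, with second column of phase `u`. -/
def triangleFrame (u : ℂ) (m : Fin 3 → ℝ) (a : Fin 3 → ℂ) : Matrix (Fin 3) (Fin 2) ℂ :=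
  Matrix.of fun i => ![a i, sideCol u m a i]

lemma triangleFrame_isFrame {u : ℂ} {m : Fin 3 → ℝ} {a : Fin 3 → ℂ} (hm : ∀ i, 0 < m i)
    (ha : IsNormalizedCentral m a) (hu : ‖u‖ = 1) : IsFrame m a (triangleFrame u m a) := by
  have h01 : a 0 ≠ a 1 := fun h => absurd (ha.injective h) (by decide)
  have h₁ := massInner_sideCol (u := u) (a := a) hm
  have h₂ : massInner m (sideCol u m a) a = 0 := by rw [← conj_massInner, h₁, map_zero]
  refine ⟨fun i => rfl, fun j => ?_, fun j j' => ?_⟩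
  · match j with
    | 0 => exact ha.centred
    | 1 => exact sum_mass_mul_sideCol hm
  · match j, j' with
    | 0, 0 => exact ha.massInner_self
    | 0, 1 => exact h₁
    | 1, 0 => exact h₂
    | 1, 1 => exact massInner_sideCol_self hm h01 hu

lemma normalized_sub {n : ℕ} (m : Fin n → ℝ) (q : Fin n → ℂ) (i j : Fin n) :
    normalized m q i - normalized m q j
      = (q i - q j) / (Real.sqrt (∑ j, m j * ‖q j - centre m q‖ ^ 2) : ℂ) := by
  rw [normalized, normalized, ← sub_div, sub_sub_sub_cancel_right]

lemma norm_normalized_sub {n : ℕ} (m : Fin n → ℝ) (q : Fin n → ℂ) (i j : Fin n) :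
    ‖normalized m q i - normalized m q j‖
      = ‖q i - q j‖ / Real.sqrt (∑ j, m j * ‖q j - centre m q‖ ^ 2) := by
  rw [normalized_sub, norm_div, Complex.norm_of_nonneg (Real.sqrt_nonneg _)]

lemma sideCol_eq (u : ℂ) (m : Fin 3 → ℝ) (a : Fin 3 → ℂ) (i : Fin 3) :
    sideCol u m a i = u * sideCol 1 m a i := by
  rw [sideCol, sideCol]; ring

lemma exists_phase_triangle {m : Fin 3 → ℝ} {a : Fin 3 → ℂ} {s : ℝ} (hm : ∀ i, 0 < m i)
    (hm1 : ∑ i, m i = 1) (hs : 0 < s) (hc : IsNormalizedCentral m a)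
    (ha : ∀ i j, i ≠ j → ‖a i - a j‖ = s) :
    ∃ u : ℂ, ‖u‖ = 1 ∧ hessConj m a (triangleFrame u m a) 1 1
      = (potential m a : ℂ) * ((Real.sqrt (9 - betaL m) / 2 : ℝ) : ℂ) := by
  obtain ⟨u, hu, h⟩ := exists_unit_conj_sq_mul
    (∑ i, ∑ i', (m i * m i' : ℂ) * (a i' - a i) ^ 2 / ((‖a i' - a i‖ ^ 5 : ℝ) : ℂ) *
      (conj (sideCol 1 m a i' - sideCol 1 m a i) * conj (sideCol 1 m a i' - sideCol 1 m a i)))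
  refine ⟨u, hu, ?_⟩
  rw [norm_sum_triangle hm hm1 hs ha norm_one] at h
  have e : hessConj m a (triangleFrame u m a) 1 1 = 3 / 4 * (conj u ^ 2 *
      ∑ i, ∑ i', (m i * m i' : ℂ) * (a i' - a i) ^ 2 / ((‖a i' - a i‖ ^ 5 : ℝ) : ℂ) *
      (conj (sideCol 1 m a i' - sideCol 1 m a i)
        * conj (sideCol 1 m a i' - sideCol 1 m a i))) := by
    rw [hessConj, Matrix.of_apply]
    congr 1
    rw [Finset.mul_sum]
    refine Finset.sum_congr rfl fun i _ => ?_
    rw [Finset.mul_sum]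
    refine Finset.sum_congr rfl fun i' _ => ?_
    have hcol : ∀ i, triangleFrame u m a i 1 = u * sideCol 1 m a i := fun i => sideCol_eq u m a i
    rw [hcol, hcol, ← mul_sub, map_mul]
    ring
  rw [e, h, potential_triangle hm1 hs ha hc]
  push_cast
  ring

lemma hessLin_triangleFrame {u : ℂ} {m : Fin 3 → ℝ} {a : Fin 3 → ℂ} {s : ℝ}
    (hm : ∀ i, 0 < m i) (hm1 : ∑ i, m i = 1) (hs : 0 < s) (hc : IsNormalizedCentral m a)
    (ha : ∀ i j, i ≠ j → ‖a i - a j‖ = s) (hu : ‖u‖ = 1) (j k : Fin 2) :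
    hessLin m a (triangleFrame u m a) j k
      = (potential m a : ℂ) * if j = k then ((1 / 2 : ℝ) : ℂ) else 0 := by
  have hV := triangleFrame_isFrame hm hc hu
  rw [hessLin_triangle hm1 ha (hV.centred j), potential_triangle hm1 hs ha hc, massInner,
    hV.orthonormal j k]
  split_ifs
  · push_cast; ring
  · simp

theorem exists_reduction_three {e : ℝ} (he₀ : 0 ≤ e) (he₁ : e < 1) (m : Fin 3 → ℝ)
    (q : Fin 3 → ℂ) (hm : ∀ i, 0 < m i) (hm1 : ∑ i, m i = 1)
    (hq : ∀ i j, i ≠ j → ‖q i - q j‖ = 1) :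
    ∃ V : Matrix (Fin 3) (Fin 2) ℂ, IsFrame m (normalized m q) V ∧
      LinearizationReducesTo m (normalized m q) e V
        (fun s => directSum ![keplerPart e s, lagrangePart (betaL m) e s]) := by
  have hcc := isCentralConfiguration_triangle hm1 hq
  have hc := hcc.isNormalizedCentral hm
  have hs := inertia_pos hm hcc.1 (centre m q)
  have ha : ∀ i j, i ≠ j → ‖normalized m q i - normalized m q j‖
      = 1 / Real.sqrt (∑ j, m j * ‖q j - centre m q‖ ^ 2) := fun i j hij => by
    rw [norm_normalized_sub, hq i j hij]
  have hs' : 0 < 1 / Real.sqrt (∑ j, m j * ‖q j - centre m q‖ ^ 2) :=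
    one_div_pos.2 (Real.sqrt_pos.2 hs)
  obtain ⟨u, hu, h11⟩ := exists_phase_triangle hm hm1 hs' hc ha
  have hV := triangleFrame_isFrame hm hc hu
  have hP := hessLin_triangleFrame hm hm1 hs' hc ha hu
  set a := normalized m q
  refine ⟨triangleFrame u m a, hV, ?_⟩
  have hμ : ((potential m a : ℝ) : ℂ) ≠ 0 := by
    exact_mod_cast (potential_pos hm hc.injective).ne'
  convert hc.linearizationReducesTo hm hV he₀ he₁ using 1
  funext s
  have e₁ : ((potential m a : ℝ) : ℂ)⁻¹ • hessLin m a (triangleFrame u m a)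
      = Matrix.diagonal fun _ => ((1 / 2 : ℝ) : ℂ) := by
    ext i j
    rw [Matrix.smul_apply, hP, smul_eq_mul, inv_mul_cancel_left₀ hμ, Matrix.diagonal_apply]
  have e₂ : ((potential m a : ℝ) : ℂ)⁻¹ • hessConj m a (triangleFrame u m a)
      = Matrix.diagonal fun j => ((![3 / 2, Real.sqrt (9 - betaL m) / 2] j : ℝ) : ℂ) := by
    have h00 : hessConj m a (triangleFrame u m a) 0 0 = (potential m a : ℂ) * (3 / 2 : ℝ) := by
      rw [hV.hessConj_zero, hP]
      simp
      ring
    have h10 : hessConj m a (triangleFrame u m a) 1 0 = 0 := by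
      rw [hV.hessConj_zero, hP]
      simp
    have h01 : hessConj m a (triangleFrame u m a) 0 1 = 0 := by
      rw [hessConj_symm, h10]
    ext i j
    rw [Matrix.smul_apply, smul_eq_mul, Matrix.diagonal_apply]
    match i, j with
    | 0, 0 => rw [h00, inv_mul_cancel_left₀ hμ]; rfl
    | 0, 1 => rw [h01, mul_zero]; rfl
    | 1, 0 => rw [h10, mul_zero]; rfl
    | 1, 1 => rw [h11, inv_mul_cancel_left₀ hμ]; rfl
  rw [e₁, e₂, reducedMatrix_diagonal (fun _ => 1 / 2)]
  congr 1
  funext j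
  match j with
  | 0 =>
    change keplerPart e s = part (1 + 1 / 2 + 3 / 2) (1 + 1 / 2 - 3 / 2) e s
    rw [← part_three_zero (one_add_mul_cos_pos he₀ he₁ s).2.ne']
    norm_num
  | 1 =>
    change lagrangePart (betaL m) e s = part (1 + 1 / 2 + Real.sqrt (9 - betaL m) / 2)
      (1 + 1 / 2 - Real.sqrt (9 - betaL m) / 2) e s
    rw [lagrangePart]
    congr 1 <;> ring

/-! ### A frame for four bodies -/

/-- `1 - m₄ (1 + |a₄|²)`, the squared distance of the normalized fourth coordinate vector from the
span of `(1, …, 1)` and `a`. -/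
def lastGap (m : Fin 4 → ℝ) (a : Fin 4 → ℂ) : ℝ := 1 - m 3 * (1 + ‖a 3‖ ^ 2)

/-- The unit vector, of phase `v`, in the direction of the projection of the fourth coordinate
vector to the orthogonal complement of `(1, …, 1)` and `a`. -/
def lastCol (v : ℂ) (m : Fin 4 → ℝ) (a : Fin 4 → ℂ) : Fin 4 → ℂ :=
  Fin.snoc (α := fun _ => ℂ)
    (fun i : Fin 3 => -v * ((Real.sqrt (m 3) : ℂ) / (Real.sqrt (lastGap m a) : ℂ)
      * (1 + conj (a 3) * a i.castSucc)))
    (v * ((Real.sqrt (lastGap m a) : ℂ) / (Real.sqrt (m 3) : ℂ)))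

/-- The side vector of the first three bodies. -/
def primaryCol (u : ℂ) (m : Fin 4 → ℝ) (a : Fin 4 → ℂ) : Fin 4 → ℂ :=
  Fin.snoc (α := fun _ => ℂ)
    (sideCol u (fun i => m i.castSucc) (fun i => a i.castSucc)) 0

/-- The frame of a configuration of four bodies. -/
def fourFrame (u v : ℂ) (m : Fin 4 → ℝ) (a : Fin 4 → ℂ) : Matrix (Fin 4) (Fin 3) ℂ :=
  Matrix.of fun i => ![a i, primaryCol u m a i, lastCol v m a i]

section FourFrame

variable {m : Fin 4 → ℝ} {a : Fin 4 → ℂ} {u v : ℂ}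

@[simp] lemma lastCol_castSucc (i : Fin 3) : lastCol v m a i.castSucc
    = -v * ((Real.sqrt (m 3) : ℂ) / (Real.sqrt (lastGap m a) : ℂ)
      * (1 + conj (a 3) * a i.castSucc)) := by
  rw [lastCol, Fin.snoc_castSucc]

@[simp] lemma lastCol_three : lastCol v m a 3
    = v * ((Real.sqrt (lastGap m a) : ℂ) / (Real.sqrt (m 3) : ℂ)) :=
  Fin.snoc_last (α := fun _ => ℂ) _ _

@[simp] lemma primaryCol_castSucc (i : Fin 3) : primaryCol u m a i.castSucc
    = sideCol u (fun i => m i.castSucc) (fun i => a i.castSucc) i := by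
  rw [primaryCol, Fin.snoc_castSucc]

@[simp] lemma primaryCol_three : primaryCol u m a 3 = 0 :=
  Fin.snoc_last (α := fun _ => ℂ) _ _

lemma sum_four {M : Type*} [AddCommMonoid M] (f : Fin 4 → M) :
    ∑ i, f i = ∑ i : Fin 3, f i.castSucc + f 3 := Fin.sum_univ_castSucc f

lemma sum_primary_mass (hm1 : ∑ i, m i = 1) : ∑ i : Fin 3, (m i.castSucc : ℂ) = 1 - m 3 := by
  rw [sum_four] at hm1
  rw [eq_sub_iff_add_eq]
  exact_mod_cast hm1

lemma sum_primary_mul (ha : IsNormalizedCentral m a) :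
    ∑ i : Fin 3, (m i.castSucc : ℂ) * a i.castSucc = -(m 3 * a 3) := by
  rw [eq_neg_iff_add_eq_zero, ← ha.centred, sum_four]

lemma sum_primary_conj_mul (ha : IsNormalizedCentral m a) :
    ∑ i : Fin 3, (m i.castSucc : ℂ) * conj (a i.castSucc) = -(m 3 * conj (a 3)) := by
  have := congrArg conj (sum_primary_mul ha)
  simpa using this

lemma sum_primary_inertia (ha : IsNormalizedCentral m a) :
    ∑ i : Fin 3, (m i.castSucc : ℂ) * (conj (a i.castSucc) * a i.castSucc)
      = 1 - m 3 * (conj (a 3) * a 3) := by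
  have h := ha.massInner_self
  rw [massInner, sum_four] at h
  rw [eq_sub_iff_add_eq, ← h]
  simp only [mul_assoc]

lemma ofReal_lastGap : (lastGap m a : ℂ) = 1 - m 3 * (1 + conj (a 3) * a 3) := by
  rw [lastGap, Complex.conj_mul']
  push_cast
  ring

lemma sum_primary_sq (ha : IsNormalizedCentral m a) (hm1 : ∑ i, m i = 1) :
    ∑ i : Fin 3, (m i.castSucc : ℂ) *
      (conj (1 + conj (a 3) * a i.castSucc) * (1 + conj (a 3) * a i.castSucc))
      = (1 + conj (a 3) * a 3) * lastGap m a := by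
  have e : ∀ i : Fin 3, (m i.castSucc : ℂ) *
      (conj (1 + conj (a 3) * a i.castSucc) * (1 + conj (a 3) * a i.castSucc))
      = m i.castSucc + conj (a 3) * (m i.castSucc * a i.castSucc)
        + a 3 * (m i.castSucc * conj (a i.castSucc))
        + (a 3 * conj (a 3)) * (m i.castSucc * (conj (a i.castSucc) * a i.castSucc)) := by
    intro i
    simp only [map_add, map_mul, map_one, Complex.conj_conj]
    ring
  simp only [e, Finset.sum_add_distrib, ← Finset.mul_sum, sum_primary_mass hm1,
    sum_primary_mul ha, sum_primary_conj_mul ha, sum_primary_inertia ha, ofReal_lastGap]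
  ring

lemma lastGap_pos (ha : IsNormalizedCentral m a) (hm : ∀ i, 0 < m i) (hm1 : ∑ i, m i = 1) :
    0 < lastGap m a := by
  have h : ∑ i : Fin 3, m i.castSucc * ‖1 + conj (a 3) * a i.castSucc‖ ^ 2
      = (1 + ‖a 3‖ ^ 2) * lastGap m a := by
    have := sum_primary_sq ha hm1
    simp only [Complex.conj_mul'] at this
    exact_mod_cast this
  have hnn : ∀ i ∈ Finset.univ, 0 ≤ m (Fin.castSucc i) * ‖1 + conj (a 3) * a i.castSucc‖ ^ 2 :=
    fun i _ => mul_nonneg (hm _).le (sq_nonneg _)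
  have hpos : 0 < ∑ i : Fin 3, m i.castSucc * ‖1 + conj (a 3) * a i.castSucc‖ ^ 2 := by
    refine lt_of_le_of_ne (Finset.sum_nonneg hnn) fun h0 => ?_
    have hz : ∀ i : Fin 3, 1 + conj (a 3) * a i.castSucc = 0 := fun i => by
      have := (Finset.sum_eq_zero_iff_of_nonneg hnn).1 h0.symm i (Finset.mem_univ i)
      simpa [(hm _).ne'] using this
    have h3 : conj (a 3) ≠ 0 := fun h3 => by simpa [h3] using hz 0
    have h01 : a (0 : Fin 3).castSucc = a (1 : Fin 3).castSucc :=
      mul_left_cancel₀ h3 (add_left_cancel ((hz 0).trans (hz 1).symm))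
    exact absurd (ha.injective h01) (by decide)
  rw [h] at hpos
  exact pos_of_mul_pos_right hpos (by positivity)

lemma fourFrame_isFrame (ha : IsNormalizedCentral m a) (hm : ∀ i, 0 < m i) (hm1 : ∑ i, m i = 1)
    (hu : ‖u‖ = 1) (hv : ‖v‖ = 1) : IsFrame m a (fourFrame u v m a) := by
  have hm' : ∀ i : Fin 3, 0 < m i.castSucc := fun i => hm _
  have h01 : a (0 : Fin 3).castSucc ≠ a (1 : Fin 3).castSucc :=
    fun h => absurd (ha.injective h) (by decide)
  have hvv : conj v * v = 1 := by rw [Complex.conj_mul', hv]; simp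
  have hg := lastGap_pos ha hm hm1
  have hκ2 : (Real.sqrt (lastGap m a) : ℂ) ^ 2 = 1 - m 3 * (1 + conj (a 3) * a 3) := by
    rw [← ofReal_lastGap]; exact_mod_cast Real.sq_sqrt hg.le
  have hκ : (Real.sqrt (lastGap m a) : ℂ) ≠ 0 := by exact_mod_cast (Real.sqrt_pos.2 hg).ne'
  have ht2 : (Real.sqrt (m 3) : ℂ) ^ 2 = m 3 := by exact_mod_cast Real.sq_sqrt (hm 3).le
  have ht : (Real.sqrt (m 3) : ℂ) ≠ 0 := by exact_mod_cast (Real.sqrt_pos.2 (hm 3)).ne'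
  have b₀ : ∑ i, (m i : ℂ) * primaryCol u m a i = 0 := by
    rw [sum_four]
    simp only [primaryCol_castSucc, primaryCol_three, mul_zero, add_zero]
    exact sum_mass_mul_sideCol hm'
  have ab : massInner m a (primaryCol u m a) = 0 := by
    rw [massInner, sum_four]
    simp only [primaryCol_castSucc, primaryCol_three, mul_zero, add_zero]
    exact massInner_sideCol hm'
  have bb : massInner m (primaryCol u m a) (primaryCol u m a) = 1 := by
    rw [massInner, sum_four]
    simp only [primaryCol_castSucc, primaryCol_three, mul_zero, add_zero]
    exact massInner_sideCol_self hm' h01 hu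
  have ba : massInner m (primaryCol u m a) a = 0 := by rw [← conj_massInner, ab, map_zero]
  have b₀' := congrArg conj b₀
  rw [sum_four] at b₀'
  rw [massInner, sum_four] at ba
  simp only [primaryCol_castSucc, primaryCol_three, mul_zero, add_zero, map_sum, map_mul,
    Complex.conj_ofReal, map_zero, zero_mul] at b₀' ba
  have c₀ : ∑ i, (m i : ℂ) * lastCol v m a i = 0 := by
    rw [sum_four]
    have e : ∀ i : Fin 3, (m i.castSucc : ℂ) * lastCol v m a i.castSucc
        = -v * (Real.sqrt (m 3) : ℂ) / (Real.sqrt (lastGap m a) : ℂ) *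
          (m i.castSucc + conj (a 3) * (m i.castSucc * a i.castSucc)) := by
      intro i; rw [lastCol_castSucc]; ring
    simp only [e, ← Finset.mul_sum, Finset.sum_add_distrib, sum_primary_mass hm1,
      sum_primary_mul ha, lastCol_three]
    field_simp
    rw [ht2, hκ2]
    ring
  have ac : massInner m a (lastCol v m a) = 0 := by
    rw [massInner, sum_four]
    have e : ∀ i : Fin 3, (m i.castSucc : ℂ) * conj (a i.castSucc) * lastCol v m a i.castSucc
        = -v * (Real.sqrt (m 3) : ℂ) / (Real.sqrt (lastGap m a) : ℂ) *
          (m i.castSucc * conj (a i.castSucc) + conj (a 3) * (m i.castSucc *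
            (conj (a i.castSucc) * a i.castSucc))) := by
      intro i; rw [lastCol_castSucc]; ring
    simp only [e, ← Finset.mul_sum, Finset.sum_add_distrib, sum_primary_conj_mul ha,
      sum_primary_inertia ha, lastCol_three]
    field_simp
    rw [ht2, hκ2]
    ring
  have bc : massInner m (primaryCol u m a) (lastCol v m a) = 0 := by
    rw [massInner, sum_four]
    have e : ∀ i : Fin 3, (m i.castSucc : ℂ) * conj (primaryCol u m a i.castSucc)
          * lastCol v m a i.castSucc
        = -v * (Real.sqrt (m 3) : ℂ) / (Real.sqrt (lastGap m a) : ℂ) *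
          (m i.castSucc * conj (sideCol u (fun i => m i.castSucc) (fun i => a i.castSucc) i)
          + conj (a 3) * (m i.castSucc *
            conj (sideCol u (fun i => m i.castSucc) (fun i => a i.castSucc) i)
            * a i.castSucc)) := by
      intro i; rw [lastCol_castSucc, primaryCol_castSucc]; ring
    simp only [e, ← Finset.mul_sum, Finset.sum_add_distrib, b₀', ba, primaryCol_three, map_zero]
    ring
  have cc : massInner m (lastCol v m a) (lastCol v m a) = 1 := by
    rw [massInner, sum_four]
    have e : ∀ i : Fin 3, (m i.castSucc : ℂ) * conj (lastCol v m a i.castSucc)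
          * lastCol v m a i.castSucc
        = ((Real.sqrt (m 3) : ℂ) / (Real.sqrt (lastGap m a) : ℂ)) ^ 2 *
          ((m i.castSucc : ℂ) *
            (conj (1 + conj (a 3) * a i.castSucc) * (1 + conj (a 3) * a i.castSucc))) := by
      intro i
      rw [lastCol_castSucc]
      simp only [map_mul, map_div₀, map_neg, Complex.conj_ofReal]
      linear_combination (m i.castSucc : ℂ) *
        (conj (1 + conj (a 3) * a i.castSucc) * (1 + conj (a 3) * a i.castSucc)) *
        ((Real.sqrt (m 3) : ℂ) / (Real.sqrt (lastGap m a) : ℂ)) ^ 2 * hvv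
    simp only [e, ← Finset.mul_sum, sum_primary_sq ha hm1, lastCol_three, ofReal_lastGap, ← hκ2]
    simp only [map_mul, map_div₀, Complex.conj_ofReal]
    field_simp
    rw [show (Real.sqrt (m 3) : ℂ) ^ 4 = ((Real.sqrt (m 3) : ℂ) ^ 2) ^ 2 by ring, ht2, hκ2]
    linear_combination (m 3 : ℂ) * (1 - m 3 * (1 + conj (a 3) * a 3)) * hvv
  have ca : massInner m (lastCol v m a) a = 0 := by rw [← conj_massInner, ac, map_zero]
  have cb : massInner m (lastCol v m a) (primaryCol u m a) = 0 := by
    rw [← conj_massInner, bc, map_zero]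
  have ba' : massInner m (primaryCol u m a) a = 0 := by rw [← conj_massInner, ab, map_zero]
  refine ⟨fun i => rfl, fun j => ?_, fun j j' => ?_⟩
  · match j with
    | 0 => exact ha.centred
    | 1 => exact b₀
    | 2 => exact c₀
  · match j, j' with
    | 0, 0 => exact ha.massInner_self
    | 0, 1 => exact ab
    | 0, 2 => exact ac
    | 1, 0 => exact ba'
    | 1, 1 => exact bb
    | 1, 2 => exact bc
    | 2, 0 => exact ca
    | 2, 1 => exact cb
    | 2, 2 => exact cc

end FourFrame

/-! ### Limits -/

lemma tendsto_kernel {ι : Type*} {F : Filter ι} {w : ι → ℂ} {w₀ : ℂ} (h : Tendsto w F (𝓝 w₀))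
    (h0 : w₀ ≠ 0) : Tendsto (fun ε => w ε / ((‖w ε‖ ^ 3 : ℝ) : ℂ)) F
      (𝓝 (w₀ / ((‖w₀‖ ^ 3 : ℝ) : ℂ))) :=
  h.div (Complex.continuous_ofReal.continuousAt.tendsto.comp (h.norm.pow 3)) (by simpa using h0)

lemma tendsto_centre {ι : Type*} {F : Filter ι} {n : ℕ} {m : ι → Fin n → ℝ} {q : ι → Fin n → ℂ}
    {m₀ : Fin n → ℝ} {q₀ : Fin n → ℂ} (hm : ∀ i, Tendsto (fun ε => m ε i) F (𝓝 (m₀ i)))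
    (hq : ∀ i, Tendsto (fun ε => q ε i) F (𝓝 (q₀ i))) (hM : ∑ i, m₀ i ≠ 0) :
    Tendsto (fun ε => centre (m ε) (q ε)) F (𝓝 (centre m₀ q₀)) := by
  have hmc : ∀ i, Tendsto (fun ε => (m ε i : ℂ)) F (𝓝 (m₀ i : ℂ)) := fun i =>
    Complex.continuous_ofReal.continuousAt.tendsto.comp (hm i)
  refine Tendsto.div (tendsto_finsetSum _ fun i _ => (hmc i).mul (hq i)) ?_
    (by exact_mod_cast hM)
  exact Complex.continuous_ofReal.continuousAt.tendsto.comp (tendsto_finsetSum _ fun i _ => hm i)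

lemma tendsto_normalized {ι : Type*} {F : Filter ι} {n : ℕ} {m : ι → Fin n → ℝ}
    {q : ι → Fin n → ℂ} {m₀ : Fin n → ℝ} {q₀ : Fin n → ℂ}
    (hm : ∀ i, Tendsto (fun ε => m ε i) F (𝓝 (m₀ i)))
    (hq : ∀ i, Tendsto (fun ε => q ε i) F (𝓝 (q₀ i))) (hM : ∑ i, m₀ i ≠ 0)
    (hI : 0 < ∑ j, m₀ j * ‖q₀ j - centre m₀ q₀‖ ^ 2) (i : Fin n) :
    Tendsto (fun ε => normalized (m ε) (q ε) i) F (𝓝 (normalized m₀ q₀ i)) := by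
  have hc := tendsto_centre hm hq hM
  refine Tendsto.div ((hq i).sub hc) ?_ (by exact_mod_cast (Real.sqrt_pos.2 hI).ne')
  refine Complex.continuous_ofReal.continuousAt.tendsto.comp
    (Real.continuous_sqrt.continuousAt.tendsto.comp ?_)
  exact tendsto_finsetSum _ fun j _ => (hm j).mul (((hq j).sub hc).norm.pow 2)

lemma force_eq_mul_sum {n : ℕ} (m : Fin n → ℝ) (q : Fin n → ℂ) (i : Fin n) :
    force m q i = m i * ∑ j, (m j : ℂ) * ((q j - q i) / ((‖q j - q i‖ ^ 3 : ℝ) : ℂ)) := by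
  rw [force, Finset.mul_sum]
  exact Finset.sum_congr rfl fun j _ => by ring

/-- In a limit of central configurations in which three bodies keep apart, and only the fourth one
may lose its mass, the fourth body does not collide with the others. -/
theorem limit_no_collision {ι : Type*} {F : Filter ι} [F.NeBot] {m : ι → Fin 4 → ℝ}
    (hm : ∀ ε i, 0 < m ε i) {q : ι → Fin 4 → ℂ}
    (hq : ∀ ε, IsCentralConfiguration (m ε) (q ε)) {m₀ : Fin 4 → ℝ} {q₀ : Fin 4 → ℂ}
    (hm₀ : ∀ i : Fin 3, 0 < m₀ i.castSucc) (hM : ∑ i, m₀ i ≠ 0)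
    (hq₀ : ∀ i j : Fin 3, i ≠ j → q₀ i.castSucc ≠ q₀ j.castSucc)
    (hm_lim : ∀ i, Tendsto (fun ε => m ε i) F (𝓝 (m₀ i)))
    (hq_lim : ∀ i, Tendsto (fun ε => q ε i) F (𝓝 (q₀ i))) (i : Fin 3) :
    q₀ 3 ≠ q₀ i.castSucc := by
  intro hcol
  choose hinj lam hlam using hq
  have hmc : ∀ i, Tendsto (fun ε => (m ε i : ℂ)) F (𝓝 (m₀ i : ℂ)) := fun i =>
    Complex.continuous_ofReal.continuousAt.tendsto.comp (hm_lim i)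
  have hc := tendsto_centre hm_lim hq_lim hM
  -- the accelerations
  set G : ι → Fin 4 → ℂ := fun ε i =>
    ∑ j, (m ε j : ℂ) * ((q ε j - q ε i) / ((‖q ε j - q ε i‖ ^ 3 : ℝ) : ℂ)) with hG
  have hGlam : ∀ ε i, G ε i = -lam ε * (q ε i - centre (m ε) (q ε)) := by
    intro ε i
    have h := hlam ε i
    have hmi : (m ε i : ℂ) ≠ 0 := by exact_mod_cast (hm ε i).ne'
    rw [sum_erase_eq_force, force_eq_mul_sum] at h
    refine mul_left_cancel₀ hmi (h.trans ?_)
    ring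
  have hterm : ∀ j k, (j ≠ k → q₀ j ≠ q₀ k) → ∃ L, Tendsto (fun ε =>
      (m ε j : ℂ) * ((q ε j - q ε k) / ((‖q ε j - q ε k‖ ^ 3 : ℝ) : ℂ))) F (𝓝 L) := by
    intro j k hjk
    by_cases h : j = k
    · subst h
      exact ⟨0, by simp⟩
    · exact ⟨_, (hmc j).mul
        (tendsto_kernel ((hq_lim j).sub (hq_lim k)) (sub_ne_zero.2 (hjk h)))⟩
  -- a primary away from the collision and from the centre of mass
  obtain ⟨j, hji, hjc⟩ : ∃ j : Fin 3, j ≠ i ∧ q₀ j.castSucc ≠ centre m₀ q₀ := by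
    have hne : i + 1 ≠ i ∧ i + 2 ≠ i ∧ i + 1 ≠ i + 2 := by fin_cases i <;> decide
    by_cases h : q₀ (i + 1).castSucc = centre m₀ q₀
    · exact ⟨i + 2, hne.2.1, fun h' => hq₀ _ _ hne.2.2 (h.trans h'.symm)⟩
    · exact ⟨i + 1, hne.1, h⟩
  have hdist : ∀ k, k ≠ j.castSucc → q₀ k ≠ q₀ j.castSucc := by
    intro k
    refine Fin.lastCases ?_ (fun k => ?_) k
    · intro _
      exact fun h => hq₀ i j hji.symm (hcol.symm.trans h)
    · intro h
      exact hq₀ k j fun h' => h (by rw [h'])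
  obtain ⟨Lam, hLam⟩ : ∃ L, Tendsto (fun ε => (lam ε : ℂ)) F (𝓝 L) := by
    choose L hL using fun k => hterm k j.castSucc (hdist k)
    have h₁ : Tendsto (fun ε => G ε j.castSucc) F (𝓝 (∑ k, L k)) :=
      tendsto_finsetSum _ fun k _ => hL k
    have h₂ := (hq_lim j.castSucc).sub hc
    have hne := sub_ne_zero.2 hjc
    refine ⟨_, ((h₁.div h₂ hne).neg).congr' ?_⟩
    filter_upwards [h₂.eventually_ne hne] with ε hε
    simp only [Pi.div_apply, hGlam]
    field_simp
  have h3 : Tendsto (fun ε => G ε 3) F (𝓝 (-Lam * (q₀ 3 - centre m₀ q₀))) := by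
    simp only [hGlam]
    exact hLam.neg.mul ((hq_lim 3).sub hc)
  -- the attraction by the colliding primary stays bounded
  have hrest : ∀ k ∈ Finset.univ.erase i.castSucc, k ≠ 3 → q₀ k ≠ q₀ 3 := by
    intro k
    refine Fin.lastCases ?_ (fun k => ?_) k
    · exact fun _ h => absurd rfl h
    · intro hk _
      rw [hcol]
      exact hq₀ k i fun h' => Finset.ne_of_mem_erase hk (by rw [h'])
  obtain ⟨R, hR⟩ : ∃ R, Tendsto (fun ε => ∑ k ∈ Finset.univ.erase i.castSucc,
      (m ε k : ℂ) * ((q ε k - q ε 3) / ((‖q ε k - q ε 3‖ ^ 3 : ℝ) : ℂ))) F (𝓝 R) := by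
    have : ∀ k, ∃ L, k ∈ Finset.univ.erase i.castSucc → Tendsto (fun ε =>
        (m ε k : ℂ) * ((q ε k - q ε 3) / ((‖q ε k - q ε 3‖ ^ 3 : ℝ) : ℂ))) F (𝓝 L) := by
      intro k
      by_cases hk : k ∈ Finset.univ.erase i.castSucc
      · obtain ⟨L, hL⟩ := hterm k 3 (hrest k hk)
        exact ⟨L, fun _ => hL⟩
      · exact ⟨0, fun h => absurd h hk⟩
    choose L hL using this
    exact ⟨_, tendsto_finsetSum _ fun k hk => hL k hk⟩
  have hK := (h3.sub hR).norm.mul ((((hq_lim i.castSucc).sub (hq_lim 3)).norm).pow 2)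
  rw [hcol, sub_self, norm_zero, zero_pow two_ne_zero, mul_zero] at hK
  have hmass : Tendsto (fun ε => m ε i.castSucc) F (𝓝 0) := by
    refine hK.congr fun ε => ?_
    have hne : q ε i.castSucc - q ε 3 ≠ 0 := sub_ne_zero.2 fun h =>
      absurd (hinj ε h) (Fin.castSucc_lt_last i).ne
    have hn := norm_pos_iff.2 hne
    have hsplit : G ε 3 - ∑ k ∈ Finset.univ.erase i.castSucc,
        (m ε k : ℂ) * ((q ε k - q ε 3) / ((‖q ε k - q ε 3‖ ^ 3 : ℝ) : ℂ))
        = m ε i.castSucc * ((q ε i.castSucc - q ε 3) /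
          ((‖q ε i.castSucc - q ε 3‖ ^ 3 : ℝ) : ℂ)) := by
      rw [hG, sub_eq_iff_eq_add]
      exact (Finset.add_sum_erase _ _ (Finset.mem_univ _)).symm
    rw [hsplit, norm_mul, norm_div, Complex.norm_of_nonneg (hm ε _).le,
      Complex.norm_of_nonneg (by positivity)]
    field_simp
  exact (hm₀ i).ne' (tendsto_nhds_unique (hm_lim i.castSucc) hmass)

/-! ### Uniform convergence of the reduced systems -/

lemma tendstoUniformly_reducedMatrix {ι : Type*} {F : Filter ι} {n : ℕ}
    {P Q : ι → Matrix (Fin n) (Fin n) ℂ} {P₀ Q₀ : Matrix (Fin n) (Fin n) ℂ} {e : ℝ}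
    (he₀ : 0 ≤ e) (he₁ : e < 1) (hP : ∀ j k, Tendsto (fun ε => P ε j k) F (𝓝 (P₀ j k)))
    (hQ : ∀ j k, Tendsto (fun ε => Q ε j k) F (𝓝 (Q₀ j k))) (x y : Coord n ⊕ Coord n) :
    TendstoUniformly (fun ε s => reducedMatrix (P ε) (Q ε) e s x y)
      (fun s => reducedMatrix P₀ Q₀ e s x y) F := by
  have hR : ∀ x y, Tendsto (fun ε => realMatrix (P ε) (Q ε) x y) F (𝓝 (realMatrix P₀ Q₀ x y)) := by
    rintro ⟨c, j⟩ ⟨d, k⟩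
    simp only [realMatrix, Matrix.of_apply]
    split_ifs
    · exact (Complex.continuous_re.tendsto _).comp ((hP j k).add (hQ j k))
    · exact (Complex.continuous_im.tendsto _).comp ((hQ j k).sub (hP j k))
    · exact (Complex.continuous_im.tendsto _).comp ((hP j k).add (hQ j k))
    · exact (Complex.continuous_re.tendsto _).comp ((hP j k).sub (hQ j k))
  rw [Metric.tendstoUniformly_iff]
  intro δ hδ
  have hconst : ∀ f : ℝ → ℝ, ∀ᶠ _ in F, ∀ s, dist (f s) (f s) < δ := fun f =>
    Eventually.of_forall fun _ s => by rwa [dist_self]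
  rcases x with x | x <;> rcases y with y | y
  · exact hconst _
  · exact hconst _
  · exact hconst _
  · have h1 : 0 < 1 - e := by linarith
    filter_upwards [(Metric.tendsto_nhds.1 (hR x y)) (δ * (1 - e)) (mul_pos hδ h1)] with ε hε s
    have hD := one_add_mul_cos_pos he₀ he₁ s
    simp only [reducedMatrix, Matrix.fromBlocks_apply₂₂, Matrix.sub_apply, Matrix.smul_apply,
      Matrix.add_apply, smul_eq_mul, Real.dist_eq] at hε ⊢
    rw [show ∀ o r r' b : ℝ, o - b * (o + r) - (o - b * (o + r')) = b * (r' - r) by intros; ring,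
      abs_mul, abs_of_pos (inv_pos.2 hD.2)]
    calc (1 + e * Real.cos s)⁻¹ * |realMatrix (P ε) (Q ε) x y - realMatrix P₀ Q₀ x y|
        ≤ (1 - e)⁻¹ * |realMatrix (P ε) (Q ε) x y - realMatrix P₀ Q₀ x y| :=
          mul_le_mul_of_nonneg_right (inv_anti₀ h1 hD.1) (abs_nonneg _)
      _ < (1 - e)⁻¹ * (δ * (1 - e)) := mul_lt_mul_of_pos_left hε (inv_pos.2 h1)
      _ = δ := by field_simp

/-! ### The second derivative of the force function in the limit -/

lemma sum_sum_four {f : Fin 4 → Fin 4 → ℂ} (hf : ∀ i j, f j i = f i j) (h3 : f 3 3 = 0) :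
    ∑ i, ∑ j, f i j = ∑ i : Fin 3, ∑ j : Fin 3, f i.castSucc j.castSucc
      + 2 * ∑ i : Fin 3, f i.castSucc 3 := by
  simp only [sum_four, Finset.sum_add_distrib, h3]
  simp only [fun i : Fin 3 => hf i.castSucc 3]
  ring

section LimitSums

variable {ι : Type*} {F : Filter ι} {m : ι → Fin 4 → ℝ} {a : ι → Fin 4 → ℂ} {m₀ : Fin 3 → ℝ}
  {a₀ : Fin 3 → ℂ} {b₀ : ℂ}

/-- The limit of a sum over pairs of bodies as the fourth mass vanishes, where the fourth
coordinates of the vectors `x` and `y` may grow like the inverse root of that mass. -/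
lemma tendsto_sum_sum (hm3 : ∀ ε, 0 < m ε 3)
    (hm : ∀ i : Fin 3, Tendsto (fun ε => m ε i.castSucc) F (𝓝 (m₀ i)))
    (ha : ∀ i : Fin 3, Tendsto (fun ε => a ε i.castSucc) F (𝓝 (a₀ i)))
    (ha3 : Tendsto (fun ε => a ε 3) F (𝓝 b₀)) (hinj : Function.Injective a₀)
    (hb : ∀ i, b₀ ≠ a₀ i) {g : ℂ → ℂ} (hg : ∀ w, g (-w) = g w)
    (hgc : ∀ w, w ≠ 0 → ContinuousAt g w) {x y : ι → Fin 4 → ℂ} {X Y : Fin 3 → ℂ} {Ex Ey : ℂ}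
    (hx : ∀ i : Fin 3, Tendsto (fun ε => x ε i.castSucc) F (𝓝 (X i)))
    (hy : ∀ i : Fin 3, Tendsto (fun ε => y ε i.castSucc) F (𝓝 (Y i)))
    (hEx : ∀ i : Fin 3, Tendsto
      (fun ε => (Real.sqrt (m ε 3) : ℂ) * (x ε 3 - x ε i.castSucc)) F (𝓝 Ex))
    (hEy : ∀ i : Fin 3, Tendsto
      (fun ε => (Real.sqrt (m ε 3) : ℂ) * (y ε 3 - y ε i.castSucc)) F (𝓝 Ey)) :
    Tendsto (fun ε => ∑ i, ∑ j, (m ε i * m ε j : ℂ) * g (a ε j - a ε i)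
        * ((x ε j - x ε i) * (y ε j - y ε i))) F
      (𝓝 (∑ i, ∑ j, (m₀ i * m₀ j : ℂ) * g (a₀ j - a₀ i) * ((X j - X i) * (Y j - Y i))
        + 2 * ∑ i, (m₀ i : ℂ) * g (b₀ - a₀ i) * (Ex * Ey))) := by
  have hmc : ∀ i : Fin 3, Tendsto (fun ε => (m ε i.castSucc : ℂ)) F (𝓝 (m₀ i : ℂ)) := fun i =>
    (Complex.continuous_ofReal.tendsto _).comp (hm i)
  have hsplit : ∀ ε, ∑ i, ∑ j, (m ε i * m ε j : ℂ) * g (a ε j - a ε i)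
        * ((x ε j - x ε i) * (y ε j - y ε i))
      = ∑ i : Fin 3, ∑ j : Fin 3, (m ε i.castSucc * m ε j.castSucc : ℂ)
          * g (a ε j.castSucc - a ε i.castSucc)
          * ((x ε j.castSucc - x ε i.castSucc) * (y ε j.castSucc - y ε i.castSucc))
        + 2 * ∑ i : Fin 3, (m ε i.castSucc : ℂ) * g (a ε 3 - a ε i.castSucc)
          * (((Real.sqrt (m ε 3) : ℂ) * (x ε 3 - x ε i.castSucc))
            * ((Real.sqrt (m ε 3) : ℂ) * (y ε 3 - y ε i.castSucc))) := by
    intro ε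
    rw [sum_sum_four]
    · congr 2
      refine Finset.sum_congr rfl fun i _ => ?_
      have ht2 : (Real.sqrt (m ε 3) : ℂ) ^ 2 = m ε 3 := by
        exact_mod_cast Real.sq_sqrt (hm3 ε).le
      rw [← ht2]
      ring
    · intro i j
      rw [← hg (a ε i - a ε j), neg_sub]
      ring
    · simp
  simp only [hsplit]
  refine Tendsto.add (tendsto_finsetSum _ fun i _ => tendsto_finsetSum _ fun j _ => ?_)
    (Tendsto.const_mul 2 (tendsto_finsetSum _ fun i _ => ?_))
  · by_cases hij : j = i
    · subst hij
      simpa using tendsto_const_nhds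
    · have hw := (ha j).sub (ha i)
      have hne : a₀ j - a₀ i ≠ 0 := sub_ne_zero.2 fun h => hij (hinj h)
      exact (((hmc i).mul (hmc j)).mul ((hgc _ hne).tendsto.comp hw)).mul
        (((hx j).sub (hx i)).mul ((hy j).sub (hy i)))
  · have hw := ha3.sub (ha i)
    exact ((hmc i).mul ((hgc _ (sub_ne_zero.2 (hb i))).tendsto.comp hw)).mul
      ((hEx i).mul (hEy i))

variable {V : ι → Matrix (Fin 4) (Fin 3) ℂ} {D : Matrix (Fin 3) (Fin 3) ℂ} {E : Fin 3 → ℂ}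

lemma tendsto_conj {x : ι → ℂ} {x₀ : ℂ} (h : Tendsto x F (𝓝 x₀)) :
    Tendsto (fun ε => conj (x ε)) F (𝓝 (conj x₀)) :=
  (Complex.continuous_conj.tendsto _).comp h

lemma tendsto_hessLin (hm3 : ∀ ε, 0 < m ε 3)
    (hm : ∀ i : Fin 3, Tendsto (fun ε => m ε i.castSucc) F (𝓝 (m₀ i)))
    (ha : ∀ i : Fin 3, Tendsto (fun ε => a ε i.castSucc) F (𝓝 (a₀ i)))
    (ha3 : Tendsto (fun ε => a ε 3) F (𝓝 b₀)) (hinj : Function.Injective a₀)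
    (hb : ∀ i, b₀ ≠ a₀ i)
    (hD : ∀ (i : Fin 3) j, Tendsto (fun ε => V ε i.castSucc j) F (𝓝 (D i j)))
    (hE : ∀ (i : Fin 3) j, Tendsto
      (fun ε => (Real.sqrt (m ε 3) : ℂ) * (V ε 3 j - V ε i.castSucc j)) F (𝓝 (E j)))
    (j k : Fin 3) :
    Tendsto (fun ε => hessLin (m ε) (a ε) (V ε) j k) F (𝓝 (hessLin m₀ a₀ D j k
      + 1 / 2 * ∑ i, (m₀ i : ℂ) / ((‖b₀ - a₀ i‖ ^ 3 : ℝ) : ℂ) * (conj (E j) * E k))) := by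
  have h := tendsto_sum_sum hm3 hm ha ha3 hinj hb (g := fun w => ((‖w‖ ^ 3 : ℝ) : ℂ)⁻¹)
    (fun w => by rw [norm_neg])
    (fun w hw => ContinuousAt.inv₀ (by fun_prop) (by simpa using hw))
    (x := fun ε i => conj (V ε i j)) (y := fun ε i => V ε i k) (fun i => tendsto_conj (hD i j))
    (fun i => hD i k) (Ex := conj (E j)) (Ey := E k)
    (fun i => by simpa using tendsto_conj (hE i j)) (fun i => hE i k)
  have h' := h.const_mul (1 / 4)
  simp only [← map_sub, ← div_eq_mul_inv] at h'
  convert h' using 2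
  · simp only [hessLin, Matrix.of_apply]
  · rw [mul_add, ← mul_assoc (1 / 4 : ℂ) 2, hessLin, Matrix.of_apply]
    norm_num

lemma tendsto_hessConj (hm3 : ∀ ε, 0 < m ε 3)
    (hm : ∀ i : Fin 3, Tendsto (fun ε => m ε i.castSucc) F (𝓝 (m₀ i)))
    (ha : ∀ i : Fin 3, Tendsto (fun ε => a ε i.castSucc) F (𝓝 (a₀ i)))
    (ha3 : Tendsto (fun ε => a ε 3) F (𝓝 b₀)) (hinj : Function.Injective a₀)
    (hb : ∀ i, b₀ ≠ a₀ i)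
    (hD : ∀ (i : Fin 3) j, Tendsto (fun ε => V ε i.castSucc j) F (𝓝 (D i j)))
    (hE : ∀ (i : Fin 3) j, Tendsto
      (fun ε => (Real.sqrt (m ε 3) : ℂ) * (V ε 3 j - V ε i.castSucc j)) F (𝓝 (E j)))
    (j k : Fin 3) :
    Tendsto (fun ε => hessConj (m ε) (a ε) (V ε) j k) F (𝓝 (hessConj m₀ a₀ D j k
      + 3 / 2 * ∑ i, (m₀ i : ℂ) * ((b₀ - a₀ i) ^ 2 / ((‖b₀ - a₀ i‖ ^ 5 : ℝ) : ℂ))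
        * (conj (E j) * conj (E k)))) := by
  have h := tendsto_sum_sum hm3 hm ha ha3 hinj hb (g := fun w => w ^ 2 / ((‖w‖ ^ 5 : ℝ) : ℂ))
    (fun w => by rw [norm_neg, neg_sq])
    (fun w hw => ContinuousAt.div (by fun_prop) (by fun_prop) (by simpa using hw))
    (x := fun ε i => conj (V ε i j)) (y := fun ε i => conj (V ε i k))
    (fun i => tendsto_conj (hD i j)) (fun i => tendsto_conj (hD i k)) (Ex := conj (E j))
    (Ey := conj (E k)) (fun i => by simpa using tendsto_conj (hE i j))
    (fun i => by simpa using tendsto_conj (hE i k))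
  have h' := h.const_mul (3 / 4)
  simp only [← map_sub] at h'
  convert h' using 2
  · simp only [hessConj, Matrix.of_apply, mul_div_assoc]
  · rw [mul_add, ← mul_assoc (3 / 4 : ℂ) 2, hessConj, Matrix.of_apply]
    simp only [mul_div_assoc]
    norm_num

/-! ### The limit of the frames -/

lemma tendsto_sideCol {m : ι → Fin 3 → ℝ} {a : ι → Fin 3 → ℂ} (u : ℂ) (hm₀ : ∀ i, 0 < m₀ i)
    (h01 : a₀ 0 ≠ a₀ 1) (hm : ∀ i, Tendsto (fun ε => m ε i) F (𝓝 (m₀ i)))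
    (ha : ∀ i, Tendsto (fun ε => a ε i) F (𝓝 (a₀ i))) (i : Fin 3) :
    Tendsto (fun ε => sideCol u (m ε) (a ε) i) F (𝓝 (sideCol u m₀ a₀ i)) := by
  have hN : Tendsto (fun ε => sideNormSq (m ε) (a ε)) F (𝓝 (sideNormSq m₀ a₀)) :=
    tendsto_finsetSum _ fun j _ => ((((ha _).sub (ha _)).norm).pow 2).div (hm j) (hm₀ j).ne'
  have hN0 : (Real.sqrt (sideNormSq m₀ a₀) : ℂ) ≠ 0 := by
    exact_mod_cast (Real.sqrt_pos.2 (sideNormSq_pos hm₀ h01)).ne'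
  have hm0 : (m₀ i : ℂ) ≠ 0 := by exact_mod_cast (hm₀ i).ne'
  exact (tendsto_const_nhds.div ((Complex.continuous_ofReal.tendsto _).comp
    ((Real.continuous_sqrt.tendsto _).comp hN)) hN0).mul
    ((tendsto_conj ((ha _).sub (ha _))).div
      ((Complex.continuous_ofReal.tendsto _).comp (hm i)) hm0)

/-- The limit of the first three rows of the frame. -/
def limitFrame (u : ℂ) (m : Fin 3 → ℝ) (a : Fin 3 → ℂ) : Matrix (Fin 3) (Fin 3) ℂ :=
  Matrix.of fun i => ![a i, sideCol u m a i, 0]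

lemma tendsto_sqrt_zero (hm3 : Tendsto (fun ε => m ε 3) F (𝓝 0)) :
    Tendsto (fun ε => (Real.sqrt (m ε 3) : ℂ)) F (𝓝 0) := by
  have h := (Complex.continuous_ofReal.tendsto _).comp
    ((Real.continuous_sqrt.tendsto _).comp hm3)
  simpa [Function.comp_def] using h

lemma tendsto_sqrt_lastGap (hm3 : Tendsto (fun ε => m ε 3) F (𝓝 0))
    (ha3 : Tendsto (fun ε => a ε 3) F (𝓝 b₀)) :
    Tendsto (fun ε => (Real.sqrt (lastGap (m ε) (a ε)) : ℂ)) F (𝓝 1) := by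
  have h := (Complex.continuous_ofReal.tendsto _).comp ((Real.continuous_sqrt.tendsto _).comp
    (tendsto_const_nhds.sub (hm3.mul ((ha3.norm.pow 2).const_add 1)) :
      Tendsto (fun ε => lastGap (m ε) (a ε)) F (𝓝 (1 - 0 * (1 + ‖b₀‖ ^ 2)))))
  rw [zero_mul, sub_zero, Real.sqrt_one, Complex.ofReal_one] at h
  exact h

lemma tendsto_lastCol_castSucc (v : ℂ) (hm3 : Tendsto (fun ε => m ε 3) F (𝓝 0))
    (ha : ∀ i : Fin 3, Tendsto (fun ε => a ε i.castSucc) F (𝓝 (a₀ i)))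
    (ha3 : Tendsto (fun ε => a ε 3) F (𝓝 b₀)) (i : Fin 3) :
    Tendsto (fun ε => lastCol v (m ε) (a ε) i.castSucc) F (𝓝 0) := by
  have h := (((tendsto_sqrt_zero hm3).div (tendsto_sqrt_lastGap hm3 ha3) one_ne_zero).mul
    (((tendsto_conj ha3).mul (ha i)).const_add 1)).const_mul (-v)
  simpa using h

lemma tendsto_fourFrame {u v : ℂ} (hm₀ : ∀ i, 0 < m₀ i) (h01 : a₀ 0 ≠ a₀ 1)
    (hm : ∀ i : Fin 3, Tendsto (fun ε => m ε i.castSucc) F (𝓝 (m₀ i)))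
    (hm3 : Tendsto (fun ε => m ε 3) F (𝓝 0))
    (ha : ∀ i : Fin 3, Tendsto (fun ε => a ε i.castSucc) F (𝓝 (a₀ i)))
    (ha3 : Tendsto (fun ε => a ε 3) F (𝓝 b₀)) (i j : Fin 3) :
    Tendsto (fun ε => fourFrame u v (m ε) (a ε) i.castSucc j) F (𝓝 (limitFrame u m₀ a₀ i j)) := by
  match j with
  | 0 => exact ha i
  | 1 =>
    change Tendsto (fun ε => primaryCol u (m ε) (a ε) i.castSucc) F (𝓝 (sideCol u m₀ a₀ i))
    simp only [primaryCol_castSucc]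
    exact tendsto_sideCol u hm₀ h01 hm ha i
  | 2 => exact tendsto_lastCol_castSucc v hm3 ha ha3 i

lemma tendsto_sqrt_mul_fourFrame {u v : ℂ} (hm₀ : ∀ i, 0 < m₀ i) (h01 : a₀ 0 ≠ a₀ 1)
    (hm : ∀ i : Fin 3, Tendsto (fun ε => m ε i.castSucc) F (𝓝 (m₀ i)))
    (hm3pos : ∀ ε, 0 < m ε 3) (hm3 : Tendsto (fun ε => m ε 3) F (𝓝 0))
    (ha : ∀ i : Fin 3, Tendsto (fun ε => a ε i.castSucc) F (𝓝 (a₀ i)))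
    (ha3 : Tendsto (fun ε => a ε 3) F (𝓝 b₀)) (i j : Fin 3) :
    Tendsto (fun ε => (Real.sqrt (m ε 3) : ℂ) *
      (fourFrame u v (m ε) (a ε) 3 j - fourFrame u v (m ε) (a ε) i.castSucc j)) F
      (𝓝 (![0, 0, v] j)) := by
  have ht := tendsto_sqrt_zero hm3
  match j with
  | 0 =>
    have h := ht.mul (ha3.sub (ha i))
    rw [zero_mul] at h
    exact h
  | 1 =>
    have h := ht.mul (tendsto_sideCol u hm₀ h01 hm ha i).neg
    rw [zero_mul] at h
    refine h.congr fun ε => ?_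
    change _ = (Real.sqrt (m ε 3) : ℂ) *
      (primaryCol u (m ε) (a ε) 3 - primaryCol u (m ε) (a ε) i.castSucc)
    simp
  | 2 =>
    have h := ((tendsto_sqrt_lastGap hm3 ha3).const_mul v).sub
      (ht.mul (tendsto_lastCol_castSucc v hm3 ha ha3 i))
    rw [zero_mul, sub_zero, mul_one] at h
    refine h.congr fun ε => ?_
    have hne : (Real.sqrt (m ε 3) : ℂ) ≠ 0 := by
      exact_mod_cast (Real.sqrt_pos.2 (hm3pos ε)).ne'
    change _ = (Real.sqrt (m ε 3) : ℂ) *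
      (lastCol v (m ε) (a ε) 3 - lastCol v (m ε) (a ε) i.castSucc)
    rw [lastCol_three]
    field_simp

end LimitSums

/-! ### The restricted four-body problem -/

section Restricted

variable {m₀ : Fin 3 → ℝ} {q₀ : Fin 3 → ℂ} {z : ℂ}

/-- Three masses and a vanishing fourth one. -/
def withZero (m₀ : Fin 3 → ℝ) : Fin 4 → ℝ := Fin.snoc (α := fun _ => ℝ) m₀ 0

/-- Three points and a fourth one. -/
def withPoint (q₀ : Fin 3 → ℂ) (z : ℂ) : Fin 4 → ℂ := Fin.snoc (α := fun _ => ℂ) q₀ z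

@[simp] lemma withZero_castSucc (i : Fin 3) : withZero m₀ i.castSucc = m₀ i :=
  Fin.snoc_castSucc (α := fun _ => ℝ) _ _ _

@[simp] lemma withZero_three : withZero m₀ 3 = 0 := Fin.snoc_last (α := fun _ => ℝ) _ _

@[simp] lemma withPoint_castSucc (i : Fin 3) : withPoint q₀ z i.castSucc = q₀ i :=
  Fin.snoc_castSucc (α := fun _ => ℂ) _ _ _

@[simp] lemma withPoint_three : withPoint q₀ z 3 = z := Fin.snoc_last (α := fun _ => ℂ) _ _

lemma tendsto_withZero {ι : Type*} {F : Filter ι} {m : ι → Fin 4 → ℝ}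
    (hm : ∀ i : Fin 3, Tendsto (fun ε => m ε i.castSucc) F (𝓝 (m₀ i)))
    (hm3 : Tendsto (fun ε => m ε 3) F (𝓝 0)) (i : Fin 4) :
    Tendsto (fun ε => m ε i) F (𝓝 (withZero m₀ i)) := by
  refine Fin.lastCases ?_ (fun i => ?_) i
  · exact withZero_three (m₀ := m₀) ▸ hm3
  · rw [withZero_castSucc]; exact hm i

lemma tendsto_withPoint {ι : Type*} {F : Filter ι} {q : ι → Fin 4 → ℂ}
    (hq : ∀ i : Fin 3, Tendsto (fun ε => q ε i.castSucc) F (𝓝 (q₀ i)))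
    (hz : Tendsto (fun ε => q ε 3) F (𝓝 z)) (i : Fin 4) :
    Tendsto (fun ε => q ε i) F (𝓝 (withPoint q₀ z i)) := by
  refine Fin.lastCases ?_ (fun i => ?_) i
  · exact withPoint_three (q₀ := q₀) (z := z) ▸ hz
  · rw [withPoint_castSucc]; exact hq i

lemma centre_withPoint : centre (withZero m₀) (withPoint q₀ z) = centre m₀ q₀ := by
  simp [centre, sum_four]

lemma inertia_withPoint (c : ℂ) :
    ∑ j, withZero m₀ j * ‖withPoint q₀ z j - c‖ ^ 2 = ∑ j, m₀ j * ‖q₀ j - c‖ ^ 2 := by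
  simp [sum_four]

lemma normalized_withPoint (i : Fin 3) :
    normalized (withZero m₀) (withPoint q₀ z) i.castSucc = normalized m₀ q₀ i := by
  rw [normalized, normalized, centre_withPoint, inertia_withPoint, withPoint_castSucc]

lemma normalized_withPoint_sub (i : Fin 3) :
    normalized (withZero m₀) (withPoint q₀ z) 3 - normalized m₀ q₀ i
      = (z - q₀ i) / (Real.sqrt (∑ j, m₀ j * ‖q₀ j - centre m₀ q₀‖ ^ 2) : ℂ) := by
  rw [← normalized_withPoint (z := z), normalized_sub, centre_withPoint, inertia_withPoint,
    withPoint_castSucc, withPoint_three]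

end Restricted

lemma directSum_limit {e : ℝ} (he₀ : 0 ≤ e) (he₁ : e < 1) (b α β s : ℝ) :
    directSum ![keplerPart e s, lagrangePart b e s, part (1 + α + 3 * β) (1 + α - 3 * β) e s]
      = reducedMatrix (Matrix.diagonal fun j => ((![1 / 2, 1 / 2, α] j : ℝ) : ℂ))
        (Matrix.diagonal fun j => ((![3 / 2, Real.sqrt (9 - b) / 2, 3 * β] j : ℝ) : ℂ)) e s := by
  rw [reducedMatrix_diagonal]
  congr 1
  funext j
  match j with
  | 0 =>
    change keplerPart e s = part (1 + 1 / 2 + 3 / 2) (1 + 1 / 2 - 3 / 2) e s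
    rw [← part_three_zero (one_add_mul_cos_pos he₀ he₁ s).2.ne']
    norm_num
  | 1 =>
    change lagrangePart b e s = part (1 + 1 / 2 + Real.sqrt (9 - b) / 2)
      (1 + 1 / 2 - Real.sqrt (9 - b) / 2) e s
    rw [lagrangePart]
    congr 1 <;> ring
  | 2 => rfl

/-- The limit of the complex linear part of the second derivative of the force function. -/
lemma limit_hessLin {m₀ : Fin 3 → ℝ} {a₀ : Fin 3 → ℂ} {b₀ u v : ℂ} {μ α : ℝ}
    (hP : ∀ j k, hessLin m₀ a₀ (triangleFrame u m₀ a₀) j k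
      = (μ : ℂ) * if j = k then ((1 / 2 : ℝ) : ℂ) else 0)
    (hv : ‖v‖ = 1) (hα : 1 / 2 * ∑ i, m₀ i / ‖b₀ - a₀ i‖ ^ 3 = μ * α) (j k : Fin 3) :
    hessLin m₀ a₀ (limitFrame u m₀ a₀) j k
      + 1 / 2 * ∑ i, (m₀ i : ℂ) / ((‖b₀ - a₀ i‖ ^ 3 : ℝ) : ℂ)
        * (conj ((![0, 0, v] : Fin 3 → ℂ) j) * (![0, 0, v] : Fin 3 → ℂ) k)
      = μ * Matrix.diagonal (fun j => ((![1 / 2, 1 / 2, α] j : ℝ) : ℂ)) j k := by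
  have h2 : ∀ j, hessLin m₀ a₀ (limitFrame u m₀ a₀) j 2 = 0 := fun j => by
    simp [hessLin, limitFrame]
  have h2' : ∀ j, hessLin m₀ a₀ (limitFrame u m₀ a₀) 2 j = 0 := fun j => by
    rw [hessLin_conj, h2, map_zero]
  have h00 : hessLin m₀ a₀ (limitFrame u m₀ a₀) 0 0 = μ * ((1 / 2 : ℝ) : ℂ) := hP 0 0
  have h01 : hessLin m₀ a₀ (limitFrame u m₀ a₀) 0 1 = μ * 0 := hP 0 1
  have h10 : hessLin m₀ a₀ (limitFrame u m₀ a₀) 1 0 = μ * 0 := hP 1 0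
  have h11 : hessLin m₀ a₀ (limitFrame u m₀ a₀) 1 1 = μ * ((1 / 2 : ℝ) : ℂ) := hP 1 1
  have hvv : conj v * v = 1 := by rw [Complex.conj_mul', hv]; simp
  have h22 : (1 / 2 : ℂ) * ∑ i, (m₀ i : ℂ) / ((‖b₀ - a₀ i‖ ^ 3 : ℝ) : ℂ) * (conj v * v)
      = μ * (α : ℂ) := by
    simp only [hvv, mul_one]
    have h := congrArg ((↑) : ℝ → ℂ) hα
    push_cast at h ⊢
    exact h
  match j, k with
  | 0, 0 => rw [h00]; simp
  | 0, 1 => rw [h01]; simp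
  | 0, 2 => rw [h2]; simp
  | 1, 0 => rw [h10]; simp
  | 1, 1 => rw [h11]; simp
  | 1, 2 => rw [h2]; simp
  | 2, 0 => rw [h2']; simp
  | 2, 1 => rw [h2']; simp
  | 2, 2 =>
    rw [h2, zero_add]
    exact h22

/-- The limit of the conjugate linear part of the second derivative of the force function. -/
lemma limit_hessConj {m₀ : Fin 3 → ℝ} {a₀ : Fin 3 → ℂ} {b₀ u v : ℂ} {μ β γ : ℝ}
    (h00 : hessConj m₀ a₀ (triangleFrame u m₀ a₀) 0 0 = (μ : ℂ) * ((3 / 2 : ℝ) : ℂ))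
    (h10 : hessConj m₀ a₀ (triangleFrame u m₀ a₀) 1 0 = 0)
    (h11 : hessConj m₀ a₀ (triangleFrame u m₀ a₀) 1 1 = (μ : ℂ) * (γ : ℂ))
    (hβ : 3 / 2 * ∑ i, (m₀ i : ℂ) * ((b₀ - a₀ i) ^ 2 / ((‖b₀ - a₀ i‖ ^ 5 : ℝ) : ℂ))
        * (conj v * conj v) = (μ : ℂ) * ((3 * β : ℝ) : ℂ)) (j k : Fin 3) :
    hessConj m₀ a₀ (limitFrame u m₀ a₀) j k
      + 3 / 2 * ∑ i, (m₀ i : ℂ) * ((b₀ - a₀ i) ^ 2 / ((‖b₀ - a₀ i‖ ^ 5 : ℝ) : ℂ))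
        * (conj ((![0, 0, v] : Fin 3 → ℂ) j) * conj ((![0, 0, v] : Fin 3 → ℂ) k))
      = μ * Matrix.diagonal (fun j => ((![3 / 2, γ, 3 * β] j : ℝ) : ℂ)) j k := by
  have h2 : ∀ j, hessConj m₀ a₀ (limitFrame u m₀ a₀) j 2 = 0 := fun j => by
    simp [hessConj, limitFrame]
  have h2' : ∀ j, hessConj m₀ a₀ (limitFrame u m₀ a₀) 2 j = 0 := fun j => by
    rw [hessConj_symm, h2]
  have e00 : hessConj m₀ a₀ (limitFrame u m₀ a₀) 0 0 = μ * ((3 / 2 : ℝ) : ℂ) := h00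
  have e10 : hessConj m₀ a₀ (limitFrame u m₀ a₀) 1 0 = 0 := h10
  have e01 : hessConj m₀ a₀ (limitFrame u m₀ a₀) 0 1 = 0 := by rw [hessConj_symm, e10]
  have e11 : hessConj m₀ a₀ (limitFrame u m₀ a₀) 1 1 = μ * (γ : ℂ) := h11
  match j, k with
  | 0, 0 => rw [e00]; simp
  | 0, 1 => rw [e01]; simp
  | 0, 2 => rw [h2]; simp
  | 1, 0 => rw [e10]; simp
  | 1, 1 => rw [e11]; simp
  | 1, 2 => rw [h2]; simp
  | 2, 0 => rw [h2']; simp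
  | 2, 1 => rw [h2']; simp
  | 2, 2 =>
    rw [h2, zero_add]
    exact hβ

lemma alpha_scaled {m : Fin 3 → ℝ} {q a : Fin 3 → ℂ} {z b : ℂ} {S : ℝ} (hS : 0 < S)
    (h : ∀ i, b - a i = (z - q i) / (S : ℂ)) :
    1 / 2 * ∑ i, m i / ‖b - a i‖ ^ 3 = S ^ 3 * alpha m q z := by
  rw [alpha, mul_left_comm]
  congr 1
  rw [Finset.mul_sum]
  refine Finset.sum_congr rfl fun i _ => ?_
  rw [h, norm_div, Complex.norm_of_nonneg hS.le, norm_sub_rev]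
  field_simp

lemma beta_scaled {m : Fin 3 → ℝ} {q a : Fin 3 → ℂ} {z b v : ℂ} {S : ℝ} (hS : 0 < S)
    (h : ∀ i, b - a i = (z - q i) / (S : ℂ))
    (hv : conj v ^ 2 * ∑ i, (m i : ℂ) * (q i - z) ^ 2 / ((‖q i - z‖ ^ 5 : ℝ) : ℂ)
      = ‖∑ i, (m i : ℂ) * (q i - z) ^ 2 / ((‖q i - z‖ ^ 5 : ℝ) : ℂ)‖) :
    3 / 2 * ∑ i, (m i : ℂ) * ((b - a i) ^ 2 / ((‖b - a i‖ ^ 5 : ℝ) : ℂ))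
        * (conj v * conj v) = ((S ^ 3 : ℝ) : ℂ) * ((3 * beta m q z : ℝ) : ℂ) := by
  have hSc : (S : ℂ) ≠ 0 := by exact_mod_cast hS.ne'
  have e : ∑ i, (m i : ℂ) * ((b - a i) ^ 2 / ((‖b - a i‖ ^ 5 : ℝ) : ℂ)) * (conj v * conj v)
      = (S : ℂ) ^ 3 * (conj v ^ 2 *
        ∑ i, (m i : ℂ) * (q i - z) ^ 2 / ((‖q i - z‖ ^ 5 : ℝ) : ℂ)) := by
    rw [Finset.mul_sum, Finset.mul_sum]
    refine Finset.sum_congr rfl fun i _ => ?_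
    rw [h, norm_div, Complex.norm_of_nonneg hS.le, norm_sub_rev z, div_pow, div_pow]
    push_cast
    field_simp
    ring
  rw [e, hv, beta]
  push_cast
  ring

/-- As the fourth mass vanishes, the reduced systems of the four-body problem converge to the sum
of three independent systems. -/
theorem exists_reduction_four {ι : Type*} {F : Filter ι} [F.NeBot] {e : ℝ} (he₀ : 0 ≤ e)
    (he₁ : e < 1) {m : ι → Fin 4 → ℝ} (hm : ∀ ε i, 0 < m ε i) (hm_sum : ∀ ε, ∑ i, m ε i = 1)
    {q : ι → Fin 4 → ℂ} (hq : ∀ ε, IsCentralConfiguration (m ε) (q ε))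
    {m₀ : Fin 3 → ℝ} (hm₀ : ∀ i, 0 < m₀ i) (hm₀1 : ∑ i, m₀ i = 1)
    (hm_lim : ∀ i : Fin 3, Tendsto (fun ε => m ε i.castSucc) F (𝓝 (m₀ i)))
    (hm4_lim : Tendsto (fun ε => m ε 3) F (𝓝 0))
    {q₀ : Fin 3 → ℂ} {z : ℂ} (hq₀ : ∀ i j, i ≠ j → ‖q₀ i - q₀ j‖ = 1)
    (hq_lim : ∀ i : Fin 3, Tendsto (fun ε => q ε i.castSucc) F (𝓝 (q₀ i)))
    (hz_lim : Tendsto (fun ε => q ε 3) F (𝓝 z)) (hz : ∀ i, z ≠ q₀ i) :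
    ∃ (V : ι → Matrix (Fin 4) (Fin 3) ℂ) (B : ι → ℝ → Matrix (Coord 3 ⊕ Coord 3)
          (Coord 3 ⊕ Coord 3) ℝ),
      (∀ ε, IsFrame (m ε) (normalized (m ε) (q ε)) (V ε) ∧
        LinearizationReducesTo (m ε) (normalized (m ε) (q ε)) e (V ε) (B ε)) ∧
      ∀ x y, TendstoUniformly (fun ε s => B ε s x y)
        (fun s => directSum
          ![keplerPart e s, lagrangePart (betaL m₀) e s,
            part (1 + alpha m₀ q₀ z + 3 * beta m₀ q₀ z)
              (1 + alpha m₀ q₀ z - 3 * beta m₀ q₀ z) e s] x y) F := by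
  have hm_lim' := tendsto_withZero hm_lim hm4_lim
  have hq_lim' := tendsto_withPoint hq_lim hz_lim
  have hM : ∑ i, withZero m₀ i ≠ 0 := by simp [sum_four, hm₀1]
  -- the limit triangle
  have hcc := isCentralConfiguration_triangle hm₀1 hq₀
  have hc := hcc.isNormalizedCentral hm₀
  have hI := inertia_pos hm₀ hcc.1 (centre m₀ q₀)
  have ha_lim := tendsto_normalized hm_lim' hq_lim' hM
    (by rw [centre_withPoint, inertia_withPoint]; exact hI)
  have ha₀ : ∀ i j, i ≠ j → ‖normalized m₀ q₀ i - normalized m₀ q₀ j‖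
      = 1 / Real.sqrt (∑ j, m₀ j * ‖q₀ j - centre m₀ q₀‖ ^ 2) := fun i j hij => by
    rw [norm_normalized_sub, hq₀ i j hij]
  have hsub := normalized_withPoint_sub (m₀ := m₀) (q₀ := q₀) (z := z)
  have hS := Real.sqrt_pos.2 hI
  generalize Real.sqrt (∑ j, m₀ j * ‖q₀ j - centre m₀ q₀‖ ^ 2) = S at ha₀ hsub hS
  have hS' : 0 < 1 / S := one_div_pos.2 hS
  have hμ₀ : potential m₀ (normalized m₀ q₀) = S ^ 3 := by
    rw [potential_triangle hm₀1 hS' ha₀ hc]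
    simp
  obtain ⟨u, hu, h11⟩ := exists_phase_triangle hm₀ hm₀1 hS' hc ha₀
  have hV₀ := triangleFrame_isFrame hm₀ hc hu
  have hP := hessLin_triangleFrame hm₀ hm₀1 hS' hc ha₀ hu
  obtain ⟨v, hv, hv2⟩ := exists_unit_conj_sq_mul
    (∑ i, (m₀ i : ℂ) * (q₀ i - z) ^ 2 / ((‖q₀ i - z‖ ^ 5 : ℝ) : ℂ))
  have ha_prim : ∀ i : Fin 3, Tendsto (fun ε => normalized (m ε) (q ε) i.castSucc) F
      (𝓝 (normalized m₀ q₀ i)) := fun i => by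
    rw [← normalized_withPoint (z := z)]; exact ha_lim i.castSucc
  have ha_last := ha_lim 3
  have hb : ∀ i, normalized (withZero m₀) (withPoint q₀ z) 3 ≠ normalized m₀ q₀ i := fun i h => by
    have h' := hsub i
    rw [h, sub_self, eq_comm, div_eq_zero_iff] at h'
    refine h'.elim (fun h0 => hz i (sub_eq_zero.1 h0)) fun h0 => hS.ne' (by exact_mod_cast h0)
  have ha : ∀ ε, IsNormalizedCentral (m ε) (normalized (m ε) (q ε)) := fun ε =>
    (hq ε).isNormalizedCentral (hm ε)
  generalize normalized (withZero m₀) (withPoint q₀ z) 3 = b₀ at ha_last hb hsub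
  generalize normalized m₀ q₀ = a₀ at *
  have h01 : a₀ 0 ≠ a₀ 1 := fun h => absurd (hc.injective h) (by decide)
  have hV : ∀ ε, IsFrame (m ε) (normalized (m ε) (q ε))
      (fourFrame u v (m ε) (normalized (m ε) (q ε))) := fun ε =>
    fourFrame_isFrame (ha ε) (hm ε) (hm_sum ε) hu hv
  have hD := tendsto_fourFrame (u := u) (v := v) hm₀ h01 hm_lim hm4_lim ha_prim ha_last
  have hE := tendsto_sqrt_mul_fourFrame (u := u) (v := v) hm₀ h01 hm_lim (fun ε => hm ε 3) hm4_lim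
    ha_prim ha_last
  rw [hμ₀] at h11
  simp only [hμ₀] at hP
  have hLin := tendsto_hessLin (fun ε => hm ε 3) hm_lim ha_prim ha_last hc.injective hb hD hE
  have hConj := tendsto_hessConj (fun ε => hm ε 3) hm_lim ha_prim ha_last hc.injective hb hD hE
  simp only [limit_hessLin hP hv (alpha_scaled hS hsub)] at hLin
  have h00 : hessConj m₀ a₀ (triangleFrame u m₀ a₀) 0 0
      = ((S ^ 3 : ℝ) : ℂ) * ((3 / 2 : ℝ) : ℂ) := by
    rw [hV₀.hessConj_zero, hP]
    push_cast
    simp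
    ring
  have h10 : hessConj m₀ a₀ (triangleFrame u m₀ a₀) 1 0 = 0 := by
    rw [hV₀.hessConj_zero, hP]
    simp
  simp only [limit_hessConj h00 h10 h11 (beta_scaled hS hsub hv2)] at hConj
  have hS3 : ((S ^ 3 : ℝ) : ℂ) ≠ 0 := by exact_mod_cast (pow_pos hS 3).ne'
  have hμ : Tendsto (fun ε => ((potential (m ε) (normalized (m ε) (q ε)) : ℝ) : ℂ)⁻¹) F
      (𝓝 ((S ^ 3 : ℝ) : ℂ)⁻¹) := by
    refine Tendsto.inv₀ ?_ hS3
    have h := (hLin 0 0).const_mul 2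
    convert h using 2 with ε
    · rw [(hV ε).hessLin_zero (ha ε)]
      simp
      ring
    · simp
      ring
  refine ⟨_, _, fun ε => ⟨hV ε, (ha ε).linearizationReducesTo (hm ε) (hV ε) he₀ he₁⟩,
    fun x y => ?_⟩
  simp only [directSum_limit he₀ he₁]
  refine tendstoUniformly_reducedMatrix he₀ he₁ (fun j k => ?_) (fun j k => ?_) x y
  · have h := hμ.mul (hLin j k)
    rwa [inv_mul_cancel_left₀ hS3] at h
  · have h := hμ.mul (hConj j k)
    rwa [inv_mul_cancel_left₀ hS3] at h

end FourBody

end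

theorem theorem1p1 {ι : Type*} (F : Filter ι) [F.NeBot]
    (e : ℝ) (he₀ : 0 ≤ e) (he₁ : e < 1)
    -- masses and central configurations
    (m : ι → Fin 4 → ℝ) (hm : ∀ ε i, 0 < m ε i) (hm_sum : ∀ ε, ∑ i, m ε i = 1)
    (q : ι → Fin 4 → ℂ) (hq : ∀ ε, FourBody.IsCentralConfiguration (m ε) (q ε))
    -- the limit: the fourth mass vanishes, the primaries form an equilateral triangle of side `1`
    (m₀ : Fin 3 → ℝ) (hm₀ : ∀ i, 0 < m₀ i)
    (hm_lim : ∀ i : Fin 3, Tendsto (fun ε => m ε i.castSucc) F (𝓝 (m₀ i)))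
    (hm4_lim : Tendsto (fun ε => m ε 3) F (𝓝 0))
    (q₀ : Fin 3 → ℂ) (z : ℂ) (hq₀ : ∀ i j, i ≠ j → ‖q₀ i - q₀ j‖ = 1)
    (hq_lim : ∀ i : Fin 3, Tendsto (fun ε => q ε i.castSucc) F (𝓝 (q₀ i)))
    (hz_lim : Tendsto (fun ε => q ε 3) F (𝓝 z)) :
    -- the limit position of the fourth body is not a collision
    (∀ i, z ≠ q₀ i) ∧
    -- in the limit, the linearized system is the sum of three independent systems
    (∃ (V : ι → Matrix (Fin 4) (Fin 3) ℂ)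
        (B : ι → ℝ → Matrix (FourBody.Coord 3 ⊕ FourBody.Coord 3)
          (FourBody.Coord 3 ⊕ FourBody.Coord 3) ℝ),
      (∀ ε, FourBody.IsFrame (m ε) (FourBody.normalized (m ε) (q ε)) (V ε) ∧
        FourBody.LinearizationReducesTo (m ε) (FourBody.normalized (m ε) (q ε)) e (V ε) (B ε)) ∧
      ∀ x y, TendstoUniformly (fun ε s => B ε s x y)
        (fun s => FourBody.directSum
          ![FourBody.keplerPart e s,
            FourBody.lagrangePart (FourBody.betaL m₀) e s,
            FourBody.part (1 + FourBody.alpha m₀ q₀ z + 3 * FourBody.beta m₀ q₀ z)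
              (1 + FourBody.alpha m₀ q₀ z - 3 * FourBody.beta m₀ q₀ z) e s] x y) F) ∧
    -- the first one is the linearized system of the two-body problem at its Kepler orbits
    (∀ (m₂ : Fin 2 → ℝ) (q₂ : Fin 2 → ℂ), (∀ i, 0 < m₂ i) → ∑ i, m₂ i = 1 → q₂ 0 ≠ q₂ 1 →
      ∃ V : Matrix (Fin 2) (Fin 1) ℂ,
        FourBody.IsFrame m₂ (FourBody.normalized m₂ q₂) V ∧
        FourBody.LinearizationReducesTo m₂ (FourBody.normalized m₂ q₂) e V
          (fun s => FourBody.directSum ![FourBody.keplerPart e s])) ∧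
    -- the second one is, next to that Kepler part, the linearized system of the three-body problem
    -- of the primaries at the elliptic Lagrangian solution
    (∃ V : Matrix (Fin 3) (Fin 2) ℂ,
      FourBody.IsFrame m₀ (FourBody.normalized m₀ q₀) V ∧
      FourBody.LinearizationReducesTo m₀ (FourBody.normalized m₀ q₀) e V
        (fun s => FourBody.directSum
          ![FourBody.keplerPart e s, FourBody.lagrangePart (FourBody.betaL m₀) e s])) := by
  have hm₀1 : ∑ i, m₀ i = 1 := by
    have h : Tendsto (fun ε => ∑ i, m ε i) F (𝓝 (∑ i, m₀ i + 0)) := by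
      simp only [FourBody.sum_four]
      exact (tendsto_finsetSum _ fun i _ => hm_lim i).add hm4_lim
    simp only [hm_sum, add_zero] at h
    exact (tendsto_nhds_unique h tendsto_const_nhds)
  have hz : ∀ i, z ≠ q₀ i := fun i => by
    have h := FourBody.limit_no_collision (F := F) (m₀ := FourBody.withZero m₀)
      (q₀ := FourBody.withPoint q₀ z) hm hq (by simpa using hm₀)
      (by simp [FourBody.sum_four, hm₀1])
      (fun i j hij h => by
        simp only [FourBody.withPoint_castSucc] at h
        simpa [h] using hq₀ i j hij)
      (FourBody.tendsto_withZero hm_lim hm4_lim) (FourBody.tendsto_withPoint hq_lim hz_lim) i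
    simpa using h
  exact ⟨hz,
    FourBody.exists_reduction_four he₀ he₁ hm hm_sum hq hm₀ hm₀1 hm_lim hm4_lim hq₀ hq_lim hz_lim hz,
    fun m₂ q₂ h₁ h₂ h₃ => FourBody.exists_reduction_two he₀ he₁ m₂ q₂ h₁ h₂ h₃,
    FourBody.exists_reduction_three he₀ he₁ m₀ q₀ hm₀ hm₀1 hq₀⟩
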